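/- Let $r\ge 1$ and let $\Lambda_r=\Lambda_1\sqcup\dots\sqcup\Lambda_r\subset J^1(\mathbb{R}^2)$ be the $A_r$ link of standard Legendrian unknots (2-spheres), represented by the following front, the spin about the $z$-axis of the front of a Legendrian arc $K_r\subset J^1(\mathbb{R})$ lying over $\{x_1\le 0\}$. The component $\Lambda_j$ has an upper and a lower sheet $z=-\tfrac{128}{125}\,j\pm(1-|x|^2)^{3/2}$ over the unit disc. The sheets of each component meet in a cusp edge over $|x|=1$; the lower sheet $\ell_j$ of $\Lambda_j$ and the upper sheet $u_{j+1}$ of $\Lambda_{j+1}$ cross over the circle $|x|=3/5$; and there are no other crossings or cusps. Decompose the half line $\{x_1\le 0,\ x_2=0\}\cap\{|x|\le 1\}$ into the 0-cells $e^0_1,e^0_2,e^0_3$ at $|x|=1,\tfrac35,0$ and the 1-cells $e^1_2$ (from $e^0_1$ to $e^0_2$) and $e^1_3$ (from $e^0_2$ to $e^0_3$), and decompose the unit disc into these cells and the cells $\check e^0_1,\check e^0_2$ (of dimension 1) and $\check e^1_2,\check e^1_3$ (of dimension 2) swept out when $e^0_1,e^0_2,e^1_2,e^1_3$ are rotated about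 the origin. Let $\Bbbk=\bigoplus_{j=1}^r(\mathbb{Z}/2)e_j$ and let $\mu$ be a Maslov potential on $\Lambda_r$, that is, integers $\mu(u_j),\mu(\ell_j)$ with $\mu(u_j)=\mu(\ell_j)+1$. The cellular dg algebra $\mathcal{C}(\Lambda_r)$ is the dg algebra over $\Bbbk$ freely generated by one generator $e^{S,T}$ for each cell $e$ and each ordered pair of sheets $S,T$ that do not belong to a cusp edge above $e$ and such that $S$ lies above $T$ over all of $e$; if $S\subset\Lambda_v$ and $T\subset\Lambda_w$, then $e^{S,T}=e_v\,e^{S,T}e_w$, and its (cohomological) degree is $\mu(T)-\mu(S)+1-\dim e$. Write $A,B,C$ for the matrices of generators of the $0$-, $1$- and $2$-cells, with rows and columns indexed by the $2r$ sheets and zeros where there is no generator, except that the $(u_j,\ell_j)$ entry is $e_j$ at the $0$-cell $e^0_1$, over which the sheets $u_j,\ell_j$ meet in a cusp. Let $E$ be the identity matrix. The differential is given entrywise on the generators by $$dA=A^2,\qquad dB=A_+(E+B)+(E+B)A_-,\qquad dC=A_+C+CA_-+P_\gamma+P_{\gamma'}.$$ Here $A_-,A_+$ belong to the initial and the terminal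 vertex, $\gamma,\gamma'$ are the two boundary paths of the $2$-cell from its initial to its terminal vertex, and $P_\gamma=(E+B_k)\cdots(E+B_1)$ if $\gamma$ runs through $1$-cells with matrices $B_1,\dots,B_k$ in this order. The cell $\check e^1_2$ has initial vertex $e^0_1$, terminal vertex $e^0_2$ and boundary paths $(\check e^0_1,e^1_2)$ and $(e^1_2,\check e^0_2)$; the cell $\check e^1_3$ has initial vertex $e^0_2$, terminal vertex $e^0_3$ and boundary paths $(\check e^0_2,e^1_3)$ and $(e^1_3)$. Then $\mathcal{C}(\Lambda_r)$ is quasi-isomorphic to a dg algebra over $\Bbbk$ that is freely generated by the following $3r-2$ generators, with the degrees and the $\Bbbk$-bimodule structure that they have in $\mathcal{C}(\Lambda_r)$: - $b_k$ ($1\le k\le r-1$), the generator of the cell $e^1_2$ for the sheets $\ell_k,u_{k+1}$; - $z_j$ ($1\le j\le r$), the generator of the cell $\check e^1_3$ for the sheets $u_j,\ell_j$; - $b^*_k$ ($1\le k\le r-1$), the generator of the cell $\check e^1_3$ for the sheets $u_{k+1},\ell_k$. More precisely, there are a differential on this free algebra and a homomorphism of dg algebras over $\Bbbk$ from $\mathcal{C}(\Lambda_r)$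 to it that is a quasi-isomorphism and maps each of the listed generators of $\mathcal{C}(\Lambda_r)$ to the generator of the same name. (If $r\ge2$ and the sheets are numbered from top to bottom, then these are $b_2^{2,3},b_2^{4,5},\dots,b_2^{2r-2,2r-1}$; $\check b_3^{1,3},\check b_3^{2,5},\check b_3^{4,7},\dots,\check b_3^{2r-4,2r-1},\check b_3^{2r-2,2r}$; $\check b_3^{2,3},\check b_3^{4,5},\dots,\check b_3^{2r-2,2r-1}$.) -/

import Mathlib

/-- A quiver with vertex set `V` and graded arrows. -/
structure GradedQuiver (V : Type) where
  /-- the arrows -/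
  Arrow : Type
  /-- start vertex -/
  src : Arrow → V
  /-- end vertex -/
  tgt : Arrow → V
  /-- degree -/
  deg : Arrow → ℤ

namespace GradedQuiver

/-- The relations of the path algebra of `Q` over `ℤ/2`: the vertices are orthogonal idempotents
with sum `1`, and an arrow `a` from `v` to `w` satisfies `e_v a = a = a e_w` (paths are composed
from left to right). -/
inductive PathRel {V : Type} [Fintype V] (Q : GradedQuiver V) :
    FreeAlgebra (ZMod 2) (V ⊕ Q.Arrow) → FreeAlgebra (ZMod 2) (V ⊕ Q.Arrow) → Prop
  | idem (v : V) : PathRel Q (FreeAlgebra.ι _ (Sum.inl v) * FreeAlgebra.ι _ (Sum.inl v))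
      (FreeAlgebra.ι _ (Sum.inl v))
  | orth (v w : V) (h : v ≠ w) :
      PathRel Q (FreeAlgebra.ι _ (Sum.inl v) * FreeAlgebra.ι _ (Sum.inl w)) 0
  | one : PathRel Q (∑ v : V, FreeAlgebra.ι _ (Sum.inl v)) 1
  | src (a : Q.Arrow) : PathRel Q
      (FreeAlgebra.ι _ (Sum.inl (Q.src a)) * FreeAlgebra.ι _ (Sum.inr a)) (FreeAlgebra.ι _ (Sum.inr a))
  | tgt (a : Q.Arrow) : PathRel Q
      (FreeAlgebra.ι _ (Sum.inr a) * FreeAlgebra.ι _ (Sum.inl (Q.tgt a))) (FreeAlgebra.ι _ (Sum.inr a))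

/-- The path algebra of `Q` over `ℤ/2`, that is, the tensor algebra over `𝕜 = ⨁_v (ℤ/2) e_v` of the
`𝕜`-bimodule spanned by the arrows: the free algebra over `𝕜` on the arrows. -/
def PathAlg {V : Type} [Fintype V] (Q : GradedQuiver V) : Type := RingQuot (PathRel Q)

section PathAlg

variable {V : Type} [Fintype V] (Q : GradedQuiver V)

noncomputable instance : Ring (PathAlg Q) := inferInstanceAs (Ring (RingQuot (PathRel Q)))

noncomputable instance : Algebra (ZMod 2) (PathAlg Q) :=
  inferInstanceAs (Algebra (ZMod 2) (RingQuot (PathRel Q)))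

/-- The quotient map onto the path algebra. -/
noncomputable def proj : FreeAlgebra (ZMod 2) (V ⊕ Q.Arrow) →ₐ[ZMod 2] PathAlg Q :=
  RingQuot.mkAlgHom (ZMod 2) (PathRel Q)

theorem proj_rel {x y : FreeAlgebra (ZMod 2) (V ⊕ Q.Arrow)} (h : PathRel Q x y) :
    Q.proj x = Q.proj y :=
  RingQuot.mkAlgHom_rel (ZMod 2) h

/-- The image of a vertex or an arrow in the path algebra. -/
noncomputable def gen (x : V ⊕ Q.Arrow) : PathAlg Q := Q.proj (FreeAlgebra.ι _ x)

/-- The idempotent `e_v`. -/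
noncomputable def vertex (v : V) : PathAlg Q := Q.gen (Sum.inl v)

/-- An arrow as an element of the path algebra. -/
noncomputable def arrow (a : Q.Arrow) : PathAlg Q := Q.gen (Sum.inr a)

theorem vertex_idem (v : V) : Q.vertex v * Q.vertex v = Q.vertex v := by
  have := Q.proj_rel (PathRel.idem (Q := Q) v)
  rwa [map_mul] at this

theorem vertex_orth (v w : V) (h : v ≠ w) : Q.vertex v * Q.vertex w = 0 := by
  have := Q.proj_rel (PathRel.orth (Q := Q) v w h)
  rwa [map_mul, map_zero] at this

theorem vertex_sum : ∑ v : V, Q.vertex v = 1 := by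
  have := Q.proj_rel (PathRel.one (Q := Q))
  rw [map_sum, map_one] at this
  exact this

theorem vertex_mul_arrow (a : Q.Arrow) : Q.vertex (Q.src a) * Q.arrow a = Q.arrow a := by
  have := Q.proj_rel (PathRel.src (Q := Q) a)
  rwa [map_mul] at this

theorem arrow_mul_vertex (a : Q.Arrow) : Q.arrow a * Q.vertex (Q.tgt a) = Q.arrow a := by
  have := Q.proj_rel (PathRel.tgt (Q := Q) a)
  rwa [map_mul] at this

/-- Universal property of the path algebra. -/
noncomputable def lift {A : Type} [Ring A] [Algebra (ZMod 2) A] (f : V → A) (g : Q.Arrow → A)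
    (idem : ∀ v, f v * f v = f v) (orth : ∀ v w, v ≠ w → f v * f w = 0) (one : ∑ v, f v = 1)
    (src : ∀ a, f (Q.src a) * g a = g a) (tgt : ∀ a, g a * f (Q.tgt a) = g a) :
    PathAlg Q →ₐ[ZMod 2] A :=
  RingQuot.liftAlgHom (ZMod 2) ⟨FreeAlgebra.lift (ZMod 2) (Sum.elim f g), by
    intro x y h
    cases h with
    | idem v => simpa using idem v
    | orth v w h => simpa using orth v w h
    | one => simpa using one
    | src a => simpa using src a
    | tgt a => simpa using tgt a⟩

theorem lift_gen {A : Type} [Ring A] [Algebra (ZMod 2) A] (f : V → A) (g : Q.Arrow → A)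
    (h1 : ∀ v, f v * f v = f v) (h2 : ∀ v w, v ≠ w → f v * f w = 0) (h3 : ∑ v, f v = 1)
    (h4 : ∀ a, f (Q.src a) * g a = g a) (h5 : ∀ a, g a * f (Q.tgt a) = g a) (x : V ⊕ Q.Arrow) :
    Q.lift f g h1 h2 h3 h4 h5 (Q.gen x) = Sum.elim f g x := by
  refine (RingQuot.liftAlgHom_mkAlgHom_apply _ _ _ _).trans ?_
  simp

theorem algHom_ext {A : Type} [Ring A] [Algebra (ZMod 2) A] {f g : PathAlg Q →ₐ[ZMod 2] A}
    (h : ∀ x, f (Q.gen x) = g (Q.gen x)) : f = g := by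
  apply RingQuot.ringQuot_ext'
  apply FreeAlgebra.hom_ext
  funext x
  exact h x

/-- Degree of a vertex (zero) or an arrow. -/
def genDeg (x : V ⊕ Q.Arrow) : ℤ := Sum.elim (fun _ => 0) Q.deg x

/-- The homogeneous elements of degree `n`: the span of the paths of total degree `n`. -/
noncomputable def grading (n : ℤ) : Submodule (ZMod 2) (PathAlg Q) :=
  Submodule.span (ZMod 2)
    {x | ∃ w : List (V ⊕ Q.Arrow), (w.map Q.genDeg).sum = n ∧ (w.map Q.gen).prod = x}

theorem word_mem (w : List (V ⊕ Q.Arrow)) :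
    (w.map Q.gen).prod ∈ Q.grading (w.map Q.genDeg).sum :=
  Submodule.subset_span ⟨w, rfl, rfl⟩

theorem gen_mem (x : V ⊕ Q.Arrow) : Q.gen x ∈ Q.grading (Q.genDeg x) := by
  simpa using Q.word_mem [x]

theorem vertex_mem (v : V) : Q.vertex v ∈ Q.grading 0 := Q.gen_mem (Sum.inl v)

theorem arrow_mem (a : Q.Arrow) : Q.arrow a ∈ Q.grading (Q.deg a) := Q.gen_mem (Sum.inr a)

instance : SetLike.GradedMonoid Q.grading where
  one_mem := by simpa using Q.word_mem []
  mul_mem := by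
    intro i j x y hx hy
    have : x * y ∈ Q.grading i * Q.grading j := Submodule.mul_mem_mul hx hy
    refine (?_ : Q.grading i * Q.grading j ≤ Q.grading (i + j)) this
    rw [grading, grading, Submodule.span_mul_span]
    refine Submodule.span_le.2 ?_
    rintro _ ⟨_, ⟨w, rfl, rfl⟩, _, ⟨w', rfl, rfl⟩, rfl⟩
    simpa using Q.word_mem (w ++ w')

/-- The map to the direct sum of the graded pieces. -/
noncomputable def toSum : PathAlg Q →ₐ[ZMod 2] DirectSum ℤ (fun i => Q.grading i) :=
  Q.lift
    (fun v => DirectSum.of (fun i => Q.grading i) 0 ⟨Q.vertex v, Q.vertex_mem v⟩)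
    (fun a => DirectSum.of (fun i => Q.grading i) (Q.deg a) ⟨Q.arrow a, Q.arrow_mem a⟩)
    (by
      intro v
      rw [DirectSum.of_mul_of]
      exact DirectSum.of_eq_of_gradedMonoid_eq (Sigma.subtype_ext (zero_add _) (Q.vertex_idem v)))
    (by
      intro v w h
      rw [DirectSum.of_mul_of]
      refine (congrArg _ ?_).trans (map_zero (DirectSum.of (fun i => Q.grading i) (0 + 0)))
      exact Subtype.ext (Q.vertex_orth v w h))
    (by
      rw [← map_sum, DirectSum.one_def]
      congr 1
      apply Subtype.ext
      simpa using Q.vertex_sum)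
    (by
      intro a
      rw [DirectSum.of_mul_of]
      exact DirectSum.of_eq_of_gradedMonoid_eq (Sigma.subtype_ext (zero_add _) (Q.vertex_mul_arrow a)))
    (by
      intro a
      rw [DirectSum.of_mul_of]
      exact DirectSum.of_eq_of_gradedMonoid_eq (Sigma.subtype_ext (add_zero _) (Q.arrow_mul_vertex a)))

theorem toSum_gen (x : V ⊕ Q.Arrow) :
    Q.toSum (Q.gen x) = DirectSum.of (fun i => Q.grading i) (Q.genDeg x) ⟨Q.gen x, Q.gen_mem x⟩ := by
  rw [toSum, lift_gen]
  cases x <;> rfl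

theorem toSum_word (w : List (V ⊕ Q.Arrow)) : Q.toSum (w.map Q.gen).prod =
    DirectSum.of (fun i => Q.grading i) _ ⟨(w.map Q.gen).prod, Q.word_mem w⟩ := by
  induction w with
  | nil =>
    simp only [List.map_nil, List.prod_nil, map_one]
    rfl
  | cons x w ih =>
    simp only [List.map_cons, List.prod_cons, map_mul, ih, toSum_gen, DirectSum.of_mul_of]
    rfl

noncomputable instance : GradedAlgebra Q.grading :=
  GradedAlgebra.ofAlgHom Q.grading Q.toSum
    (by
      apply Q.algHom_ext
      intro x
      simp [toSum_gen])
    (by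
      rintro i ⟨x, hx⟩
      refine Submodule.span_induction (p := fun x hx => Q.toSum x =
        DirectSum.of (fun i => Q.grading i) i ⟨x, hx⟩) ?_ ?_ ?_ ?_ hx
      · rintro _ ⟨w, rfl, rfl⟩
        exact Q.toSum_word w
      · rw [map_zero]
        exact (map_zero (DirectSum.of (fun i => Q.grading i) i)).symm
      · intro x y hx hy h1 h2
        rw [map_add, h1, h2, ← map_add]
        rfl
      · intro c x hx h
        rw [map_smul, h]
        exact (map_smul (DirectSum.lof (ZMod 2) ℤ (fun i => Q.grading i) i) c ⟨x, hx⟩).symm)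

/-- The derivation of the path algebra that kills the vertices and has prescribed values on the
arrows (signs play no role over `ℤ/2`). -/
noncomputable def derivHom (δ : Q.Arrow → PathAlg Q)
    (hs : ∀ a, Q.vertex (Q.src a) * δ a = δ a) (ht : ∀ a, δ a * Q.vertex (Q.tgt a) = δ a) :
    PathAlg Q →ₐ[ZMod 2] TrivSqZeroExt (PathAlg Q) (PathAlg Q) :=
  Q.lift (fun v => TrivSqZeroExt.inl (Q.vertex v))
    (fun a => TrivSqZeroExt.inl (Q.arrow a) + TrivSqZeroExt.inr (δ a))
    (fun v => by rw [TrivSqZeroExt.inl_mul_inl, vertex_idem])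
    (fun v w h => by rw [TrivSqZeroExt.inl_mul_inl, vertex_orth Q v w h, TrivSqZeroExt.inl_zero])
    (by
      rw [← TrivSqZeroExt.inl_sum, vertex_sum, TrivSqZeroExt.inl_one])
    (fun a => by
      apply TrivSqZeroExt.ext <;> simp [vertex_mul_arrow, hs])
    (fun a => by
      apply TrivSqZeroExt.ext <;> simp [arrow_mul_vertex, ht])

theorem derivHom_fst (δ : Q.Arrow → PathAlg Q)
    (hs : ∀ a, Q.vertex (Q.src a) * δ a = δ a) (ht : ∀ a, δ a * Q.vertex (Q.tgt a) = δ a)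
    (x : PathAlg Q) : (Q.derivHom δ hs ht x).fst = x := by
  have : (TrivSqZeroExt.fstHom (ZMod 2) (PathAlg Q) (PathAlg Q)).comp (Q.derivHom δ hs ht) =
      AlgHom.id (ZMod 2) _ := by
    apply Q.algHom_ext
    intro x
    rw [AlgHom.comp_apply, derivHom, lift_gen]
    cases x <;> simp [vertex, arrow]
  exact DFunLike.congr_fun this x

/-- The derivation with prescribed values on the arrows. -/
noncomputable def deriv (δ : Q.Arrow → PathAlg Q)
    (hs : ∀ a, Q.vertex (Q.src a) * δ a = δ a) (ht : ∀ a, δ a * Q.vertex (Q.tgt a) = δ a) :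
    PathAlg Q →ₗ[ZMod 2] PathAlg Q :=
  (TrivSqZeroExt.sndHom (PathAlg Q) (PathAlg Q)).restrictScalars (ZMod 2) ∘ₗ
    (Q.derivHom δ hs ht).toLinearMap

section deriv

variable (δ : Q.Arrow → PathAlg Q)
    (hs : ∀ a, Q.vertex (Q.src a) * δ a = δ a) (ht : ∀ a, δ a * Q.vertex (Q.tgt a) = δ a)

theorem deriv_mul (x y : PathAlg Q) :
    Q.deriv δ hs ht (x * y) = Q.deriv δ hs ht x * y + x * Q.deriv δ hs ht y := by
  simp [deriv, derivHom_fst, add_comm]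

theorem deriv_vertex (v : V) : Q.deriv δ hs ht (Q.vertex v) = 0 := by
  simp [deriv, derivHom, vertex, lift_gen]

theorem deriv_arrow (a : Q.Arrow) : Q.deriv δ hs ht (Q.arrow a) = δ a := by
  simp [deriv, derivHom, arrow, lift_gen]

theorem deriv_one : Q.deriv δ hs ht 1 = 0 := by
  rw [← Q.vertex_sum, map_sum]
  exact Finset.sum_eq_zero fun v _ => Q.deriv_vertex δ hs ht v

theorem deriv_degree (hd : ∀ a, δ a ∈ Q.grading (Q.deg a + 1)) (n : ℤ) (x : PathAlg Q)
    (hx : x ∈ Q.grading n) : Q.deriv δ hs ht x ∈ Q.grading (n + 1) := by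
  have hw : ∀ w : List (V ⊕ Q.Arrow),
      Q.deriv δ hs ht (w.map Q.gen).prod ∈ Q.grading ((w.map Q.genDeg).sum + 1) := by
    intro w
    induction w with
    | nil => simp [deriv_one]
    | cons x w ih =>
      have hx : Q.deriv δ hs ht (Q.gen x) ∈ Q.grading (Q.genDeg x + 1) := by
        cases x with
        | inl v =>
          have := Q.deriv_vertex δ hs ht v
          rw [vertex] at this
          rw [this]
          exact zero_mem _
        | inr a =>
          have := Q.deriv_arrow δ hs ht a
          rw [arrow] at this
          rw [this]
          exact hd a
      simp only [List.map_cons, List.prod_cons, List.sum_cons, deriv_mul]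
      refine add_mem ?_ ?_
      · have := SetLike.mul_mem_graded hx (Q.word_mem w)
        convert this using 2
        ring
      · have := SetLike.mul_mem_graded (Q.gen_mem x) ih
        convert this using 2
        ring
  refine Submodule.span_induction (p := fun x _ => Q.deriv δ hs ht x ∈ Q.grading (n + 1))
    ?_ ?_ ?_ ?_ hx
  · rintro _ ⟨w, rfl, rfl⟩
    exact hw w
  · simp
  · intro x y _ _ h1 h2
    rw [map_add]
    exact add_mem h1 h2
  · intro c x _ h
    rw [map_smul]
    exact Submodule.smul_mem _ c h

theorem deriv_sq (h : ∀ a, Q.deriv δ hs ht (δ a) = 0) (x : PathAlg Q) :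
    Q.deriv δ hs ht (Q.deriv δ hs ht x) = 0 := by
  have hw : ∀ w : List (V ⊕ Q.Arrow),
      Q.deriv δ hs ht (Q.deriv δ hs ht (w.map Q.gen).prod) = 0 := by
    intro w
    induction w with
    | nil => simp [deriv_one]
    | cons x w ih =>
      have hx : Q.deriv δ hs ht (Q.deriv δ hs ht (Q.gen x)) = 0 := by
        cases x with
        | inl v =>
          have := Q.deriv_vertex δ hs ht v
          rw [vertex] at this
          rw [this, map_zero]
        | inr a =>
          have := Q.deriv_arrow δ hs ht a
          rw [arrow] at this
          rw [this, h]
      simp only [List.map_cons, List.prod_cons, deriv_mul, map_add, hx, ih, zero_mul, mul_zero,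
        zero_add, add_zero]
      rw [← two_smul (ZMod 2)]
      have : (2 : ZMod 2) = 0 := rfl
      rw [this, zero_smul]
  have hn : ∀ n, ∀ x ∈ Q.grading n, Q.deriv δ hs ht (Q.deriv δ hs ht x) = 0 := by
    intro n x hx
    refine Submodule.span_induction
      (p := fun x _ => Q.deriv δ hs ht (Q.deriv δ hs ht x) = 0) ?_ ?_ ?_ ?_ hx
    · rintro _ ⟨w, rfl, rfl⟩
      exact hw w
    · simp
    · intro x y _ _ h1 h2
      simp [h1, h2]
    · intro c x _ h
      simp [h]
  refine DirectSum.Decomposition.inductionOn Q.grading (by simp) (fun m => hn _ m m.2) ?_ x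
  intro x y h1 h2
  simp [h1, h2]

end deriv

end PathAlg

/-- A differential on the path algebra: a derivation of degree `1` that kills the vertices and
squares to zero. -/
structure Differential {V : Type} [Fintype V] (Q : GradedQuiver V) where
  /-- the underlying linear map -/
  toMap : PathAlg Q →ₗ[ZMod 2] PathAlg Q
  leibniz : ∀ x y, toMap (x * y) = toMap x * y + x * toMap y
  map_vertex : ∀ v, toMap (Q.vertex v) = 0
  degree : ∀ n, ∀ x ∈ Q.grading n, toMap x ∈ Q.grading (n + 1)
  sq : ∀ x, toMap (toMap x) = 0

end GradedQuiver

/-- A (cohomologically graded) dg algebra over the semisimple ring `𝕜 = ⨁_{v ∈ V} (ℤ/2) e_v`. Over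
`ℤ/2` the sign in the graded Leibniz rule is trivial. -/
structure DGAlgebra (V : Type) [Fintype V] where
  /-- the underlying algebra -/
  Carrier : Type
  [ring : Ring Carrier]
  [algebra : Algebra (ZMod 2) Carrier]
  /-- the idempotents `e_v` -/
  e : V → Carrier
  e_idem : ∀ v, e v * e v = e v
  e_orth : ∀ v w, v ≠ w → e v * e w = 0
  e_sum : ∑ v, e v = 1
  /-- the grading -/
  grading : ℤ → Submodule (ZMod 2) Carrier
  [graded : GradedAlgebra grading]
  e_mem : ∀ v, e v ∈ grading 0
  /-- the differential -/
  d : Carrier →ₗ[ZMod 2] Carrier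
  d_mem : ∀ n, ∀ x ∈ grading n, d x ∈ grading (n + 1)
  leibniz : ∀ x y, d (x * y) = d x * y + x * d y
  d_e : ∀ v, d (e v) = 0
  d_d : ∀ x, d (d x) = 0

namespace DGAlgebra

attribute [instance] DGAlgebra.ring DGAlgebra.algebra

variable {V : Type} [Fintype V]

/-- The cohomology `ker d / im d` (the direct sum over all degrees). -/
abbrev Cohomology (A : DGAlgebra V) : Type :=
  LinearMap.ker A.d ⧸ (LinearMap.range A.d).submoduleOf (LinearMap.ker A.d)

/-- A homomorphism of dg algebras over `𝕜`. -/
structure Hom (A B : DGAlgebra V) where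
  /-- the underlying algebra homomorphism -/
  toAlgHom : A.Carrier →ₐ[ZMod 2] B.Carrier
  map_e : ∀ v, toAlgHom (A.e v) = B.e v
  map_grading : ∀ n, ∀ x ∈ A.grading n, toAlgHom x ∈ B.grading n
  map_d : ∀ x, toAlgHom (A.d x) = B.d (toAlgHom x)

/-- The induced map on cocycles. -/
def Hom.onCocycles {A B : DGAlgebra V} (φ : A.Hom B) :
    LinearMap.ker A.d →ₗ[ZMod 2] LinearMap.ker B.d :=
  φ.toAlgHom.toLinearMap.restrict (by
    intro x hx
    rw [LinearMap.mem_ker] at hx ⊢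
    rw [AlgHom.toLinearMap_apply, ← φ.map_d, hx, map_zero])

/-- The induced map on cohomology. -/
def Hom.onCohomology {A B : DGAlgebra V} (φ : A.Hom B) :
    A.Cohomology →ₗ[ZMod 2] B.Cohomology :=
  Submodule.mapQ _ _ φ.onCocycles (by
    rintro ⟨x, hx⟩ ⟨y, hy⟩
    exact ⟨φ.toAlgHom y, (φ.map_d y).symm.trans (congrArg φ.toAlgHom hy)⟩)

/-- A quasi-isomorphism is a homomorphism that is bijective on cohomology. -/
def Hom.IsQuasiIso {A B : DGAlgebra V} (φ : A.Hom B) : Prop :=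
  Function.Bijective φ.onCohomology

end DGAlgebra

/-- The dg algebra freely generated over `𝕜` by the arrows of `Q`, with differential `D`. -/
noncomputable def GradedQuiver.Differential.dgAlgebra {V : Type} [Fintype V] {Q : GradedQuiver V}
    (D : Q.Differential) : DGAlgebra V where
  Carrier := Q.PathAlg
  e := Q.vertex
  e_idem := Q.vertex_idem
  e_orth := Q.vertex_orth
  e_sum := Q.vertex_sum
  grading := Q.grading
  e_mem := Q.vertex_mem
  d := D.toMap
  d_mem := D.degree
  leibniz := D.leibniz
  d_e := D.map_vertex
  d_d := D.sq

namespace ALink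

/-! The front of `Λ_r` over the plane. The component `j` is the standard Legendrian unknot ("flying
saucer") shifted down by `j` times `128/125`: it has an upper sheet `z = -(128/125) j + (1 - |x|²)^{3/2}`
and a lower sheet `z = -(128/125) j - (1 - |x|²)^{3/2}` over the closed unit disc, which meet in a cusp edge
over the unit circle. The front is the rotation about the `z`-axis of its part over the half line
`x₁ ≤ 0, x₂ = 0`, the front of the Legendrian arc `K_r`. Consecutive components cross, the lower
sheet of `j` with the upper sheet of `j + 1`, and all crossings lie over the circle of radius `3/5`;
nonconsecutive components do not meet. -/

/-- The sheets: `(j, true)` is the upper and `(j, false)` the lower sheet of the component `j`. -/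
abbrev Sheet (r : ℕ) : Type := Fin r × Bool

/-- The upper sheet of a component. -/
abbrev upper {r : ℕ} (j : Fin r) : Sheet r := (j, true)

/-- The lower sheet of a component. -/
abbrev lower {r : ℕ} (j : Fin r) : Sheet r := (j, false)

/-- The `z`-coordinate of a sheet as a function of the base point. -/
noncomputable def height {r : ℕ} (s : Sheet r) (x : EuclideanSpace ℝ (Fin 2)) : ℝ :=
  -(128 / 125) * (s.1 : ℕ) + (if s.2 then 1 else -1) * Real.sqrt (1 - ‖x‖ ^ 2) ^ 3

/-- The closed half line `x₁ ≤ 0, x₂ = 0`, over which the front of `K_r` lies. -/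
def halfLine : Set (EuclideanSpace ℝ (Fin 2)) := {x | x 0 ≤ 0 ∧ x 1 = 0}

/-- The cells of the polygonal decomposition of the closed unit disc. The cells `v₁, v₂, v₃, e₂, e₃`
are the cells of the half line, and the others are swept out when `v₁, v₂, e₂, e₃` are rotated about
the origin. -/
inductive Cell
  | v₁ | v₂ | v₃ | e₂ | e₃ | c₁ | c₂ | f₂ | f₃

namespace Cell

/-- The dimension of a cell. -/
def dim : Cell → ℤ
  | v₁ | v₂ | v₃ => 0
  | e₂ | e₃ | c₁ | c₂ => 1
  | f₂ | f₃ => 2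

/-- The cell as a subset of the plane. -/
def carrier : Cell → Set (EuclideanSpace ℝ (Fin 2))
  | v₁ => {x | x ∈ halfLine ∧ ‖x‖ = 1}
  | v₂ => {x | x ∈ halfLine ∧ ‖x‖ = 3 / 5}
  | v₃ => {x | ‖x‖ = 0}
  | e₂ => {x | x ∈ halfLine ∧ 3 / 5 < ‖x‖ ∧ ‖x‖ < 1}
  | e₃ => {x | x ∈ halfLine ∧ 0 < ‖x‖ ∧ ‖x‖ < 3 / 5}
  | c₁ => {x | x ∉ halfLine ∧ ‖x‖ = 1}
  | c₂ => {x | x ∉ halfLine ∧ ‖x‖ = 3 / 5}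
  | f₂ => {x | x ∉ halfLine ∧ 3 / 5 < ‖x‖ ∧ ‖x‖ < 1}
  | f₃ => {x | x ∉ halfLine ∧ 0 < ‖x‖ ∧ ‖x‖ < 3 / 5}

end Cell

/-- The two sheets of the component `j` meet in a cusp above the cell `c`. -/
def IsCusp {r : ℕ} (c : Cell) (j : Fin r) : Prop :=
  ∀ x ∈ c.carrier, height (upper j) x = height (lower j) x

/-- The partial order `m ≺ n` on the sheets above a cell: neither `m` nor `n` belongs to a cusp edge
above `c`, and `m` lies above `n` over all of `c`. -/
def Prec {r : ℕ} (c : Cell) (m n : Sheet r) : Prop :=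
  ¬ IsCusp c m.1 ∧ ¬ IsCusp c n.1 ∧ ∀ x ∈ c.carrier, height n x < height m x

/-- A Maslov potential on `Λ_r`: it increases by `1` from the lower to the upper sheet of each
component. -/
structure MaslovPotential (r : ℕ) where
  /-- the value on each sheet -/
  val : Sheet r → ℤ
  cusp : ∀ j, val (upper j) = val (lower j) + 1

/-- The generators of the cellular dg algebra: one for each cell and each pair of sheets `m ≺ n`
above it. -/
structure CellGen (r : ℕ) where
  /-- the cell -/
  cell : Cell
  /-- the first sheet -/
  fst : Sheet r
  /-- the second sheet -/
  snd : Sheet r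
  prec : Prec cell fst snd

/-- The generators as arrows between the components of the link, with their degrees
`μ(S_n) - μ(S_m) + 1 - dim`. -/
def cellQuiver (r : ℕ) (μ : MaslovPotential r) : GradedQuiver (Fin r) where
  Arrow := CellGen r
  src g := g.fst.1
  tgt g := g.snd.1
  deg g := μ.val g.snd - μ.val g.fst + 1 - g.cell.dim

section differential

variable {r : ℕ} (μ : MaslovPotential r)

/-- Matrices over the path algebra indexed by the sheets. -/
abbrev Mat : Type := Matrix (Sheet r) (Sheet r) (cellQuiver r μ).PathAlg

open Classical in
/-- The matrix of a cell: the entry at `m ≺ n` is the corresponding generator; over a `0`-cell, the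
entry at the upper and the lower sheet of a component `j` that has a cusp there is `e_j`; all other
entries vanish. -/
noncomputable def cellMatrix (c : Cell) : Mat μ := fun m n =>
  if h : Prec c m n then (cellQuiver r μ).arrow ⟨c, m, n, h⟩
  else if c.dim = 0 ∧ IsCusp c m.1 ∧ m = upper m.1 ∧ n = lower m.1 then
    (cellQuiver r μ).vertex m.1
  else 0

/-- `d B = A₊ (E + B) + (E + B) A₋` for a `1`-cell. -/
noncomputable def edgeFormula (B Aplus Aminus : Mat μ) : Mat μ :=
  Aplus * (1 + B) + (1 + B) * Aminus

/-- The product `(E + B_k) ⋯ (E + B_1)` along a path of positively oriented `1`-cells. -/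
noncomputable def pathProduct (l : List (Mat μ)) : Mat μ :=
  l.foldl (fun P B => (1 + B) * P) 1

/-- `d C = A₊ C + C A₋ +` the products along the two boundary paths, for a `2`-cell. -/
noncomputable def faceFormula (C Aplus Aminus : Mat μ) (γ γ' : List (Mat μ)) : Mat μ :=
  Aplus * C + C * Aminus + pathProduct μ γ + pathProduct μ γ'

/-- The matrix of the differentials of the generators of a cell. The edges `e₂ : v₁ → v₂` and
`e₃ : v₂ → v₃` are oriented towards the origin, `c₁` and `c₂` are loops at `v₁` and `v₂`. The slit
annulus `f₂` is a square with initial vertex `v₁`, terminal vertex `v₂` and boundary paths `c₁, e₂`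
and `e₂, c₂`; the slit disc `f₃` is a triangle with initial vertex `v₂`, terminal vertex `v₃` and
boundary paths `c₂, e₃` and `e₃`. -/
noncomputable def cellDiff : Cell → Mat μ
  | .v₁ => cellMatrix μ .v₁ ^ 2
  | .v₂ => cellMatrix μ .v₂ ^ 2
  | .v₃ => cellMatrix μ .v₃ ^ 2
  | .e₂ => edgeFormula μ (cellMatrix μ .e₂) (cellMatrix μ .v₂) (cellMatrix μ .v₁)
  | .e₃ => edgeFormula μ (cellMatrix μ .e₃) (cellMatrix μ .v₃) (cellMatrix μ .v₂)
  | .c₁ => edgeFormula μ (cellMatrix μ .c₁) (cellMatrix μ .v₁) (cellMatrix μ .v₁)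
  | .c₂ => edgeFormula μ (cellMatrix μ .c₂) (cellMatrix μ .v₂) (cellMatrix μ .v₂)
  | .f₂ => faceFormula μ (cellMatrix μ .f₂) (cellMatrix μ .v₂) (cellMatrix μ .v₁)
      [cellMatrix μ .c₁, cellMatrix μ .e₂] [cellMatrix μ .e₂, cellMatrix μ .c₂]
  | .f₃ => faceFormula μ (cellMatrix μ .f₃) (cellMatrix μ .v₃) (cellMatrix μ .v₂)
      [cellMatrix μ .c₂, cellMatrix μ .e₃] [cellMatrix μ .e₃]

end differential

/-! The order of the sheets above each cell. -/

/-- The order just outside the crossing circle. -/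
def OuterRel {r : ℕ} (m n : Sheet r) : Prop :=
  m.1 < n.1 ∨ (m.1 = n.1 ∧ m.2 = true ∧ n.2 = false)

/-- The order over the crossing circle. -/
def CrossRel {r : ℕ} (m n : Sheet r) : Prop :=
  OuterRel m n ∧ ¬ ((n.1 : ℕ) = m.1 + 1 ∧ m.2 = false ∧ n.2 = true)

/-- The order inside the crossing circle. -/
def InnerRel {r : ℕ} (m n : Sheet r) : Prop :=
  CrossRel m n ∨ ((m.1 : ℕ) = n.1 + 1 ∧ m.2 = true ∧ n.2 = false)

/-- The order of the sheets above each cell, spelled out. -/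
def CellRel {r : ℕ} : Cell → Sheet r → Sheet r → Prop
  | .v₁, _, _ | .c₁, _, _ => False
  | .v₂, m, n | .c₂, m, n => CrossRel m n
  | .e₂, m, n | .f₂, m, n => OuterRel m n
  | .v₃, m, n | .e₃, m, n | .f₃, m, n => InnerRel m n

/-- The profile of the standard unknot. -/
noncomputable def profile (ρ : ℝ) : ℝ := Real.sqrt (1 - ρ ^ 2) ^ 3

theorem height_eq {r : ℕ} (s : Sheet r) (x : EuclideanSpace ℝ (Fin 2)) :
    height s x = -(128 / 125) * ((s.1 : ℕ) : ℝ) + (if s.2 then 1 else -1) * profile ‖x‖ := rfl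

theorem profile_one : profile 1 = 0 := by simp [profile]

theorem profile_zero : profile 0 = 1 := by simp [profile]

theorem profile_cross : profile (3 / 5) = 64 / 125 := by
  have : (1 - (3 / 5 : ℝ) ^ 2) = (4 / 5) ^ 2 := by norm_num
  rw [profile, this, Real.sqrt_sq (by norm_num)]
  norm_num

theorem profile_lt {a b : ℝ} (ha : 0 ≤ a) (hab : a < b) (hb : b ≤ 1) : profile b < profile a := by
  unfold profile
  have : Real.sqrt (1 - b ^ 2) < Real.sqrt (1 - a ^ 2) :=
    Real.sqrt_lt_sqrt (by nlinarith) (by nlinarith)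
  exact pow_lt_pow_left₀ this (Real.sqrt_nonneg _) (by norm_num)

/-- The radii of the points of a cell. -/
def radii : Cell → Set ℝ
  | .v₁ | .c₁ => {1}
  | .v₂ | .c₂ => {3 / 5}
  | .e₂ | .f₂ => Set.Ioo (3 / 5) 1
  | .v₃ => {0}
  | .e₃ | .f₃ => Set.Ioo 0 (3 / 5)

theorem norm_mem_radii {c : Cell} {x : EuclideanSpace ℝ (Fin 2)} (hx : x ∈ c.carrier) :
    ‖x‖ ∈ radii c := by
  cases c <;> simp_all [Cell.carrier, radii]

theorem exists_norm_eq {c : Cell} {ρ : ℝ} (hρ : ρ ∈ radii c) : ∃ x ∈ c.carrier, ‖x‖ = ρ := by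
  have h0 : 0 ≤ ρ := by
    cases c <;> simp [radii] at hρ <;> linarith
  have n1 : ‖(!₂[-ρ, 0] : EuclideanSpace ℝ (Fin 2))‖ = ρ := by
    simp [EuclideanSpace.norm_eq, Real.sqrt_sq h0]
  have n2 : ‖(!₂[ρ, 0] : EuclideanSpace ℝ (Fin 2))‖ = ρ := by
    simp [EuclideanSpace.norm_eq, Real.sqrt_sq h0]
  have m1 : (!₂[-ρ, 0] : EuclideanSpace ℝ (Fin 2)) ∈ halfLine := by
    simp [halfLine, h0]
  have m2 : 0 < ρ → (!₂[ρ, 0] : EuclideanSpace ℝ (Fin 2)) ∉ halfLine := by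
    intro h
    simp [halfLine, h]
  cases c
  case c₁ | c₂ | f₂ | f₃ =>
    refine ⟨!₂[ρ, 0], ?_, n2⟩
    simp only [radii, Set.mem_singleton_iff, Set.mem_Ioo] at hρ
    simp only [Cell.carrier, Set.mem_ofPred_eq, n2]
    refine ⟨m2 ?_, hρ⟩
    linarith
  all_goals
    refine ⟨!₂[-ρ, 0], ?_, n1⟩
    simp only [radii, Set.mem_singleton_iff, Set.mem_Ioo] at hρ
    simp only [Cell.carrier, Set.mem_ofPred_eq, n1, m1, true_and]
    exact hρ

theorem isCusp_iff {r : ℕ} (c : Cell) (j : Fin r) : IsCusp c j ↔ c = .v₁ ∨ c = .c₁ := by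
  have key : IsCusp c j ↔ ∀ ρ ∈ radii c, profile ρ = 0 := by
    constructor
    · intro h ρ hρ
      obtain ⟨x, hx, rfl⟩ := exists_norm_eq hρ
      have := h x hx
      simp only [height_eq] at this
      simp at this
      linarith
    · intro h x hx
      simp [height_eq, h _ (norm_mem_radii hx)]
  rw [key]
  have hp : ∀ ρ : ℝ, 0 ≤ ρ → ρ < 1 → profile ρ ≠ 0 := by
    intro ρ h0 h1
    have := profile_lt h0 h1 le_rfl
    rw [profile_one] at this
    exact this.ne'
  cases c
  case v₁ | c₁ => simp [radii, profile_one]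
  case v₂ | c₂ | v₃ => simpa [radii] using hp _ (by norm_num) (by norm_num)
  case e₂ | f₂ =>
    simp only [reduceCtorEq, or_self, iff_false]
    exact fun h => hp (4 / 5) (by norm_num) (by norm_num) (h _ (by simp [radii]; norm_num))
  case e₃ | f₃ =>
    simp only [reduceCtorEq, or_self, iff_false]
    exact fun h => hp (1 / 5) (by norm_num) (by norm_num) (h _ (by simp [radii]; norm_num))

theorem height_outer {r : ℕ} (m n : Sheet r) (g : ℝ) (h0 : 0 < g) (h1 : g < 64 / 125) :
    -(128 / 125) * ((n.1 : ℕ) : ℝ) + (if n.2 then 1 else -1) * g <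
      -(128 / 125) * ((m.1 : ℕ) : ℝ) + (if m.2 then 1 else -1) * g ↔ OuterRel m n := by
  obtain ⟨⟨a, ha⟩, s⟩ := m
  obtain ⟨⟨b, hb⟩, t⟩ := n
  have h : b = a ∨ a + 1 ≤ b ∨ b + 1 ≤ a := by omega
  simp only [OuterRel, Fin.lt_def, Fin.mk.injEq]
  rcases h with h | h | h
  · subst h
    cases s <;> cases t <;> simp <;> linarith
  · have h' : (a : ℝ) + 1 ≤ b := by exact_mod_cast h
    exact iff_of_true (by cases s <;> cases t <;> simp <;> linarith) (Or.inl (by omega))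
  · have h' : (b : ℝ) + 1 ≤ a := by exact_mod_cast h
    exact iff_of_false (by cases s <;> cases t <;> simp <;> linarith) (by omega)

theorem height_cross {r : ℕ} (m n : Sheet r) :
    -(128 / 125) * ((n.1 : ℕ) : ℝ) + (if n.2 then 1 else -1) * (64 / 125) <
      -(128 / 125) * ((m.1 : ℕ) : ℝ) + (if m.2 then 1 else -1) * (64 / 125) ↔ CrossRel m n := by
  obtain ⟨⟨a, ha⟩, s⟩ := m
  obtain ⟨⟨b, hb⟩, t⟩ := n
  have h : b = a ∨ b = a + 1 ∨ a + 2 ≤ b ∨ b + 1 ≤ a := by omega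
  simp only [CrossRel, OuterRel, Fin.lt_def, Fin.mk.injEq]
  rcases h with h | h | h | h
  · subst h
    cases s <;> cases t <;> simp <;> linarith
  · subst h
    cases s <;> cases t <;> simp <;> linarith
  · have h' : (a : ℝ) + 2 ≤ b := by exact_mod_cast h
    exact iff_of_true (by cases s <;> cases t <;> simp <;> linarith)
      ⟨Or.inl (by omega), by omega⟩
  · have h' : (b : ℝ) + 1 ≤ a := by exact_mod_cast h
    exact iff_of_false (by cases s <;> cases t <;> simp <;> linarith) (by omega)

theorem height_inner {r : ℕ} (m n : Sheet r) (g : ℝ) (h0 : 64 / 125 < g) (h1 : g ≤ 1) :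
    -(128 / 125) * ((n.1 : ℕ) : ℝ) + (if n.2 then 1 else -1) * g <
      -(128 / 125) * ((m.1 : ℕ) : ℝ) + (if m.2 then 1 else -1) * g ↔ InnerRel m n := by
  obtain ⟨⟨a, ha⟩, s⟩ := m
  obtain ⟨⟨b, hb⟩, t⟩ := n
  have h : b = a ∨ b = a + 1 ∨ a + 2 ≤ b ∨ a = b + 1 ∨ b + 2 ≤ a := by omega
  simp only [InnerRel, CrossRel, OuterRel, Fin.lt_def, Fin.mk.injEq]
  rcases h with h | h | h | h | h
  · subst h
    cases s <;> cases t <;> simp <;> linarith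
  · subst h
    cases s <;> cases t <;> simp <;> linarith
  · have h' : (a : ℝ) + 2 ≤ b := by exact_mod_cast h
    exact iff_of_true (by cases s <;> cases t <;> simp <;> linarith)
      (Or.inl ⟨Or.inl (by omega), by omega⟩)
  · subst h
    cases s <;> cases t <;> simp <;> linarith
  · have h' : (b : ℝ) + 2 ≤ a := by exact_mod_cast h
    exact iff_of_false (by cases s <;> cases t <;> simp <;> linarith) (by omega)

theorem profile_outer {ρ : ℝ} (h : ρ ∈ Set.Ioo (3 / 5 : ℝ) 1) :
    0 < profile ρ ∧ profile ρ < 64 / 125 := by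
  have h1 := profile_lt (by linarith [h.1]) h.2 le_rfl
  have h2 := profile_lt (by norm_num) h.1 h.2.le
  rw [profile_one] at h1
  rw [profile_cross] at h2
  exact ⟨h1, h2⟩

theorem profile_inner {ρ : ℝ} (h : ρ ∈ Set.Ioo (0 : ℝ) (3 / 5)) :
    64 / 125 < profile ρ ∧ profile ρ ≤ 1 := by
  have h1 := profile_lt h.1.le h.2 (by norm_num)
  have h2 := profile_lt le_rfl h.1 (by linarith [h.2])
  rw [profile_cross] at h1
  rw [profile_zero] at h2
  exact ⟨h1, h2.le⟩

theorem height_radii {r : ℕ} (c : Cell) (hc : ¬ (c = .v₁ ∨ c = .c₁)) (m n : Sheet r) (ρ : ℝ)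
    (hρ : ρ ∈ radii c) :
    -(128 / 125) * ((n.1 : ℕ) : ℝ) + (if n.2 then 1 else -1) * profile ρ <
      -(128 / 125) * ((m.1 : ℕ) : ℝ) + (if m.2 then 1 else -1) * profile ρ ↔ CellRel c m n := by
  cases c
  case v₁ | c₁ => simp at hc
  case v₂ | c₂ =>
    simp only [radii, Set.mem_singleton_iff] at hρ
    rw [hρ, profile_cross]
    exact height_cross m n
  case v₃ =>
    simp only [radii, Set.mem_singleton_iff] at hρ
    rw [hρ, profile_zero]
    exact height_inner m n 1 (by norm_num) le_rfl
  case e₂ | f₂ => exact height_outer m n _ (profile_outer hρ).1 (profile_outer hρ).2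
  case e₃ | f₃ => exact height_inner m n _ (profile_inner hρ).1 (profile_inner hρ).2

theorem radii_nonempty (c : Cell) : (radii c).Nonempty := by
  cases c
  case e₂ | f₂ => exact ⟨4 / 5, by norm_num [radii]⟩
  case e₃ | f₃ => exact ⟨1 / 5, by norm_num [radii]⟩
  all_goals exact Set.singleton_nonempty _

theorem prec_iff {r : ℕ} (c : Cell) (m n : Sheet r) : Prec c m n ↔ CellRel c m n := by
  by_cases hc : c = .v₁ ∨ c = .c₁
  · have h1 : IsCusp c m.1 := (isCusp_iff c m.1).2 hc
    refine iff_of_false (fun h => h.1 h1) ?_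
    rcases hc with rfl | rfl <;> exact fun h => h
  · have h1 : ∀ j : Fin r, ¬ IsCusp c j := fun j h => hc ((isCusp_iff c j).1 h)
    constructor
    · rintro ⟨-, -, h⟩
      obtain ⟨ρ, hρ⟩ := radii_nonempty c
      obtain ⟨x, hx, rfl⟩ := exists_norm_eq hρ
      exact (height_radii c hc m n _ hρ).1 (h x hx)
    · intro h
      exact ⟨h1 _, h1 _, fun x hx => (height_radii c hc m n _ (norm_mem_radii hx)).2 h⟩

theorem Prec.trans {r : ℕ} {c : Cell} {k m n : Sheet r} (h : Prec c k m) (h' : Prec c m n) :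
    Prec c k n :=
  ⟨h.1, h'.2.1, fun x hx => (h'.2.2 x hx).trans (h.2.2 x hx)⟩

section differential

variable {r : ℕ} (μ : MaslovPotential r)

/-- All entries off the order above `c` vanish. -/
def Supported (c : Cell) (X : Mat μ) : Prop := ∀ m n, ¬ Prec c m n → X m n = 0

/-- The entry at `m, n` lies in `e_m A e_n` and has degree `μ(S_n) - μ(S_m) + p`. -/
def Homog (p : ℤ) (X : Mat μ) : Prop := ∀ m n,
  X m n ∈ (cellQuiver r μ).grading (μ.val n - μ.val m + p) ∧
    (cellQuiver r μ).vertex m.1 * X m n = X m n ∧ X m n * (cellQuiver r μ).vertex n.1 = X m n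

variable {μ}

theorem Supported.add {c : Cell} {X Y : Mat μ} (hX : Supported μ c X) (hY : Supported μ c Y) :
    Supported μ c (X + Y) := by
  intro m n h
  rw [Matrix.add_apply, hX m n h, hY m n h, add_zero]

theorem Supported.mul {c : Cell} {X Y : Mat μ} (hX : Supported μ c X) (hY : Supported μ c Y) :
    Supported μ c (X * Y) := by
  intro m n h
  rw [Matrix.mul_apply]
  refine Finset.sum_eq_zero fun k _ => ?_
  by_cases h1 : Prec c m k
  · rw [hY k n (fun h2 => h (h1.trans h2)), mul_zero]
  · rw [hX m k h1, zero_mul]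

theorem Homog.add {p : ℤ} {X Y : Mat μ} (hX : Homog μ p X) (hY : Homog μ p Y) :
    Homog μ p (X + Y) := by
  intro m n
  obtain ⟨a, b, c⟩ := hX m n
  obtain ⟨a', b', c'⟩ := hY m n
  rw [Matrix.add_apply, mul_add, add_mul, b, b', c, c']
  exact ⟨add_mem a a', rfl, rfl⟩

theorem Homog.mul {p q t : ℤ} {X Y : Mat μ} (hX : Homog μ p X) (hY : Homog μ q Y)
    (ht : p + q = t) : Homog μ t (X * Y) := by
  intro m n
  rw [Matrix.mul_apply, Finset.mul_sum, Finset.sum_mul]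
  refine ⟨sum_mem fun k _ => ?_, Finset.sum_congr rfl fun k _ => ?_,
    Finset.sum_congr rfl fun k _ => ?_⟩
  · have := SetLike.mul_mem_graded (hX m k).1 (hY k n).1
    convert this using 2
    rw [← ht]
    ring
  · rw [← mul_assoc, (hX m k).2.1]
  · rw [mul_assoc, (hY k n).2.2]

variable (μ)

theorem cellMatrix_homog (c : Cell) (p : ℤ) (hp : 1 - c.dim = p) :
    Homog μ p (cellMatrix μ c) := by
  subst hp
  intro m n
  unfold cellMatrix
  split_ifs with h h'
  · refine ⟨?_, (cellQuiver r μ).vertex_mul_arrow ⟨c, m, n, h⟩,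
      (cellQuiver r μ).arrow_mul_vertex ⟨c, m, n, h⟩⟩
    have := (cellQuiver r μ).arrow_mem ⟨c, m, n, h⟩
    have e : (cellQuiver r μ).deg ⟨c, m, n, h⟩ = μ.val n - μ.val m + (1 - c.dim) := by
      change μ.val n - μ.val m + 1 - c.dim = _
      ring
    rwa [e] at this
  · obtain ⟨h0, -, hm, hn⟩ := h'
    have hv := (cellQuiver r μ).vertex_mem m.1
    have h1 := (cellQuiver r μ).vertex_idem m.1
    have hn1 : n.1 = m.1 := by rw [hn]
    refine ⟨?_, h1, by rw [hn1, h1]⟩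
    convert hv using 2
    have := μ.cusp m.1
    rw [← hm, ← hn] at this
    omega
  · exact ⟨zero_mem _, mul_zero _, zero_mul _⟩

theorem cellMatrix_supported (c : Cell) (hc : c ≠ .v₁) : Supported μ c (cellMatrix μ c) := by
  intro m n h
  unfold cellMatrix
  rw [dif_neg h, if_neg]
  rintro ⟨h0, h1, -⟩
  rcases (isCusp_iff c m.1).1 h1 with rfl | rfl
  · exact hc rfl
  · simp [Cell.dim] at h0

theorem cellMatrix_apply {c : Cell} {m n : Sheet r} (h : Prec c m n) :
    cellMatrix μ c m n = (cellQuiver r μ).arrow ⟨c, m, n, h⟩ := dif_pos h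

theorem Supported.mono {c c' : Cell} (h : ∀ m n : Sheet r, CellRel c m n → CellRel c' m n)
    {X : Mat μ} (hX : Supported μ c X) : Supported μ c' X := fun m n h' =>
  hX m n fun h'' => h' ((prec_iff c' m n).2 (h m n ((prec_iff c m n).1 h'')))

theorem cellMatrix_v₁_apply (m n : Sheet r) (h : ¬ (m = upper m.1 ∧ n = lower m.1)) :
    cellMatrix μ .v₁ m n = 0 := by
  unfold cellMatrix
  rw [dif_neg (fun h' => (prec_iff .v₁ m n).1 h'), if_neg]
  exact fun h' => h h'.2.2

theorem cellMatrix_v₁_supported (c : Cell) (hc : c = .e₂ ∨ c = .f₂) :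
    Supported μ c (cellMatrix μ .v₁) := by
  intro m n h
  apply cellMatrix_v₁_apply
  rintro ⟨h1, h2⟩
  apply h
  rw [prec_iff, h1, h2]
  rcases hc with rfl | rfl <;> exact Or.inr ⟨rfl, rfl, rfl⟩

theorem cellMatrix_v₁_sq : cellMatrix μ .v₁ ^ 2 = 0 := by
  rw [pow_two]
  ext m n
  rw [Matrix.mul_apply]
  refine Finset.sum_eq_zero fun k _ => ?_
  by_cases h : m = upper m.1 ∧ k = lower m.1
  · rw [cellMatrix_v₁_apply μ k n, mul_zero]
    rintro ⟨h1, -⟩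
    rw [h.2] at h1
    simp at h1
  · rw [cellMatrix_v₁_apply μ m k h, zero_mul]

theorem cellMatrix_c₁ : cellMatrix μ .c₁ = 0 := by
  ext m n
  exact cellMatrix_supported μ .c₁ (by simp) m n fun h => (prec_iff _ m n).1 h

theorem pathAlg_add_self {V : Type} [Fintype V] (Q : GradedQuiver V) (x : Q.PathAlg) :
    x + x = 0 := by
  rw [← two_smul (ZMod 2)]
  have : (2 : ZMod 2) = 0 := rfl
  rw [this, zero_smul]

theorem mat_add_self (X : Mat μ) : X + X = 0 := by
  ext m n
  exact pathAlg_add_self _ _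

theorem edgeFormula_eq (B A A' : Mat μ) : edgeFormula μ B A A' = A + A * B + (A' + B * A') := by
  unfold edgeFormula
  noncomm_ring

theorem faceFormula_two (F A A' X Y Z : Mat μ) : faceFormula μ F A A' [X, Y] [Y, Z] =
    A * F + F * A' + (X + Y * X + (Z + Z * Y)) := by
  have h : faceFormula μ F A A' [X, Y] [Y, Z] =
      A * F + F * A' + (X + Y * X + (Z + Z * Y)) + ((1 + Y) + (1 + Y)) := by
    simp only [faceFormula, pathProduct, List.foldl_cons, List.foldl_nil]
    noncomm_ring
  rw [h, mat_add_self, add_zero]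

theorem faceFormula_one (F A A' X Y : Mat μ) : faceFormula μ F A A' [X, Y] [Y] =
    A * F + F * A' + (X + Y * X) := by
  have h : faceFormula μ F A A' [X, Y] [Y] =
      A * F + F * A' + (X + Y * X) + ((1 + Y) + (1 + Y)) := by
    simp only [faceFormula, pathProduct, List.foldl_cons, List.foldl_nil]
    noncomm_ring
  rw [h, mat_add_self, add_zero]

theorem cellDiff_homog (c : Cell) : Homog μ (2 - c.dim) (cellDiff μ c) := by
  have h0 : ∀ c : Cell, c.dim = 0 → Homog μ 1 (cellMatrix μ c) := fun c h =>
    cellMatrix_homog μ c _ (by omega)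
  have h1 : ∀ c : Cell, c.dim = 1 → Homog μ 0 (cellMatrix μ c) := fun c h =>
    cellMatrix_homog μ c _ (by omega)
  have h2 : ∀ c : Cell, c.dim = 2 → Homog μ (-1) (cellMatrix μ c) := fun c h =>
    cellMatrix_homog μ c _ (by omega)
  have hv : ∀ X : Mat μ, Homog μ 1 X → Homog μ 2 (X ^ 2) := fun X h => by
    rw [pow_two]
    exact h.mul h (by norm_num)
  have he : ∀ B A A' : Mat μ, Homog μ 0 B → Homog μ 1 A → Homog μ 1 A' →
      Homog μ 1 (edgeFormula μ B A A') := fun B A A' hB hA hA' => by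
    rw [edgeFormula_eq]
    exact (hA.add (hA.mul hB (by norm_num))).add (hA'.add (hB.mul hA' (by norm_num)))
  have hm : ∀ X Y : Mat μ, Homog μ 0 X → Homog μ 0 Y → Homog μ 0 (X * Y) := fun X Y hX hY =>
    hX.mul hY (by norm_num)
  cases c
  case v₁ => exact hv _ (h0 _ rfl)
  case v₂ => exact hv _ (h0 _ rfl)
  case v₃ => exact hv _ (h0 _ rfl)
  case e₂ => exact he _ _ _ (h1 _ rfl) (h0 _ rfl) (h0 _ rfl)
  case e₃ => exact he _ _ _ (h1 _ rfl) (h0 _ rfl) (h0 _ rfl)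
  case c₁ => exact he _ _ _ (h1 _ rfl) (h0 _ rfl) (h0 _ rfl)
  case c₂ => exact he _ _ _ (h1 _ rfl) (h0 _ rfl) (h0 _ rfl)
  case f₂ =>
    rw [cellDiff, faceFormula_two]
    exact (((h0 _ rfl).mul (h2 _ rfl) rfl).add ((h2 _ rfl).mul (h0 _ rfl) rfl)).add
      (((h1 _ rfl).add (hm _ _ (h1 _ rfl) (h1 _ rfl))).add
        ((h1 _ rfl).add (hm _ _ (h1 _ rfl) (h1 _ rfl))))
  case f₃ =>
    rw [cellDiff, faceFormula_one]
    exact (((h0 _ rfl).mul (h2 _ rfl) rfl).add ((h2 _ rfl).mul (h0 _ rfl) rfl)).add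
      ((h1 _ rfl).add (hm _ _ (h1 _ rfl) (h1 _ rfl)))

theorem cellDiff_supported (c : Cell) : Supported μ c (cellDiff μ c) := by
  have cr : ∀ m n : Sheet r, CrossRel m n → OuterRel m n := fun m n h => h.1
  have ci : ∀ m n : Sheet r, CrossRel m n → InnerRel m n := fun m n h => Or.inl h
  have s : ∀ c, c ≠ .v₁ → Supported μ c (cellMatrix μ c) := cellMatrix_supported μ
  have he : ∀ (c : Cell) (B A A' : Mat μ), Supported μ c B → Supported μ c A → Supported μ c A' →
      Supported μ c (edgeFormula μ B A A') := fun c B A A' hB hA hA' => by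
    rw [edgeFormula_eq]
    exact (hA.add (hA.mul hB)).add (hA'.add (hB.mul hA'))
  cases c
  case v₁ =>
    rw [cellDiff, cellMatrix_v₁_sq]
    exact fun m n _ => rfl
  case v₂ =>
    rw [cellDiff, pow_two]
    exact (s _ (by simp)).mul (s _ (by simp))
  case v₃ =>
    rw [cellDiff, pow_two]
    exact (s _ (by simp)).mul (s _ (by simp))
  case e₂ =>
    exact he _ _ _ _ (s _ (by simp)) (Supported.mono μ (c := .v₂) (c' := .e₂) cr (s _ (by simp)))
      (cellMatrix_v₁_supported μ _ (by simp))
  case e₃ =>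
    exact he _ _ _ _ (s _ (by simp)) (Supported.mono μ (c := .v₃) (c' := .e₃) (fun _ _ h => h) (s _ (by simp)))
      (Supported.mono μ (c := .v₂) (c' := .e₃) ci (s _ (by simp)))
  case c₁ =>
    rw [cellDiff, cellMatrix_c₁, edgeFormula_eq, mul_zero, zero_mul, add_zero, mat_add_self]
    exact fun m n _ => rfl
  case c₂ =>
    have := Supported.mono μ (c := .v₂) (c' := .c₂) (fun _ _ h => h) (s .v₂ (by simp))
    exact he _ _ _ _ (s _ (by simp)) this this
  case f₂ =>
    rw [cellDiff, faceFormula_two, cellMatrix_c₁]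
    have hA := Supported.mono μ (c := .v₂) (c' := .f₂) cr (s .v₂ (by simp))
    have hC := Supported.mono μ (c := .c₂) (c' := .f₂) cr (s .c₂ (by simp))
    have hB := Supported.mono μ (c := .e₂) (c' := .f₂) (fun _ _ h => h) (s .e₂ (by simp))
    have hN := cellMatrix_v₁_supported μ .f₂ (by simp)
    have hF := s .f₂ (by simp)
    have h0 : Supported μ .f₂ 0 := fun m n _ => rfl
    exact ((hA.mul hF).add (hF.mul hN)).add ((h0.add (hB.mul h0)).add (hC.add (hC.mul hB)))
  case f₃ =>
    rw [cellDiff, faceFormula_one]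
    have hA := Supported.mono μ (c := .v₃) (c' := .f₃) (fun _ _ h => h) (s .v₃ (by simp))
    have hA' := Supported.mono μ (c := .v₂) (c' := .f₃) ci (s .v₂ (by simp))
    have hC := Supported.mono μ (c := .c₂) (c' := .f₃) ci (s .c₂ (by simp))
    have hB := Supported.mono μ (c := .e₃) (c' := .f₃) (fun _ _ h => h) (s .e₃ (by simp))
    have hF := s .f₃ (by simp)
    exact ((hA.mul hF).add (hF.mul hA')).add (hC.add (hB.mul hC))

/-- The derivation of the path algebra given by the matrix formulas. -/
noncomputable def cellDeriv : (cellQuiver r μ).PathAlg →ₗ[ZMod 2] (cellQuiver r μ).PathAlg :=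
  (cellQuiver r μ).deriv (fun g : CellGen r => cellDiff μ g.cell g.fst g.snd)
    (fun g => (cellDiff_homog μ g.cell g.fst g.snd).2.1)
    (fun g => (cellDiff_homog μ g.cell g.fst g.snd).2.2)

/-- The entrywise derivation of matrices. -/
noncomputable def matDeriv (X : Mat μ) : Mat μ := X.map (cellDeriv μ)

theorem matDeriv_add (X Y : Mat μ) : matDeriv μ (X + Y) = matDeriv μ X + matDeriv μ Y := by
  ext m n
  simp [matDeriv]

theorem matDeriv_one : matDeriv μ 1 = 0 := by
  ext m n
  simp only [matDeriv, Matrix.map_apply, Matrix.one_apply, Matrix.zero_apply]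
  split_ifs
  · exact (cellQuiver r μ).deriv_one _ _ _
  · exact map_zero _

theorem matDeriv_mul (X Y : Mat μ) :
    matDeriv μ (X * Y) = matDeriv μ X * Y + X * matDeriv μ Y := by
  ext m n
  simp only [matDeriv, Matrix.map_apply, Matrix.mul_apply, Matrix.add_apply, map_sum,
    ← Finset.sum_add_distrib]
  exact Finset.sum_congr rfl fun k _ => (cellQuiver r μ).deriv_mul _ _ _ _ _

theorem matDeriv_cellMatrix (c : Cell) : matDeriv μ (cellMatrix μ c) = cellDiff μ c := by
  ext m n
  rw [matDeriv, Matrix.map_apply]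
  by_cases h : Prec c m n
  · rw [cellMatrix_apply μ h]
    exact (cellQuiver r μ).deriv_arrow _ _ _ _
  · rw [cellDiff_supported μ c m n h]
    unfold cellMatrix
    rw [dif_neg h]
    split_ifs
    · exact (cellQuiver r μ).deriv_vertex _ _ _ _
    · exact map_zero _

theorem ring_edge {R : Type*} [Ring R] (A C Y : R) :
    A ^ 2 * Y + A * (A * Y + Y * C) + ((A * Y + Y * C) * C + Y * C ^ 2) =
      (A ^ 2 * Y + A * Y * C + Y * C ^ 2) + (A ^ 2 * Y + A * Y * C + Y * C ^ 2) := by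
  noncomm_ring

theorem ring_face {R : Type*} [Ring R] (A C F G : R) :
    A ^ 2 * F + A * (A * F + F * C + G) + ((A * F + F * C + G) * C + F * C ^ 2) + (A * G + G * C) =
      (A ^ 2 * F + A * F * C + F * C ^ 2 + A * G + G * C) +
        (A ^ 2 * F + A * F * C + F * C ^ 2 + A * G + G * C) := by
  noncomm_ring

theorem matDeriv_one_add (X : Mat μ) : matDeriv μ (1 + X) = matDeriv μ X := by
  rw [matDeriv_add, matDeriv_one, zero_add]

theorem matDeriv_edge (B A A' : Mat μ) (hA : matDeriv μ A = A ^ 2) (hA' : matDeriv μ A' = A' ^ 2)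
    (hB : matDeriv μ B = edgeFormula μ B A A') : matDeriv μ (edgeFormula μ B A A') = 0 := by
  rw [edgeFormula] at hB ⊢
  simp only [matDeriv_add, matDeriv_mul, matDeriv_one, zero_add, hA, hA', hB]
  exact (ring_edge A A' (1 + B)).trans (mat_add_self μ _)

theorem matDeriv_product (Y X A C E : Mat μ) (hY : matDeriv μ Y = edgeFormula μ Y A C)
    (hX : matDeriv μ X = edgeFormula μ X C E) : matDeriv μ ((1 + Y) * (1 + X)) =
      A * ((1 + Y) * (1 + X)) + (1 + Y) * (1 + X) * E := by
  rw [matDeriv_mul, matDeriv_one_add, matDeriv_one_add, hY, hX, edgeFormula, edgeFormula]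
  have : (A * (1 + Y) + (1 + Y) * C) * (1 + X) + (1 + Y) * (C * (1 + X) + (1 + X) * E) =
      A * ((1 + Y) * (1 + X)) + (1 + Y) * (1 + X) * E +
        ((1 + Y) * C * (1 + X) + (1 + Y) * C * (1 + X)) := by
    simp only [add_mul, mul_add, mul_assoc]
    abel
  rw [this, mat_add_self, add_zero]

theorem matDeriv_face (F A A' G : Mat μ) (hA : matDeriv μ A = A ^ 2)
    (hA' : matDeriv μ A' = A' ^ 2) (hG : matDeriv μ G = A * G + G * A')
    (hF : matDeriv μ F = A * F + F * A' + G) : matDeriv μ (A * F + F * A' + G) = 0 := by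
  simp only [matDeriv_add, matDeriv_mul, hA, hA', hF, hG]
  exact (ring_face A A' F G).trans (mat_add_self μ _)

theorem matDeriv_face_two (F A A' X Y Z : Mat μ) (hA : matDeriv μ A = A ^ 2)
    (hA' : matDeriv μ A' = A' ^ 2) (hY : matDeriv μ Y = edgeFormula μ Y A A')
    (hX : matDeriv μ X = edgeFormula μ X A' A') (hZ : matDeriv μ Z = edgeFormula μ Z A A)
    (hF : matDeriv μ F = faceFormula μ F A A' [X, Y] [Y, Z]) :
    matDeriv μ (faceFormula μ F A A' [X, Y] [Y, Z]) = 0 := by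
  have e : faceFormula μ F A A' [X, Y] [Y, Z] =
      A * F + F * A' + ((1 + Y) * (1 + X) + (1 + Z) * (1 + Y)) := by
    simp only [faceFormula, pathProduct, List.foldl_cons, List.foldl_nil, mul_one, add_assoc]
  rw [e] at hF ⊢
  refine matDeriv_face μ F A A' _ hA hA' ?_ hF
  rw [matDeriv_add, matDeriv_product μ Y X A A' A' hY hX, matDeriv_product μ Z Y A A A' hZ hY,
    mul_add A, add_mul _ _ A']
  abel

theorem matDeriv_face_one (F A A' X Y : Mat μ) (hA : matDeriv μ A = A ^ 2)
    (hA' : matDeriv μ A' = A' ^ 2) (hY : matDeriv μ Y = edgeFormula μ Y A A')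
    (hX : matDeriv μ X = edgeFormula μ X A' A')
    (hF : matDeriv μ F = faceFormula μ F A A' [X, Y] [Y]) :
    matDeriv μ (faceFormula μ F A A' [X, Y] [Y]) = 0 := by
  have e : faceFormula μ F A A' [X, Y] [Y] =
      A * F + F * A' + ((1 + Y) * (1 + X) + (1 + Y)) := by
    simp only [faceFormula, pathProduct, List.foldl_cons, List.foldl_nil, mul_one, add_assoc]
  rw [e] at hF ⊢
  refine matDeriv_face μ F A A' _ hA hA' ?_ hF
  rw [matDeriv_add, matDeriv_product μ Y X A A' A' hY hX, matDeriv_one_add, hY, edgeFormula,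
    mul_add A ((1 + Y) * (1 + X)), add_mul ((1 + Y) * (1 + X))]
  abel

theorem matDeriv_cellDiff (c : Cell) : matDeriv μ (cellDiff μ c) = 0 := by
  have h := matDeriv_cellMatrix μ
  have hv : ∀ X : Mat μ, matDeriv μ X = X ^ 2 → matDeriv μ (X ^ 2) = 0 := fun X hX => by
    rw [pow_two, matDeriv_mul, hX, ← pow_succ, ← pow_succ', mat_add_self]
  cases c
  case v₁ => exact hv _ (h _)
  case v₂ => exact hv _ (h _)
  case v₃ => exact hv _ (h _)
  case f₂ => exact matDeriv_face_two μ _ _ _ _ _ _ (h .v₂) (h .v₁) (h .e₂) (h .c₁) (h .c₂) (h .f₂)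
  case f₃ => exact matDeriv_face_one μ _ _ _ _ _ (h .v₃) (h .v₂) (h .e₃) (h .c₂) (h .f₃)
  case e₂ => exact matDeriv_edge μ _ _ _ (h .v₂) (h .v₁) (h .e₂)
  case e₃ => exact matDeriv_edge μ _ _ _ (h .v₃) (h .v₂) (h .e₃)
  case c₁ => exact matDeriv_edge μ _ _ _ (h .v₁) (h .v₁) (h .c₁)
  case c₂ => exact matDeriv_edge μ _ _ _ (h .v₂) (h .v₂) (h .c₂)

/-- The differential of the cellular dg algebra: the derivation whose value on the generator of
`m ≺ n` above a cell is the entry at `m, n` of the matrix of differentials of that cell. -/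
noncomputable def cellDifferential : (cellQuiver r μ).Differential where
  toMap := cellDeriv μ
  leibniz := (cellQuiver r μ).deriv_mul _ _ _
  map_vertex := (cellQuiver r μ).deriv_vertex _ _ _
  degree n x hx := (cellQuiver r μ).deriv_degree _ _ _ (fun g => by
    have := (cellDiff_homog μ g.cell g.fst g.snd).1
    convert this using 2
    simp only [cellQuiver]
    ring) n x hx
  sq := (cellQuiver r μ).deriv_sq _ _ _ fun g =>
    congrFun (congrFun (matDeriv_cellDiff μ g.cell) g.fst) g.snd

end differential

/-- The cellular dg algebra `C(Λ_r)` over `𝕜 = ⨁_j (ℤ/2) e_j`. -/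
noncomputable def cellularDGA (r : ℕ) (μ : MaslovPotential r) : DGAlgebra (Fin r) :=
  (cellDifferential μ).dgAlgebra

/-- The remaining generators. With components numbered `0, …, r - 1`:
* `b k` is the generator of the edge `e₂` for the lower sheet of `k` and the upper sheet of `k + 1`,
  which are the sheets number `2k+2, 2k+3` from the top above `e₂`;
* `z j` is the generator of the face `f₃` for the upper and the lower sheet of `j`, which are the
  sheets number `2j, 2j+3` from the top above `f₃`, where `0` and `2r+1` are to be read as `1` and
  `2r`;
* `bdual k` is the generator of the face `f₃` for the upper sheet of `k + 1` and the lower sheet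
  of `k`, which are the sheets number `2k+2, 2k+3` from the top above `f₃`. -/
inductive ListedGen (r : ℕ)
  | b (k : ℕ) (hk : k + 1 < r)
  | z (j : Fin r)
  | bdual (k : ℕ) (hk : k + 1 < r)

/-- The remaining generators as generators of the cellular dg algebra. -/
def ListedGen.toCellGen {r : ℕ} : ListedGen r → CellGen r
  | .b k hk => ⟨.e₂, lower ⟨k, by omega⟩, upper ⟨k + 1, hk⟩,
      (prec_iff _ _ _).2 (Or.inl (by simp))⟩
  | .z j => ⟨.f₃, upper j, lower j, (prec_iff _ _ _).2 (Or.inl ⟨Or.inr ⟨rfl, rfl, rfl⟩, by simp⟩)⟩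
  | .bdual k hk => ⟨.f₃, upper ⟨k + 1, hk⟩, lower ⟨k, by omega⟩,
      (prec_iff _ _ _).2 (Or.inr ⟨rfl, rfl, rfl⟩)⟩

/-- The remaining generators as arrows, with the ends and degrees that they have in the cellular dg
algebra. -/
def listedQuiver (r : ℕ) (μ : MaslovPotential r) : GradedQuiver (Fin r) where
  Arrow := ListedGen r
  src g := (cellQuiver r μ).src g.toCellGen
  tgt g := (cellQuiver r μ).tgt g.toCellGen
  deg g := (cellQuiver r μ).deg g.toCellGen

end ALink

/-! Write N for the cusp matrix at `v₁`; A₂, A₃, B₂, B₃, C₂, F₂, F₃ for the matrices of `v₂`, `v₃`,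
`e₂`, `e₃`, `c₂`, `f₂`, `f₃`; and b, z, w for the matrices of the generators `b`, `z`, `bdual`.
Since dB₂ contains A₂ linearly, dB₃ contains A₃ and dF₂ contains C₂, most generators cancel in
pairs. The order over the crossing circle lacks exactly the pairs (ℓ_k, u_{k+1}) present just
outside it, so b and the entries of F₂ at these pairs are left over, together with all of F₃.

To treat F₃, put U = E + B₂, V = E + B₃ and transport the disc to `v₁`: the matrix `disc` =
U⁻¹V⁻¹F₃U + U⁻¹F₂ satisfies d(disc) = N disc + disc N (`cellDeriv_disc`). The commutator with N is
contracted by left multiplication with Nᵗ, because N Nᵗ + Nᵗ N acts as the identity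
(`ccusp_ccuspT_mul`). This removes the entries of `disc` from a component to a later one; the
left-over entries of F₂ supply those at (ℓ_k, u_{k+1}), which F₃ lacks. There remain z at (u_j, ℓ_j)
and w at (u_{k+1}, ℓ_k). The leading terms w + bw + wb of `disc` give dz = Nbw + wbN, while b and w
are closed.

Instead of cancelling step by step, the proof gives an explicit deformation retract. The
homomorphism φ = `cellHom` sends B₂ to b, B₃ to 0, A₂ and A₃ to (E + b)N(E + b), F₂ to bwb and F₃ to
w + (E + b)z(E + b). The homomorphism ψ = `listedHom` keeps b, w and sends z_j to the (u_j, ℓ_j)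
entry of `disc`. Both commute with the differentials (`listedDeriv_cellImage`,
`listedHom_listedDeriv`) and φψ = id. With ρ = ψφ, a derivation h from id to ρ is needed with dh +
hd = id + ρ. It vanishes on B₂ and B₃, and h(disc) = Nᵗ(disc + ρ disc). Its value on F₂ is chosen so
that the remaining values, which the equation then forces, have the support required by the order of
the sheets. The defect dh + hd + id + ρ is again a derivation from id to ρ and commutes with d, so
its vanishing on B₂, B₃, F₂ and `disc` implies its vanishing everywhere (`defect_cellMatrix`).
Finally `DGAlgebra.Hom.isQuasiIso_of_homotopy` applies. -/

namespace GradedQuiver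

/-! ### Induction, derivations and gradings on path algebras -/

section PathAlg

variable {V : Type} [Fintype V] (Q : GradedQuiver V)

/-- The only scalars are 0 and 1, and 1 is the sum of the vertices, so no clause for scalars is
needed. -/
theorem pathAlg_induction {p : Q.PathAlg → Prop} (vertex : ∀ v, p (Q.vertex v))
    (arrow : ∀ a, p (Q.arrow a)) (zero : p 0) (add : ∀ x y, p x → p y → p (x + y))
    (mul : ∀ x y, p x → p y → p (x * y)) (x : Q.PathAlg) : p x := by
  have one : p 1 := by
    rw [← Q.vertex_sum]
    exact Finset.sum_induction _ p add zero fun v _ => vertex v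
  obtain ⟨x, rfl⟩ := RingQuot.mkAlgHom_surjective (ZMod 2) (PathRel Q) x
  change p (Q.proj x)
  induction x using FreeAlgebra.induction with
  | grade0 c =>
    rw [AlgHom.commutes]
    fin_cases c
    · exact (map_zero (algebraMap (ZMod 2) Q.PathAlg)).symm ▸ zero
    · exact (map_one (algebraMap (ZMod 2) Q.PathAlg)).symm ▸ one
  | grade1 x =>
    cases x with
    | inl v => exact vertex v
    | inr a => exact arrow a
  | mul x y hx hy => rw [map_mul]; exact mul _ _ hx hy
  | add x y hx hy => rw [map_add]; exact add _ _ hx hy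

variable {A : Type} [Ring A] [Algebra (ZMod 2) A]

/-- A derivation between two algebra homomorphisms vanishes if it vanishes on the generators. -/
theorem derivation_eq_zero (f g : Q.PathAlg →ₐ[ZMod 2] A) (T : Q.PathAlg →ₗ[ZMod 2] A)
    (hT : ∀ x y, T (x * y) = T x * g y + f x * T y) (hv : ∀ v, T (Q.vertex v) = 0)
    (ha : ∀ a, T (Q.arrow a) = 0) (x : Q.PathAlg) : T x = 0 := by
  refine Q.pathAlg_induction (p := fun x => T x = 0) hv ha (map_zero T) ?_ ?_ x
  · intro x y hx hy
    rw [map_add, hx, hy, add_zero]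
  · intro x y hx hy
    rw [hT, hx, hy, zero_mul, mul_zero, add_zero]

theorem algHom_eq {f g : Q.PathAlg →ₐ[ZMod 2] A} (hv : ∀ v, f (Q.vertex v) = g (Q.vertex v))
    (ha : ∀ a, f (Q.arrow a) = g (Q.arrow a)) : f = g := by
  apply Q.algHom_ext
  rintro (v | a)
  · exact hv v
  · exact ha a

/-- Two algebra homomorphisms and compatible values on the arrows determine a derivation between
them that kills the vertices. -/
theorem exists_derivation (f g : Q.PathAlg →ₐ[ZMod 2] A) (η : Q.Arrow → A)
    (hs : ∀ a, f (Q.vertex (Q.src a)) * η a = η a)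
    (ht : ∀ a, η a * g (Q.vertex (Q.tgt a)) = η a) :
    ∃ h : Q.PathAlg →ₗ[ZMod 2] A, (∀ x y, h (x * y) = h x * g y + f x * h y) ∧
      (∀ v, h (Q.vertex v) = 0) ∧ ∀ a, h (Q.arrow a) = η a := by
  -- An upper triangular 2 × 2 matrix with diagonal f, g depends multiplicatively on its argument
  -- exactly when its corner is a derivation from f to g. The universal property thus yields the
  -- derivation as a corner.
  obtain ⟨H, Hv, Ha⟩ : ∃ H : Q.PathAlg →ₐ[ZMod 2] Matrix (Fin 2) (Fin 2) A,
      (∀ v, H (Q.vertex v) = !![f (Q.vertex v), 0; 0, g (Q.vertex v)]) ∧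
      ∀ a, H (Q.arrow a) = !![f (Q.arrow a), η a; 0, g (Q.arrow a)] := by
    refine ⟨Q.lift
      (fun v => !![f (Q.vertex v), 0; 0, g (Q.vertex v)])
      (fun a => !![f (Q.arrow a), η a; 0, g (Q.arrow a)])
      (fun v => by simp [← map_mul, vertex_idem])
      (fun v w h => by
        ext i j
        fin_cases i <;> fin_cases j <;> simp [← map_mul, vertex_orth Q v w h])
      ?_
      (fun a => by simp [← map_mul, vertex_mul_arrow, hs])
      (fun a => by simp [← map_mul, arrow_mul_vertex, ht]),
      fun v => Q.lift_gen _ _ _ _ _ _ _ (Sum.inl v),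
      fun a => Q.lift_gen _ _ _ _ _ _ _ (Sum.inr a)⟩
    have h1 := congrArg f Q.vertex_sum
    have h2 := congrArg g Q.vertex_sum
    rw [map_sum, map_one] at h1 h2
    ext i j
    fin_cases i <;> fin_cases j <;> simp [Matrix.sum_apply, h1, h2]
  have key : ∀ x, H x 0 0 = f x ∧ H x 1 0 = 0 ∧ H x 1 1 = g x := by
    refine Q.pathAlg_induction ?_ ?_ ?_ ?_ ?_
    · intro v
      rw [Hv]
      exact ⟨rfl, rfl, rfl⟩
    · intro a
      rw [Ha]
      exact ⟨rfl, rfl, rfl⟩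
    · rw [map_zero, map_zero, map_zero]
      exact ⟨rfl, rfl, rfl⟩
    · rintro x y ⟨h1, h2, h3⟩ ⟨h4, h5, h6⟩
      rw [map_add, map_add, map_add, Matrix.add_apply, Matrix.add_apply, Matrix.add_apply, h1, h2,
        h3, h4, h5, h6, add_zero]
      exact ⟨rfl, rfl, rfl⟩
    · rintro x y ⟨h1, h2, h3⟩ ⟨h4, h5, h6⟩
      rw [map_mul, map_mul, map_mul, Matrix.mul_apply, Matrix.mul_apply, Matrix.mul_apply,
        Fin.sum_univ_two, Fin.sum_univ_two, Fin.sum_univ_two, h1, h2, h3, h4, h5, h6, mul_zero,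
        mul_zero, zero_mul, zero_mul, add_zero, add_zero, zero_add]
      exact ⟨rfl, rfl, rfl⟩
  refine ⟨{ toFun := fun x => H x 0 1, map_add' := ?_, map_smul' := ?_ }, ?_, ?_, ?_⟩
  · intro x y
    rw [map_add]
    rfl
  · intro c x
    rw [map_smul]
    rfl
  · intro x y
    change H (x * y) 0 1 = H x 0 1 * g y + f x * H y 0 1
    rw [map_mul, Matrix.mul_apply, Fin.sum_univ_two, (key x).1, (key y).2.2, add_comm]
  · intro v
    change H (Q.vertex v) 0 1 = 0
    rw [Hv]
    rfl
  · intro a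
    change H (Q.arrow a) 0 1 = η a
    rw [Ha]
    rfl

theorem map_mem_grading {V' : Type} [Fintype V'] (Q' : GradedQuiver V')
    (f : Q.PathAlg →ₐ[ZMod 2] Q'.PathAlg) (hv : ∀ v, f (Q.vertex v) ∈ Q'.grading 0)
    (ha : ∀ a, f (Q.arrow a) ∈ Q'.grading (Q.deg a)) (n : ℤ) (x : Q.PathAlg)
    (hx : x ∈ Q.grading n) : f x ∈ Q'.grading n := by
  have hw : ∀ w : List (V ⊕ Q.Arrow),
      f (w.map Q.gen).prod ∈ Q'.grading (w.map Q.genDeg).sum := by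
    intro w
    induction w with
    | nil => simpa using Q'.word_mem []
    | cons x w ih =>
      simp only [List.map_cons, List.prod_cons, List.sum_cons, map_mul]
      refine SetLike.mul_mem_graded ?_ ih
      cases x with
      | inl v => exact hv v
      | inr a => exact ha a
  refine (Submodule.span_le (p := (Q'.grading n).comap f.toLinearMap)).2 ?_ hx
  rintro _ ⟨w, rfl, rfl⟩
  exact hw w

end PathAlg

end GradedQuiver

/-- A homomorphism of dg algebras with a right inverse chain map that is also a left inverse up to
homotopy is a quasi-isomorphism. -/
theorem DGAlgebra.Hom.isQuasiIso_of_homotopy {V : Type} [Fintype V] {A B : DGAlgebra V}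
    (φ : A.Hom B) (ψ : B.Carrier →ₗ[ZMod 2] A.Carrier) (hψ : ∀ x, ψ (B.d x) = A.d (ψ x))
    (hφψ : ∀ x, φ.toAlgHom (ψ x) = x) (h : A.Carrier →ₗ[ZMod 2] A.Carrier)
    (hh : ∀ x, A.d (h x) + h (A.d x) + x + ψ (φ.toAlgHom x) = 0) : φ.IsQuasiIso := by
  constructor
  · rw [← LinearMap.ker_eq_bot, LinearMap.ker_eq_bot']
    intro q hq
    obtain ⟨⟨x, hx⟩, rfl⟩ := Submodule.Quotient.mk_surjective _ q
    have hq' : (Submodule.Quotient.mk (φ.onCocycles ⟨x, hx⟩) : B.Cohomology) = 0 := hq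
    rw [Submodule.Quotient.mk_eq_zero] at hq' ⊢
    obtain ⟨y, hy⟩ : ∃ y, B.d y = φ.toAlgHom x := hq'
    -- For a cocycle x with φ(x) = dy the homotopy equation reads x = d(hx) + ψ(dy) = d(hx + ψy).
    refine ⟨h x + ψ y, ?_⟩
    have h1 := hh x
    rw [LinearMap.mem_ker.1 hx, map_zero, add_zero, ← hy, hψ, add_right_comm] at h1
    change A.d (h x + ψ y) = x
    rw [map_add, ← sub_eq_zero, ZModModule.sub_eq_add, h1]
  · intro q
    obtain ⟨⟨x, hx⟩, rfl⟩ := Submodule.Quotient.mk_surjective _ q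
    have hx' : A.d (ψ x) = 0 := by rw [← hψ, LinearMap.mem_ker.1 hx, map_zero]
    refine ⟨Submodule.Quotient.mk ⟨ψ x, hx'⟩, ?_⟩
    change (Submodule.Quotient.mk (φ.onCocycles ⟨ψ x, hx'⟩) : B.Cohomology) = _
    congr 1
    exact Subtype.ext (hφψ x)

/-! ### Matrices with prescribed support and inverses of unipotent matrices -/

section Matrices

variable {ι A : Type} [Ring A]

/-- All entries of the matrix off a relation vanish. -/
def Matrix.SupportedOn (R : ι → ι → Prop) (X : Matrix ι ι A) : Prop := ∀ m n, ¬ R m n → X m n = 0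

namespace Matrix.SupportedOn

variable {R R' R'' : ι → ι → Prop} {X Y : Matrix ι ι A}

theorem mono (hX : SupportedOn R X) (h : ∀ m n, R m n → R' m n) : SupportedOn R' X :=
  fun m n h' => hX m n fun h'' => h' (h m n h'')

theorem add (hX : SupportedOn R X) (hY : SupportedOn R Y) : SupportedOn R (X + Y) := by
  intro m n h
  rw [Matrix.add_apply, hX m n h, hY m n h, add_zero]

theorem mul [Fintype ι] (hX : SupportedOn R X) (hY : SupportedOn R' Y)
    (h : ∀ m k n, R m k → R' k n → R'' m n) : SupportedOn R'' (X * Y) := by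
  intro m n hmn
  rw [Matrix.mul_apply]
  refine Finset.sum_eq_zero fun k _ => ?_
  by_cases h1 : R m k
  · rw [hY k n (fun h2 => hmn (h m k n h1 h2)), mul_zero]
  · rw [hX m k h1, zero_mul]

theorem mul_eq_zero [Fintype ι] (hX : SupportedOn R X) (hY : SupportedOn R' Y)
    (h : ∀ m k n, R m k → R' k n → False) : X * Y = 0 := by
  ext m n
  exact (hX.mul hY (R'' := fun _ _ => False) h) m n not_false

theorem zero : SupportedOn R (0 : Matrix ι ι A) := fun _ _ _ => rfl

theorem map {B : Type} [Ring B] (hX : SupportedOn R X) {f : A → B} (hf : f 0 = 0) :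
    SupportedOn R (X.map f) := by
  intro m n h
  rw [Matrix.map_apply, hX m n h, hf]

/-- Each factor raises the rank by at least one, so a nonzero entry of the k-th power joins indices
whose ranks differ by at least k. -/
theorem pow_eq_zero [Fintype ι] [DecidableEq ι] {rank : ι → ℕ} {N : ℕ} (hN : ∀ m, rank m < N)
    (hX : SupportedOn (fun m n => rank m < rank n) X) : X ^ N = 0 := by
  have key : ∀ k, SupportedOn (fun m n => rank m + k ≤ rank n) (X ^ k) := by
    intro k
    induction k with
    | zero =>
      intro m n h
      rw [pow_zero, Matrix.one_apply_ne]
      rintro rfl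
      simp at h
    | succ k ih =>
      rw [pow_succ]
      refine ih.mul hX ?_
      intro l m n h1 h2
      omega
  ext m n
  apply key
  have := hN n
  omega

end Matrix.SupportedOn

/-- In characteristic two, `1 + X` is invertible for `X` strictly triangular, and the inverse is `1`
plus a polynomial in `X` without constant term. -/
theorem exists_one_add_inverse [Fintype ι] [DecidableEq ι] [Algebra (ZMod 2) A] {X : Matrix ι ι A} {rank : ι → ℕ} {N : ℕ}
    (hN : ∀ m, rank m < N) (hX : X.SupportedOn fun m n => rank m < rank n) :
    ∃ T : Matrix ι ι A, (1 + X) * (1 + T) = 1 ∧ (1 + T) * (1 + X) = 1 ∧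
      ∀ p : Matrix ι ι A → Prop, p 0 → (∀ Y Z, p Y → p Z → p (Y + Z)) →
        (∀ Y Z, p Y → p Z → p (Y * Z)) → p X → p T := by
  have h0 := hX.pow_eq_zero hN
  have h1 : 1 + ∑ i ∈ Finset.range N, X ^ (i + 1) = ∑ i ∈ Finset.range (N + 1), X ^ i := by
    rw [Finset.sum_range_succ', pow_zero, add_comm]
  have h2 : 1 + X = 1 - X := (ZModModule.sub_eq_add _ _).symm
  -- The inverse of E - X is the geometric series. The closure clause omits the unit because support
  -- on a strict order, to which it is applied, fails for E.
  refine ⟨∑ i ∈ Finset.range N, X ^ (i + 1), ?_, ?_, ?_⟩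
  · rw [h1, h2, mul_neg_geom_sum, pow_succ, h0, zero_mul, sub_zero]
  · rw [h1, h2, geom_sum_mul_neg, pow_succ, h0, zero_mul, sub_zero]
  · intro p hp0 hpa hpm hpX
    refine Finset.sum_induction _ p hpa hp0 fun i hi => ?_
    clear hi
    induction i with
    | zero => simpa using hpX
    | succ i ih =>
      rw [pow_succ]
      exact hpm _ _ ih hpX

end Matrices

theorem ZModModule.add_add_self_cancel {M : Type*} [AddCommGroup M] [Module (ZMod 2) M] (x y : M) :
    x + (x + y) = y := by
  rw [← add_assoc, ZModModule.add_self, zero_add]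

section Matrices

variable {ι A B : Type} [DecidableEq ι] [Ring A] [Algebra (ZMod 2) A] [Ring B]
  [Algebra (ZMod 2) B]

/-- Differentials, homotopies and defects are all of this kind. Passing to matrices allows all
generators of a cell to be treated at once. -/
theorem LinearMap.mapMatrix_mul_of_derivation [Fintype ι] (f g : A →ₐ[ZMod 2] B) (T : A →ₗ[ZMod 2] B)
    (hT : ∀ x y, T (x * y) = T x * g y + f x * T y) (X Y : Matrix ι ι A) :
    T.mapMatrix (X * Y) = T.mapMatrix X * g.mapMatrix Y + f.mapMatrix X * T.mapMatrix Y := by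
  ext m n
  simp only [LinearMap.mapMatrix_apply, Matrix.map_apply, Matrix.mul_apply, Matrix.add_apply,
    AlgHom.mapMatrix_apply, map_sum, hT, Finset.sum_add_distrib]

theorem LinearMap.mapMatrix_one_of_map_one {T : A →ₗ[ZMod 2] B} (hT : T 1 = 0) :
    T.mapMatrix (1 : Matrix ι ι A) = 0 := by
  ext m n
  rw [LinearMap.mapMatrix_apply, Matrix.map_apply, Matrix.one_apply]
  split_ifs
  · exact hT
  · exact map_zero T

end Matrices

/-! ### Bihomogeneous matrices and the generator matrices N, b, w, z -/

namespace ALink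

variable {r : ℕ}

section Bihomogeneous

variable {A : Type} [Ring A]

/-- The entry at `m, n` lies in `e_m A e_n`. -/
def IsBihom (e : Fin r → A) (X : Matrix (Sheet r) (Sheet r) A) : Prop :=
  ∀ m n, e m.1 * X m n = X m n ∧ X m n * e n.1 = X m n

namespace IsBihom

variable {e : Fin r → A} {X Y : Matrix (Sheet r) (Sheet r) A}

theorem zero : IsBihom e 0 := fun _ _ => ⟨mul_zero _, zero_mul _⟩

theorem add (hX : IsBihom e X) (hY : IsBihom e Y) : IsBihom e (X + Y) := by
  intro m n
  rw [Matrix.add_apply, mul_add, add_mul, (hX m n).1, (hX m n).2, (hY m n).1, (hY m n).2]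
  exact ⟨rfl, rfl⟩

theorem mul (hX : IsBihom e X) (hY : IsBihom e Y) : IsBihom e (X * Y) := by
  intro m n
  rw [Matrix.mul_apply, Finset.mul_sum, Finset.sum_mul]
  refine ⟨Finset.sum_congr rfl fun k _ => ?_, Finset.sum_congr rfl fun k _ => ?_⟩
  · rw [← mul_assoc, (hX m k).1]
  · rw [mul_assoc, (hY k n).2]

theorem one_add_mul (hX : IsBihom e X) (hY : IsBihom e Y) : IsBihom e ((1 + X) * Y) := by
  rw [add_mul, one_mul]
  exact hY.add (hX.mul hY)

theorem mul_one_add (hX : IsBihom e X) (hY : IsBihom e Y) : IsBihom e (X * (1 + Y)) := by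
  rw [mul_add, mul_one]
  exact hX.add (hX.mul hY)

end IsBihom

end Bihomogeneous

/-- The entry at `m, n` has degree `μ(n) - μ(m) + p`. -/
def HasDegree (Q : GradedQuiver (Fin r)) (μ : MaslovPotential r) (p : ℤ)
    (X : Matrix (Sheet r) (Sheet r) Q.PathAlg) : Prop :=
  ∀ m n, X m n ∈ Q.grading (μ.val n - μ.val m + p)

namespace HasDegree

variable {Q : GradedQuiver (Fin r)} {μ : MaslovPotential r} {p q t : ℤ}
  {X Y : Matrix (Sheet r) (Sheet r) Q.PathAlg}

theorem zero : HasDegree Q μ p 0 := fun _ _ => zero_mem _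

theorem one : HasDegree Q μ 0 1 := by
  intro m n
  by_cases h : m = n
  · subst h
    rw [Matrix.one_apply_eq, sub_self, add_zero]
    exact SetLike.GradedOne.one_mem
  · rw [Matrix.one_apply_ne h]
    exact zero_mem _

theorem add (hX : HasDegree Q μ p X) (hY : HasDegree Q μ p Y) : HasDegree Q μ p (X + Y) :=
  fun m n => add_mem (hX m n) (hY m n)

theorem mul (hX : HasDegree Q μ p X) (hY : HasDegree Q μ q Y) (ht : p + q = t) :
    HasDegree Q μ t (X * Y) := by
  intro m n
  rw [Matrix.mul_apply]
  refine sum_mem fun k _ => ?_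
  have := SetLike.mul_mem_graded (hX m k) (hY k n)
  convert this using 2
  rw [← ht]
  ring

end HasDegree

/-- `m` and `n` are the upper and the lower sheet of the same component. -/
def CuspRel (m n : Sheet r) : Prop := m.1 = n.1 ∧ m.2 = true ∧ n.2 = false

/-- `m` is a lower sheet and `n` is the upper sheet of the next component. -/
def DownRel (m n : Sheet r) : Prop := (n.1 : ℕ) = m.1 + 1 ∧ m.2 = false ∧ n.2 = true

/-- `n` is a lower sheet and `m` is the upper sheet of the next component. -/
def UpRel (m n : Sheet r) : Prop := (m.1 : ℕ) = n.1 + 1 ∧ m.2 = true ∧ n.2 = false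

open Classical in
/-- The matrix with the entries `e j` at the upper and the lower sheet of `j`. -/
noncomputable def cuspMatrix {A : Type} [Zero A] (e : Fin r → A) : Matrix (Sheet r) (Sheet r) A :=
  fun m n => if CuspRel m n then e m.1 else 0

theorem cuspMatrix_supported {A : Type} [Ring A] (e : Fin r → A) :
    (cuspMatrix e).SupportedOn CuspRel := fun _ _ h => if_neg h

theorem cuspMatrix_isBihom {A : Type} [Ring A] {e : Fin r → A} (he : ∀ v, e v * e v = e v) :
    IsBihom e (cuspMatrix e) := by
  intro m n
  unfold cuspMatrix
  split_ifs with h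
  · rw [← h.1, he]
    exact ⟨rfl, rfl⟩
  · simp

theorem map_cuspMatrix {A B : Type} [Ring A] [Ring B] (e : Fin r → A) {f : A → B} (h0 : f 0 = 0) :
    (cuspMatrix e).map f = cuspMatrix (f ∘ e) := by
  ext m n
  simp only [Matrix.map_apply, cuspMatrix]
  split_ifs
  · rfl
  · exact h0

theorem CuspRel.val_eq (μ : MaslovPotential r) {m n : Sheet r} (h : CuspRel m n) :
    μ.val m = μ.val n + 1 := by
  obtain ⟨⟨a, s⟩, ⟨b, t⟩⟩ := m, n
  obtain ⟨h1, h2, h3⟩ := h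
  simp only at h1 h2 h3
  subst h1 h2 h3
  exact μ.cusp a

section Listed

variable (μ : MaslovPotential r)

/-- Matrices over the path algebra on the listed generators. -/
abbrev LMat : Type := Matrix (Sheet r) (Sheet r) (listedQuiver r μ).PathAlg

/-- The constant matrix of the cusps. -/
noncomputable abbrev lcusp : LMat μ := cuspMatrix (listedQuiver r μ).vertex

open Classical in
/-- The matrix of the generators `b k`. -/
noncomputable def lb : LMat μ := fun m n =>
  if h : DownRel m n then
    (listedQuiver r μ).arrow (ListedGen.b m.1 (h.1 ▸ n.1.2)) else 0

open Classical in
/-- The matrix of the generators `bdual k`. -/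
noncomputable def lw : LMat μ := fun m n =>
  if h : UpRel m n then
    (listedQuiver r μ).arrow (ListedGen.bdual n.1 (h.1 ▸ m.1.2)) else 0

open Classical in
/-- The matrix of the generators `z j`. -/
noncomputable def lz : LMat μ := fun m n =>
  if CuspRel m n then (listedQuiver r μ).arrow (ListedGen.z m.1) else 0

theorem lb_supported : (lb μ).SupportedOn DownRel := fun _ _ h => dif_neg h

theorem lw_supported : (lw μ).SupportedOn UpRel := fun _ _ h => dif_neg h

theorem lz_supported : (lz μ).SupportedOn CuspRel := fun _ _ h => if_neg h

theorem lb_apply (k : ℕ) (hk : k + 1 < r) : lb μ (lower ⟨k, by omega⟩) (upper ⟨k + 1, hk⟩) =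
    (listedQuiver r μ).arrow (ListedGen.b k hk) := dif_pos ⟨rfl, rfl, rfl⟩

theorem lw_apply (k : ℕ) (hk : k + 1 < r) : lw μ (upper ⟨k + 1, hk⟩) (lower ⟨k, by omega⟩) =
    (listedQuiver r μ).arrow (ListedGen.bdual k hk) := dif_pos ⟨rfl, rfl, rfl⟩

theorem lz_apply (j : Fin r) : lz μ (upper j) (lower j) =
    (listedQuiver r μ).arrow (ListedGen.z j) := if_pos ⟨rfl, rfl, rfl⟩

theorem DownRel.exists {m n : Sheet r} (h : DownRel m n) : ∃ (k : ℕ) (hk : k + 1 < r),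
    m = lower ⟨k, by omega⟩ ∧ n = upper ⟨k + 1, hk⟩ := by
  obtain ⟨⟨⟨a, ha⟩, s⟩, ⟨⟨b, hb⟩, t⟩⟩ := m, n
  obtain ⟨h1, h2, h3⟩ := h
  simp only at h1 h2 h3
  subst h1 h2 h3
  exact ⟨a, hb, rfl, rfl⟩

theorem UpRel.exists {m n : Sheet r} (h : UpRel m n) : ∃ (k : ℕ) (hk : k + 1 < r),
    m = upper ⟨k + 1, hk⟩ ∧ n = lower ⟨k, by omega⟩ := by
  obtain ⟨⟨⟨a, ha⟩, s⟩, ⟨⟨b, hb⟩, t⟩⟩ := m, n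
  obtain ⟨h1, h2, h3⟩ := h
  simp only at h1 h2 h3
  subst h1 h2 h3
  exact ⟨b, ha, rfl, rfl⟩

theorem CuspRel.exists {m n : Sheet r} (h : CuspRel m n) : ∃ j, m = upper j ∧ n = lower j := by
  obtain ⟨⟨a, s⟩, ⟨b, t⟩⟩ := m, n
  obtain ⟨h1, h2, h3⟩ := h
  simp only at h1 h2 h3
  subst h1 h2 h3
  exact ⟨a, rfl, rfl⟩

theorem listed_isBihom_arrow {X : LMat μ}
    (hX : ∀ m n, X m n = 0 ∨ ∃ g, X m n = (listedQuiver r μ).arrow g ∧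
      g.toCellGen.fst = m ∧ g.toCellGen.snd = n) :
    IsBihom (listedQuiver r μ).vertex X := by
  intro m n
  rcases hX m n with h | ⟨g, h, rfl, rfl⟩
  · rw [h]
    simp
  · rw [h]
    exact ⟨(listedQuiver r μ).vertex_mul_arrow g, (listedQuiver r μ).arrow_mul_vertex g⟩

theorem listed_hasDegree_arrow {X : LMat μ} (p : ℤ)
    (hX : ∀ m n, X m n = 0 ∨ ∃ g, X m n = (listedQuiver r μ).arrow g ∧
      g.toCellGen.fst = m ∧ g.toCellGen.snd = n ∧ 1 - g.toCellGen.cell.dim = p) :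
    HasDegree (listedQuiver r μ) μ p X := by
  intro m n
  rcases hX m n with h | ⟨g, h, rfl, rfl, rfl⟩
  · rw [h]
    exact zero_mem _
  · rw [h]
    have := (listedQuiver r μ).arrow_mem g
    convert this using 2
    change _ = μ.val g.toCellGen.snd - μ.val g.toCellGen.fst + 1 - g.toCellGen.cell.dim
    ring

theorem lb_entries (m n : Sheet r) : lb μ m n = 0 ∨ ∃ g, lb μ m n = (listedQuiver r μ).arrow g ∧
    g.toCellGen.fst = m ∧ g.toCellGen.snd = n ∧ 1 - g.toCellGen.cell.dim = 0 := by
  by_cases h : DownRel m n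
  · obtain ⟨k, hk, rfl, rfl⟩ := h.exists
    exact Or.inr ⟨_, lb_apply μ k hk, rfl, rfl, rfl⟩
  · exact Or.inl (lb_supported μ m n h)

theorem lw_entries (m n : Sheet r) : lw μ m n = 0 ∨ ∃ g, lw μ m n = (listedQuiver r μ).arrow g ∧
    g.toCellGen.fst = m ∧ g.toCellGen.snd = n ∧ 1 - g.toCellGen.cell.dim = -1 := by
  by_cases h : UpRel m n
  · obtain ⟨k, hk, rfl, rfl⟩ := h.exists
    exact Or.inr ⟨_, lw_apply μ k hk, rfl, rfl, rfl⟩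
  · exact Or.inl (lw_supported μ m n h)

theorem lz_entries (m n : Sheet r) : lz μ m n = 0 ∨ ∃ g, lz μ m n = (listedQuiver r μ).arrow g ∧
    g.toCellGen.fst = m ∧ g.toCellGen.snd = n ∧ 1 - g.toCellGen.cell.dim = -1 := by
  by_cases h : CuspRel m n
  · obtain ⟨j, rfl, rfl⟩ := h.exists
    exact Or.inr ⟨_, lz_apply μ j, rfl, rfl, rfl⟩
  · exact Or.inl (lz_supported μ m n h)

theorem lcusp_isBihom : IsBihom (listedQuiver r μ).vertex (lcusp μ) :=
  cuspMatrix_isBihom (listedQuiver r μ).vertex_idem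

theorem lb_isBihom : IsBihom (listedQuiver r μ).vertex (lb μ) :=
  listed_isBihom_arrow μ fun m n => (lb_entries μ m n).imp_right fun ⟨g, h⟩ => ⟨g, h.1, h.2.1, h.2.2.1⟩

theorem lw_isBihom : IsBihom (listedQuiver r μ).vertex (lw μ) :=
  listed_isBihom_arrow μ fun m n => (lw_entries μ m n).imp_right fun ⟨g, h⟩ => ⟨g, h.1, h.2.1, h.2.2.1⟩

theorem lz_isBihom : IsBihom (listedQuiver r μ).vertex (lz μ) :=
  listed_isBihom_arrow μ fun m n => (lz_entries μ m n).imp_right fun ⟨g, h⟩ => ⟨g, h.1, h.2.1, h.2.2.1⟩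

theorem lb_hasDegree : HasDegree (listedQuiver r μ) μ 0 (lb μ) :=
  listed_hasDegree_arrow μ 0 (lb_entries μ)

theorem lw_hasDegree : HasDegree (listedQuiver r μ) μ (-1) (lw μ) :=
  listed_hasDegree_arrow μ (-1) (lw_entries μ)

theorem lz_hasDegree : HasDegree (listedQuiver r μ) μ (-1) (lz μ) :=
  listed_hasDegree_arrow μ (-1) (lz_entries μ)

theorem lcusp_hasDegree : HasDegree (listedQuiver r μ) μ 1 (lcusp μ) := by
  intro m n
  unfold lcusp cuspMatrix
  split_ifs with h
  · have := (listedQuiver r μ).vertex_mem m.1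
    rwa [h.val_eq μ, show μ.val n - (μ.val n + 1) + 1 = 0 by ring]
  · exact zero_mem _

end Listed

end ALink

/-! ### The differential on the listed generators and the images of the cells -/

namespace ALink

variable {r : ℕ}

section Products

variable {A : Type} [Ring A] {X Y : Matrix (Sheet r) (Sheet r) A}

/-- N, w and z lead from upper to lower sheets and b leads from lower to upper ones, so two factors
of the same kind cannot be composed. -/
theorem mul_eq_zero_of_ends {R R' : Sheet r → Sheet r → Prop} (hX : X.SupportedOn R)
    (hY : Y.SupportedOn R') (s : Bool) (hR : ∀ m n, R m n → n.2 = s) (hR' : ∀ m n, R' m n → m.2 ≠ s) :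
    X * Y = 0 :=
  hX.mul_eq_zero hY fun _ _ _ h h' => hR' _ _ h' (hR _ _ h)

theorem CuspRel.snd_ne {m n : Sheet r} (h : CuspRel m n) : m.2 ≠ false := by simp [h.2.1]

theorem UpRel.snd_ne {m n : Sheet r} (h : UpRel m n) : m.2 ≠ false := by simp [h.2.1]

theorem DownRel.snd_ne {m n : Sheet r} (h : DownRel m n) : m.2 ≠ true := by simp [h.2.1]

end Products

section Listed

variable (μ : MaslovPotential r)

theorem lcusp_mul_lcusp : lcusp μ * lcusp μ = 0 :=
  mul_eq_zero_of_ends (cuspMatrix_supported _) (cuspMatrix_supported _) false (fun _ _ h => h.2.2)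
    fun _ _ h => h.snd_ne

theorem lcusp_mul_lw : lcusp μ * lw μ = 0 :=
  mul_eq_zero_of_ends (cuspMatrix_supported _) (lw_supported μ) false (fun _ _ h => h.2.2)
    fun _ _ h => h.snd_ne

theorem lw_mul_lcusp : lw μ * lcusp μ = 0 :=
  mul_eq_zero_of_ends (lw_supported μ) (cuspMatrix_supported _) false (fun _ _ h => h.2.2)
    fun _ _ h => h.snd_ne

theorem lcusp_mul_lz : lcusp μ * lz μ = 0 :=
  mul_eq_zero_of_ends (cuspMatrix_supported _) (lz_supported μ) false (fun _ _ h => h.2.2)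
    fun _ _ h => h.snd_ne

theorem lz_mul_lcusp : lz μ * lcusp μ = 0 :=
  mul_eq_zero_of_ends (lz_supported μ) (cuspMatrix_supported _) false (fun _ _ h => h.2.2)
    fun _ _ h => h.snd_ne

theorem lb_mul_lb : lb μ * lb μ = 0 :=
  mul_eq_zero_of_ends (lb_supported μ) (lb_supported μ) true (fun _ _ h => h.2.2)
    fun _ _ h => h.snd_ne

/-- The matrix of the differentials of the generators `z j`. -/
noncomputable def lzDiff : LMat μ := lcusp μ * lb μ * lw μ + lw μ * lb μ * lcusp μ

/-- The paths u_j → ℓ_j → u_{j+1} → ℓ_j and u_j → ℓ_{j-1} → u_j → ℓ_j begin and end on the same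
component. Hence the identity for dz holds for whole matrices, not only at the positions of the
generators. -/
theorem lzDiff_supported : (lzDiff μ).SupportedOn CuspRel := by
  have h1 : ∀ k l m n : Sheet r, CuspRel k l → DownRel l m → UpRel m n → CuspRel k n :=
    fun k l m n h h' h'' => ⟨by
      have := congrArg Fin.val h.1; apply Fin.ext; have := h'.1; have := h''.1; omega, h.2.1, h''.2.2⟩
  have h2 : ∀ k l m n : Sheet r, UpRel k l → DownRel l m → CuspRel m n → CuspRel k n :=
    fun k l m n h h' h'' => ⟨by
      have := congrArg Fin.val h''.1; apply Fin.ext; have := h'.1; have := h.1; omega, h.2.1, h''.2.2⟩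
  refine .add ?_ ?_
  · exact ((cuspMatrix_supported _).mul (lb_supported μ)
      (R'' := fun k m => ∃ l, CuspRel k l ∧ DownRel l m) fun _ l _ h h' => ⟨l, h, h'⟩).mul
      (lw_supported μ) fun k m n ⟨l, h, h'⟩ h'' => h1 k l m n h h' h''
  · exact ((lw_supported μ).mul (lb_supported μ)
      (R'' := fun k m => ∃ l, UpRel k l ∧ DownRel l m) fun _ l _ h h' => ⟨l, h, h'⟩).mul
      (cuspMatrix_supported _) fun k m n ⟨l, h, h'⟩ h'' => h2 k l m n h h' h''

theorem lzDiff_isBihom : IsBihom (listedQuiver r μ).vertex (lzDiff μ) :=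
  (((lcusp_isBihom μ).mul (lb_isBihom μ)).mul (lw_isBihom μ)).add
    (((lw_isBihom μ).mul (lb_isBihom μ)).mul (lcusp_isBihom μ))

theorem lzDiff_hasDegree : HasDegree (listedQuiver r μ) μ 0 (lzDiff μ) :=
  (((lcusp_hasDegree μ).mul (lb_hasDegree μ) rfl).mul (lw_hasDegree μ) rfl).add
    (((lw_hasDegree μ).mul (lb_hasDegree μ) rfl).mul (lcusp_hasDegree μ) rfl)

/-- The differentials of the listed generators. -/
noncomputable def listedDiff : ListedGen r → (listedQuiver r μ).PathAlg
  | .b _ _ => 0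
  | .z j => lzDiff μ (upper j) (lower j)
  | .bdual _ _ => 0

theorem vertex_mul_listedDiff (g : ListedGen r) :
    (listedQuiver r μ).vertex ((listedQuiver r μ).src g) * listedDiff μ g = listedDiff μ g := by
  cases g with
  | b k hk => exact mul_zero _
  | z j => exact (lzDiff_isBihom μ (upper j) (lower j)).1
  | bdual k hk => exact mul_zero _

theorem listedDiff_mul_vertex (g : ListedGen r) :
    listedDiff μ g * (listedQuiver r μ).vertex ((listedQuiver r μ).tgt g) = listedDiff μ g := by
  cases g with
  | b k hk => exact zero_mul _
  | z j => exact (lzDiff_isBihom μ (upper j) (lower j)).2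
  | bdual k hk => exact zero_mul _

theorem listedDiff_mem (g : ListedGen r) :
    listedDiff μ g ∈ (listedQuiver r μ).grading ((listedQuiver r μ).deg g + 1) := by
  cases g with
  | b k hk => exact zero_mem _
  | z j =>
    have := lzDiff_hasDegree μ (upper j) (lower j)
    rwa [show μ.val (lower j) - μ.val (upper j) + 0 =
      μ.val (lower j) - μ.val (upper j) + 1 - 2 + 1 by ring] at this
  | bdual k hk => exact zero_mem _

/-- The derivation on the path algebra of the listed generators. -/
noncomputable def listedDeriv : (listedQuiver r μ).PathAlg →ₗ[ZMod 2] (listedQuiver r μ).PathAlg :=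
  (listedQuiver r μ).deriv (listedDiff μ) (vertex_mul_listedDiff μ) (listedDiff_mul_vertex μ)

theorem listedDeriv_arrow (g : ListedGen r) :
    listedDeriv μ ((listedQuiver r μ).arrow g) = listedDiff μ g :=
  (listedQuiver r μ).deriv_arrow _ _ _ g

theorem listedDeriv_matrix_mul (X Y : LMat μ) : (listedDeriv μ).mapMatrix (X * Y) =
    (listedDeriv μ).mapMatrix X * Y + X * (listedDeriv μ).mapMatrix Y := by
  have := LinearMap.mapMatrix_mul_of_derivation (AlgHom.id _ _) (AlgHom.id _ _) (listedDeriv μ)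
    ((listedQuiver r μ).deriv_mul _ _ _) X Y
  rwa [AlgHom.mapMatrix_id] at this

theorem listedDeriv_matrix_one : (listedDeriv μ).mapMatrix (1 : LMat μ) = 0 :=
  LinearMap.mapMatrix_one_of_map_one ((listedQuiver r μ).deriv_one _ _ _)

theorem listedDeriv_cusp : (listedDeriv μ).mapMatrix (lcusp μ) = 0 := by
  refine (map_cuspMatrix _ (map_zero _)).trans ?_
  ext m n
  unfold cuspMatrix
  split_ifs
  · exact (listedQuiver r μ).deriv_vertex _ _ _ _
  · rfl

theorem listedDeriv_lb : (listedDeriv μ).mapMatrix (lb μ) = 0 := by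
  ext m n
  change listedDeriv μ (lb μ m n) = 0
  by_cases h : DownRel m n
  · obtain ⟨k, hk, rfl, rfl⟩ := h.exists
    rw [lb_apply μ k hk, listedDeriv_arrow]
    rfl
  · rw [lb_supported μ m n h, map_zero]

theorem listedDeriv_lw : (listedDeriv μ).mapMatrix (lw μ) = 0 := by
  ext m n
  change listedDeriv μ (lw μ m n) = 0
  by_cases h : UpRel m n
  · obtain ⟨k, hk, rfl, rfl⟩ := h.exists
    rw [lw_apply μ k hk, listedDeriv_arrow]
    rfl
  · rw [lw_supported μ m n h, map_zero]

theorem listedDeriv_lz : (listedDeriv μ).mapMatrix (lz μ) = lzDiff μ := by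
  ext m n
  change listedDeriv μ (lz μ m n) = _
  by_cases h : CuspRel m n
  · obtain ⟨j, rfl, rfl⟩ := h.exists
    rw [lz_apply μ j, listedDeriv_arrow]
    rfl
  · rw [lz_supported μ m n h, map_zero, lzDiff_supported μ m n h]

theorem listedDeriv_lzDiff : (listedDeriv μ).mapMatrix (lzDiff μ) = 0 := by
  simp only [lzDiff, map_add, listedDeriv_matrix_mul, listedDeriv_cusp, listedDeriv_lb,
    listedDeriv_lw, mul_zero, zero_mul, add_zero]

/-- The differential on the path algebra of the listed generators: `b k` and `bdual k` are cocycles,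
and `d (z j) = b_j b*_j + b*_{j-1} b_{j-1}`. -/
noncomputable def listedDifferential : (listedQuiver r μ).Differential where
  toMap := listedDeriv μ
  leibniz := (listedQuiver r μ).deriv_mul _ _ _
  map_vertex := (listedQuiver r μ).deriv_vertex _ _ _
  degree n x hx := (listedQuiver r μ).deriv_degree _ _ _ (listedDiff_mem μ) n x hx
  sq := (listedQuiver r μ).deriv_sq _ _ _ fun g => by
    cases g with
    | b k hk => exact map_zero _
    | z j => exact congrFun (congrFun (listedDeriv_lzDiff μ) (upper j)) (lower j)
    | bdual k hk => exact map_zero _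

/-- The image of the matrices of the vertices `v₂` and `v₃`. -/
noncomputable def lvertex : LMat μ := (1 + lb μ) * lcusp μ * (1 + lb μ)

/-- The image of the matrix of the face `f₂`. -/
noncomputable def louter : LMat μ := lb μ * lw μ * lb μ

/-- The image of the matrix of the face `f₃`. -/
noncomputable def linner : LMat μ := lw μ + (1 + lb μ) * lz μ * (1 + lb μ)

/-- The images of the matrices of the cells in the path algebra of the listed generators. -/
noncomputable def cellImage : Cell → LMat μ
  | .v₁ => lcusp μ
  | .v₂ => lvertex μ
  | .v₃ => lvertex μ
  | .e₂ => lb μ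
  | .e₃ => 0
  | .c₁ => 0
  | .c₂ => lvertex μ * louter μ + louter μ * lvertex μ
  | .f₂ => louter μ
  | .f₃ => linner μ

theorem cellImage_isBihom (c : Cell) : IsBihom (listedQuiver r μ).vertex (cellImage μ c) := by
  have hN := lcusp_isBihom μ
  have hb := lb_isBihom μ
  have hA : IsBihom (listedQuiver r μ).vertex (lvertex μ) := (hb.one_add_mul hN).mul_one_add hb
  have hF : IsBihom (listedQuiver r μ).vertex (louter μ) := (hb.mul (lw_isBihom μ)).mul hb
  cases c
  case v₁ => exact hN
  case v₂ | v₃ => exact hA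
  case e₂ => exact hb
  case e₃ | c₁ => exact IsBihom.zero
  case c₂ => exact (hA.mul hF).add (hF.mul hA)
  case f₂ => exact hF
  case f₃ => exact (lw_isBihom μ).add ((hb.one_add_mul (lz_isBihom μ)).mul_one_add hb)

theorem cellImage_hasDegree (c : Cell) :
    HasDegree (listedQuiver r μ) μ (1 - c.dim) (cellImage μ c) := by
  have hN := lcusp_hasDegree μ
  have hb := lb_hasDegree μ
  have hU := HasDegree.one.add hb
  have hA : HasDegree (listedQuiver r μ) μ 1 (lvertex μ) := (hU.mul hN rfl).mul hU rfl
  have hF : HasDegree (listedQuiver r μ) μ (-1) (louter μ) := (hb.mul (lw_hasDegree μ) rfl).mul hb rfl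
  cases c
  case v₁ => exact hN
  case v₂ | v₃ => exact hA
  case e₂ => exact hb
  case e₃ | c₁ => exact HasDegree.zero
  case c₂ => exact (hA.mul hF rfl).add (hF.mul hA rfl)
  case f₂ => exact hF
  case f₃ => exact (lw_hasDegree μ).add ((hU.mul (lz_hasDegree μ) rfl).mul hU rfl)

end Listed

end ALink

/-! ### The homomorphism φ to the listed algebra -/

namespace ALink

variable {r : ℕ}

/-- The four hypotheses on the relations treat the terms X, bX, Xb and bXb of the product. -/
theorem _root_.Matrix.SupportedOn.conj_one_add {A : Type} [Ring A] {b X : Matrix (Sheet r) (Sheet r) A}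
    {R R' : Sheet r → Sheet r → Prop} (hb : b.SupportedOn DownRel) (hX : X.SupportedOn R)
    (h0 : ∀ m n, R m n → R' m n) (h1 : ∀ k m n, DownRel k m → R m n → R' k n)
    (h2 : ∀ k m n, R k m → DownRel m n → R' k n)
    (h3 : ∀ k l m n, DownRel k l → R l m → DownRel m n → R' k n) :
    ((1 + b) * X * (1 + b)).SupportedOn R' := by
  have e : (1 + b) * X * (1 + b) = X + b * X + (X * b + b * X * b) := by noncomm_ring
  rw [e]
  refine ((hX.mono h0).add (hb.mul hX h1)).add ((hX.mul hb h2).add ?_)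
  exact (hb.mul hX (R'' := fun k m => ∃ l, DownRel k l ∧ R l m) fun _ l _ h h' => ⟨l, h, h'⟩).mul
    hb fun k m n ⟨l, h, h'⟩ h'' => h3 k l m n h h' h''

theorem mul_apply_eq_zero_of_upper {A : Type} [Ring A] {b : Matrix (Sheet r) (Sheet r) A}
    (hb : b.SupportedOn DownRel) (X : Matrix (Sheet r) (Sheet r) A) (j : Fin r) (n : Sheet r) :
    (b * X) (upper j) n = 0 := by
  rw [Matrix.mul_apply]
  refine Finset.sum_eq_zero fun k _ => ?_
  rw [hb _ _ fun h => absurd h.2.1 (by simp), zero_mul]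

theorem mul_apply_eq_zero_of_lower {A : Type} [Ring A] {b : Matrix (Sheet r) (Sheet r) A}
    (hb : b.SupportedOn DownRel) (X : Matrix (Sheet r) (Sheet r) A) (m : Sheet r) (j : Fin r) :
    (X * b) m (lower j) = 0 := by
  rw [Matrix.mul_apply]
  refine Finset.sum_eq_zero fun k _ => ?_
  rw [hb _ _ fun h => absurd h.2.2 (by simp), mul_zero]

/-- The rows of b at upper sheets and its columns at lower sheets vanish. This is why φ maps z_j to
itself although F₃ goes to a conjugate of z. -/
theorem conj_one_add_apply {A : Type} [Ring A] {b : Matrix (Sheet r) (Sheet r) A}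
    (hb : b.SupportedOn DownRel) (X : Matrix (Sheet r) (Sheet r) A) (i j : Fin r) :
    ((1 + b) * X * (1 + b)) (upper i) (lower j) = X (upper i) (lower j) := by
  rw [mul_add, mul_one, Matrix.add_apply, mul_apply_eq_zero_of_lower hb, add_zero, add_mul, one_mul,
    Matrix.add_apply, mul_apply_eq_zero_of_upper hb, add_zero]

theorem crossRel_of_cuspRel (m n : Sheet r) (h : CuspRel m n) : CrossRel m n := by
  grind [CuspRel, CrossRel, OuterRel]

theorem crossRel_of_down_cusp (k m n : Sheet r) (h : DownRel k m) (h' : CuspRel m n) :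
    CrossRel k n := by
  grind [CuspRel, DownRel, CrossRel, OuterRel]

theorem crossRel_of_cusp_down (k m n : Sheet r) (h : CuspRel k m) (h' : DownRel m n) :
    CrossRel k n := by
  grind [CuspRel, DownRel, CrossRel, OuterRel]

theorem crossRel_of_down_cusp_down (k l m n : Sheet r) (h : DownRel k l) (h' : CuspRel l m)
    (h'' : DownRel m n) : CrossRel k n := by
  grind [CuspRel, DownRel, CrossRel, OuterRel]

theorem crossRel_of_cross_down (k m n : Sheet r) (h : CrossRel k m) (h' : DownRel m n) :
    CrossRel k n := by
  grind [DownRel, CrossRel, OuterRel]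

theorem crossRel_of_down_cross (k m n : Sheet r) (h : DownRel k m) (h' : CrossRel m n) :
    CrossRel k n := by
  grind [DownRel, CrossRel, OuterRel]

/-- The path ℓ_k → u_{k+1} → ℓ_k → u_{k+1} is forced at each step. So bwb lives at pairs that are
ordered over `f₂` but not over `f₃`. -/
theorem downRel_of_down_up_down (k l m n : Sheet r) (h : DownRel k l) (h' : UpRel l m)
    (h'' : DownRel m n) : DownRel k n := by
  grind [DownRel, UpRel]

theorem outerRel_of_downRel (m n : Sheet r) (h : DownRel m n) : OuterRel m n := by
  grind [DownRel, OuterRel]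

theorem innerRel_of_upRel (m n : Sheet r) (h : UpRel m n) : InnerRel m n := by
  grind [UpRel, InnerRel]

section Listed

variable (μ : MaslovPotential r)

theorem louter_supported : (louter μ).SupportedOn DownRel :=
  ((lb_supported μ).mul (lw_supported μ) (R'' := fun k m => ∃ l, DownRel k l ∧ UpRel l m)
    fun _ l _ h h' => ⟨l, h, h'⟩).mul (lb_supported μ)
    fun _ _ _ ⟨_, h, h'⟩ h'' => downRel_of_down_up_down _ _ _ _ h h' h''

theorem lvertex_supported : (lvertex μ).SupportedOn CrossRel :=
  .conj_one_add (lb_supported μ) (cuspMatrix_supported _) crossRel_of_cuspRel crossRel_of_down_cusp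
    crossRel_of_cusp_down crossRel_of_down_cusp_down

theorem lz_conj_supported : ((1 + lb μ) * lz μ * (1 + lb μ)).SupportedOn CrossRel :=
  .conj_one_add (lb_supported μ) (lz_supported μ) crossRel_of_cuspRel crossRel_of_down_cusp
    crossRel_of_cusp_down crossRel_of_down_cusp_down

/-- φ is prescribed only at pairs of sheets that carry a generator; with this support the whole
matrix becomes the image of the cell matrix. It also explains the image of F₂: the term bwb of (E +
b)w(E + b) is not allowed over `f₃` and is moved to `f₂`. -/
theorem cellImage_supported (c : Cell) (hc : c ≠ .v₁) : (cellImage μ c).SupportedOn (CellRel c) := by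
  cases c
  case v₁ => exact absurd rfl hc
  case v₂ => exact lvertex_supported μ
  case v₃ => exact (lvertex_supported μ).mono fun _ _ h => Or.inl h
  case e₂ => exact (lb_supported μ).mono outerRel_of_downRel
  case e₃ | c₁ => exact .zero
  case c₂ =>
    exact ((lvertex_supported μ).mul (louter_supported μ) crossRel_of_cross_down).add
      ((louter_supported μ).mul (lvertex_supported μ) crossRel_of_down_cross)
  case f₂ => exact (louter_supported μ).mono outerRel_of_downRel
  case f₃ =>
    exact ((lw_supported μ).mono innerRel_of_upRel).add
      ((lz_conj_supported μ).mono fun _ _ h => Or.inl h)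

/-- The homomorphism from the cellular algebra to the path algebra of the listed generators. -/
noncomputable def cellHom : (cellQuiver r μ).PathAlg →ₐ[ZMod 2] (listedQuiver r μ).PathAlg :=
  (cellQuiver r μ).lift (listedQuiver r μ).vertex
    (fun g : CellGen r => cellImage μ g.cell g.fst g.snd)
    (listedQuiver r μ).vertex_idem (listedQuiver r μ).vertex_orth (listedQuiver r μ).vertex_sum
    (fun g : CellGen r => (cellImage_isBihom μ g.cell g.fst g.snd).1)
    (fun g : CellGen r => (cellImage_isBihom μ g.cell g.fst g.snd).2)

theorem cellHom_vertex (v : Fin r) :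
    cellHom μ ((cellQuiver r μ).vertex v) = (listedQuiver r μ).vertex v :=
  (cellQuiver r μ).lift_gen _ _ _ _ _ _ _ (Sum.inl v)

theorem cellHom_arrow (g : CellGen r) :
    cellHom μ ((cellQuiver r μ).arrow g) = cellImage μ g.cell g.fst g.snd :=
  (cellQuiver r μ).lift_gen _ _ _ _ _ _ _ (Sum.inr g)

/-- The constant matrix of the cusps over the cellular algebra. -/
noncomputable abbrev ccusp : Mat μ := cuspMatrix (cellQuiver r μ).vertex

theorem cellMatrix_v₁_eq : cellMatrix μ .v₁ = ccusp μ := by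
  ext m n
  unfold cellMatrix ccusp cuspMatrix
  rw [dif_neg fun h => (prec_iff .v₁ m n).1 h]
  by_cases h : CuspRel m n
  · rw [if_pos h, if_pos]
    obtain ⟨j, rfl, rfl⟩ := h.exists
    exact ⟨rfl, (isCusp_iff _ _).2 (Or.inl rfl), rfl, rfl⟩
  · rw [if_neg h, if_neg]
    rintro ⟨-, -, h1, h2⟩
    exact h ⟨by rw [h2], by rw [h1], by rw [h2]⟩

theorem cellMatrix_supportedOn {c : Cell} (hc : c ≠ .v₁) :
    (cellMatrix μ c).SupportedOn (CellRel c) := fun m n h =>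
  cellMatrix_supported μ c hc m n fun h' => h ((prec_iff c m n).1 h')

theorem cellHom_cellMatrix (c : Cell) : (cellHom μ).mapMatrix (cellMatrix μ c) = cellImage μ c := by
  by_cases hc : c = .v₁
  · subst hc
    rw [cellMatrix_v₁_eq, AlgHom.mapMatrix_apply, ccusp, map_cuspMatrix _ (map_zero _)]
    exact congrArg cuspMatrix (funext (cellHom_vertex μ))
  · ext m n
    rw [AlgHom.mapMatrix_apply, Matrix.map_apply]
    by_cases h : CellRel c m n
    · rw [cellMatrix_apply μ ((prec_iff c m n).2 h), cellHom_arrow]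
    · rw [cellMatrix_supportedOn μ hc m n h, map_zero, cellImage_supported μ c hc m n h]

/-- As b² = 0 in characteristic two, E + b is its own inverse, so `lvertex` is the conjugate of N by
E + b. -/
theorem one_add_lb_mul_self : (1 + lb μ) * (1 + lb μ) = 1 := by
  have e : (1 + lb μ) * (1 + lb μ) = 1 + (lb μ + lb μ) + lb μ * lb μ := by noncomm_ring
  rw [e, lb_mul_lb, ZModModule.add_self, add_zero, add_zero]

theorem lb_mul_louter : lb μ * louter μ = 0 := by
  rw [louter, ← mul_assoc, ← mul_assoc, lb_mul_lb, zero_mul, zero_mul]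

theorem louter_mul_lb : louter μ * lb μ = 0 := by
  rw [louter, mul_assoc, lb_mul_lb, mul_zero]

theorem lvertex_mul_one_add : lvertex μ * (1 + lb μ) = (1 + lb μ) * lcusp μ := by
  rw [lvertex, mul_assoc, one_add_lb_mul_self, mul_one]

theorem one_add_mul_lvertex : (1 + lb μ) * lvertex μ = lcusp μ * (1 + lb μ) := by
  rw [lvertex, ← mul_assoc, ← mul_assoc, one_add_lb_mul_self, one_mul]

theorem lvertex_mul_lvertex : lvertex μ * lvertex μ = 0 := by
  rw [lvertex, ← mul_assoc, ← lvertex, ← mul_assoc, lvertex_mul_one_add, mul_assoc (1 + lb μ),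
    lcusp_mul_lcusp, mul_zero, zero_mul]

theorem listedDeriv_lvertex : (listedDeriv μ).mapMatrix (lvertex μ) = 0 := by
  simp only [lvertex, listedDeriv_matrix_mul, map_add, listedDeriv_matrix_one, listedDeriv_lb,
    listedDeriv_cusp, zero_mul, mul_zero, add_zero]

theorem listedDeriv_louter : (listedDeriv μ).mapMatrix (louter μ) = 0 := by
  simp only [louter, listedDeriv_matrix_mul, listedDeriv_lw, listedDeriv_lb, zero_mul, mul_zero,
    add_zero]

theorem lvertex_mul_conj (x : LMat μ) (h : lcusp μ * x = 0) :
    lvertex μ * ((1 + lb μ) * x * (1 + lb μ)) = 0 := by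
  rw [← mul_assoc, ← mul_assoc, lvertex_mul_one_add, mul_assoc (1 + lb μ), h, mul_zero, zero_mul]

theorem conj_mul_lvertex (x : LMat μ) (h : x * lcusp μ = 0) :
    (1 + lb μ) * x * (1 + lb μ) * lvertex μ = 0 := by
  rw [mul_assoc, one_add_mul_lvertex, ← mul_assoc, mul_assoc (1 + lb μ), h, mul_zero, zero_mul]

/-- Let A be the conjugate of N by E + b. Since Nw = wN = 0, A annihilates (E + b)w(E + b) from both
sides, so in the commutator with A the matrix w + bwb may be replaced by bw + wb. The result is the
conjugate of Nbw + wbN, which is the differential of the conjugate of z. -/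
theorem listedDeriv_linner : (listedDeriv μ).mapMatrix (linner μ) =
    lvertex μ * (lw μ + louter μ) + (lw μ + louter μ) * lvertex μ := by
  have h1 : lvertex μ * (lw μ + louter μ) = lvertex μ * (lb μ * lw μ + lw μ * lb μ) := by
    have h := lvertex_mul_conj μ _ (lcusp_mul_lw μ)
    rw [← sub_eq_zero, ZModModule.sub_eq_add, ← mul_add, ← h, louter]
    congr 1
    noncomm_ring
  have h2 : (lw μ + louter μ) * lvertex μ = (lb μ * lw μ + lw μ * lb μ) * lvertex μ := by
    have h := conj_mul_lvertex μ _ (lw_mul_lcusp μ)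
    rw [← sub_eq_zero, ZModModule.sub_eq_add, ← add_mul, ← h, louter]
    congr 1
    noncomm_ring
  have h3 : lvertex μ * (lb μ * lw μ + lw μ * lb μ) =
      (1 + lb μ) * (lcusp μ * lb μ * lw μ) * (1 + lb μ) := by
    have e : (1 + lb μ) * (lb μ * lw μ + lw μ * lb μ) =
        lw μ * lb μ + lb μ * lw μ * (1 + lb μ) + lb μ * lb μ * lw μ := by noncomm_ring
    rw [lvertex, mul_assoc _ (1 + lb μ), e, lb_mul_lb, zero_mul, add_zero, mul_assoc, mul_add,
      ← mul_assoc (lcusp μ) (lw μ), lcusp_mul_lw, zero_mul, zero_add]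
    noncomm_ring
  have h4 : (lb μ * lw μ + lw μ * lb μ) * lvertex μ =
      (1 + lb μ) * (lw μ * lb μ * lcusp μ) * (1 + lb μ) := by
    have e : (lb μ * lw μ + lw μ * lb μ) * (1 + lb μ) =
        lb μ * lw μ + (1 + lb μ) * lw μ * lb μ + lw μ * (lb μ * lb μ) := by noncomm_ring
    rw [lvertex, ← mul_assoc, ← mul_assoc, e, lb_mul_lb, mul_zero, add_zero, add_mul _ _ (lcusp μ),
      mul_assoc (lb μ) (lw μ) (lcusp μ), lw_mul_lcusp, mul_zero, zero_add]
    noncomm_ring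
  have h5 : (listedDeriv μ).mapMatrix (linner μ) = (1 + lb μ) * lzDiff μ * (1 + lb μ) := by
    simp only [linner, listedDeriv_matrix_mul, map_add, listedDeriv_matrix_one, listedDeriv_lb,
      listedDeriv_lw, listedDeriv_lz, zero_mul, mul_zero, add_zero, zero_add]
  rw [h1, h2, h3, h4, h5, lzDiff, mul_add (1 + lb μ), add_mul _ _ (1 + lb μ)]

/-- The conjugate A of N satisfies the equations of `v₂`, `v₃`, `e₂` and `e₃`. The image of C₂ is
the one forced by the equation of `f₂`; with it the equation of `f₃` reduces to
`listedDeriv_linner`, because A annihilates the conjugate of z. -/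
theorem listedDeriv_cellImage (c : Cell) :
    (listedDeriv μ).mapMatrix (cellImage μ c) = (cellHom μ).mapMatrix (cellDiff μ c) := by
  cases c
  case v₁ =>
    rw [cellDiff, map_pow, cellHom_cellMatrix, cellImage, listedDeriv_cusp, pow_two, lcusp_mul_lcusp]
  case v₂ =>
    rw [cellDiff, map_pow, cellHom_cellMatrix, cellImage, listedDeriv_lvertex, pow_two,
      lvertex_mul_lvertex]
  case v₃ =>
    rw [cellDiff, map_pow, cellHom_cellMatrix, cellImage, listedDeriv_lvertex, pow_two,
      lvertex_mul_lvertex]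
  case e₂ =>
    simp only [cellDiff, edgeFormula, map_add, map_mul, map_one, cellHom_cellMatrix, cellImage]
    rw [listedDeriv_lb, lvertex_mul_one_add, ZModModule.add_self]
  case e₃ =>
    simp only [cellDiff, edgeFormula, map_add, map_mul, map_one, cellHom_cellMatrix, cellImage]
    rw [map_zero, add_zero, mul_one, one_mul, ZModModule.add_self]
  case c₁ =>
    simp only [cellDiff, edgeFormula, map_add, map_mul, map_one, cellHom_cellMatrix, cellImage]
    rw [map_zero, add_zero, mul_one, one_mul, ZModModule.add_self]
  case c₂ =>
    simp only [cellDiff, edgeFormula, map_add, map_mul, map_one, cellHom_cellMatrix, cellImage]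
    simp only [listedDeriv_matrix_mul, listedDeriv_lvertex, listedDeriv_louter, mul_zero, zero_mul,
      add_zero]
    have e : ∀ a f : LMat μ, a * (1 + (a * f + f * a)) + (1 + (a * f + f * a)) * a =
        (a + a) + (a * f * a + a * f * a) + a * a * f + f * (a * a) := by
      intro a f
      noncomm_ring
    rw [e, lvertex_mul_lvertex, ZModModule.add_self, ZModModule.add_self, zero_mul, mul_zero,
      add_zero, add_zero, add_zero]
  case f₂ =>
    rw [cellDiff, faceFormula_two]
    simp only [map_add, map_mul, cellHom_cellMatrix, cellImage]
    have h1 : (lvertex μ * louter μ + louter μ * lvertex μ) * (1 + lb μ) =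
        lvertex μ * louter μ + louter μ * lcusp μ := by
      rw [add_mul, mul_assoc, mul_assoc, lvertex_mul_one_add, mul_add, mul_one, louter_mul_lb,
        add_zero, ← mul_assoc, mul_add, mul_one, louter_mul_lb, add_zero]
    rw [listedDeriv_louter, mul_zero, add_zero, zero_add, ← mul_one_add, h1, ZModModule.add_self]
  case f₃ =>
    rw [cellDiff, faceFormula_one]
    simp only [map_add, map_mul, cellHom_cellMatrix, cellImage]
    rw [listedDeriv_linner, linner]
    have h1 := lvertex_mul_conj μ _ (lcusp_mul_lz μ)
    have h2 := conj_mul_lvertex μ _ (lz_mul_lcusp μ)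
    rw [mul_add, mul_add, add_mul, add_mul _ _ (lvertex μ), h1, h2, zero_mul]
    abel

theorem cellDeriv_mul (x y : (cellQuiver r μ).PathAlg) :
    cellDeriv μ (x * y) = cellDeriv μ x * y + x * cellDeriv μ y :=
  (cellDifferential μ).leibniz x y

theorem cellDeriv_vertex (v : Fin r) : cellDeriv μ ((cellQuiver r μ).vertex v) = 0 :=
  (cellDifferential μ).map_vertex v

theorem cellDeriv_arrow (g : CellGen r) :
    cellDeriv μ ((cellQuiver r μ).arrow g) = cellDiff μ g.cell g.fst g.snd :=
  (cellQuiver r μ).deriv_arrow _ _ _ g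

theorem listedDeriv_mul (x y : (listedQuiver r μ).PathAlg) :
    listedDeriv μ (x * y) = listedDeriv μ x * y + x * listedDeriv μ y :=
  (listedDifferential μ).leibniz x y

theorem listedDeriv_vertex (v : Fin r) : listedDeriv μ ((listedQuiver r μ).vertex v) = 0 :=
  (listedDifferential μ).map_vertex v

theorem cellHom_cellDeriv (x : (cellQuiver r μ).PathAlg) :
    cellHom μ (cellDeriv μ x) = listedDeriv μ (cellHom μ x) := by
  -- The difference of the two sides is a derivation relative to φ on both sides, so the generators
  -- suffice.
  have key := (cellQuiver r μ).derivation_eq_zero (cellHom μ) (cellHom μ)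
    ((cellHom μ).toLinearMap ∘ₗ cellDeriv μ - listedDeriv μ ∘ₗ (cellHom μ).toLinearMap) ?_ ?_ ?_ x
  · exact sub_eq_zero.1 key
  · intro x y
    simp only [LinearMap.sub_apply, LinearMap.comp_apply, AlgHom.toLinearMap_apply, cellDeriv_mul,
      map_add, map_mul, listedDeriv_mul]
    noncomm_ring
  · intro v
    simp only [LinearMap.sub_apply, LinearMap.comp_apply, AlgHom.toLinearMap_apply,
      cellDeriv_vertex, cellHom_vertex, listedDeriv_vertex, map_zero, sub_zero]
  · intro g
    simp only [LinearMap.sub_apply, LinearMap.comp_apply, AlgHom.toLinearMap_apply]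
    rw [cellDeriv_arrow μ g, cellHom_arrow μ g, sub_eq_zero]
    exact (congrFun (congrFun (listedDeriv_cellImage μ g.cell) g.fst) g.snd).symm

/-- The homomorphism of dg algebras from the cellular dg algebra to the dg algebra freely generated
by the listed generators. -/
noncomputable def cellDGHom : (cellularDGA r μ).Hom (listedDifferential μ).dgAlgebra where
  toAlgHom := cellHom μ
  map_e := cellHom_vertex μ
  map_grading := (cellQuiver r μ).map_mem_grading (listedQuiver r μ) (cellHom μ)
    (fun v => by
      rw [cellHom_vertex]
      exact (listedQuiver r μ).vertex_mem v)
    (fun g => by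
      rw [cellHom_arrow μ g]
      have := cellImage_hasDegree μ g.cell g.fst g.snd
      rwa [show μ.val g.snd - μ.val g.fst + (1 - g.cell.dim) = (cellQuiver r μ).deg g by
        change _ = μ.val g.snd - μ.val g.fst + 1 - g.cell.dim
        ring] at this)
  map_d := cellHom_cellDeriv μ

theorem cellHom_listed (g : ListedGen r) :
    cellHom μ ((cellQuiver r μ).arrow g.toCellGen) = (listedQuiver r μ).arrow g := by
  rw [cellHom_arrow]
  cases g with
  | b k hk => exact lb_apply μ k hk
  | z j =>
    have hw : lw μ (upper j) (lower j) = 0 := lw_supported μ _ _ fun h => by simp [UpRel] at h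
    have h1 : ((1 + lb μ) * lz μ * (1 + lb μ)) (upper j) (lower j) = lz μ (upper j) (lower j) :=
      conj_one_add_apply (lb_supported μ) _ j j
    exact (congrArg₂ (· + ·) hw (h1.trans (lz_apply μ j))).trans (zero_add _)
  | bdual k hk =>
    have h1 := lz_conj_supported μ (upper ⟨k + 1, hk⟩) (lower ⟨k, by omega⟩)
      (by grind [CrossRel, OuterRel])
    exact (congrArg₂ (· + ·) (lw_apply μ k hk) h1).trans (add_zero _)

end Listed

end ALink

/-! ### The transported disc and the homomorphism ψ from the listed algebra -/

namespace ALink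

variable {r : ℕ}

/-- ℓ_k and u_{k+1} are neighbours outside the crossing circle, so a composition of two strict
relations never joins them, and these are the only pairs lost over the circle. -/
theorem crossRel_of_outer_outer (k m n : Sheet r) (h : OuterRel k m) (h' : OuterRel m n) :
    CrossRel k n := by
  grind [CrossRel, OuterRel]

/-- Likewise u_{k+1} and ℓ_k are neighbours inside the circle. -/
theorem crossRel_of_inner_inner (k m n : Sheet r) (h : InnerRel k m) (h' : InnerRel m n) :
    CrossRel k n := by
  grind [InnerRel, CrossRel, OuterRel]

theorem crossRel_of_cross_up (k m n : Sheet r) (h : CrossRel k m) (h' : UpRel m n) :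
    CrossRel k n := by
  grind [UpRel, CrossRel, OuterRel]

theorem crossRel_of_up_cross (k m n : Sheet r) (h : UpRel k m) (h' : CrossRel m n) :
    CrossRel k n := by
  grind [UpRel, CrossRel, OuterRel]

theorem outerRel_of_cuspRel (m n : Sheet r) (h : CuspRel m n) : OuterRel m n :=
  (crossRel_of_cuspRel m n h).1

theorem not_downRel_of_crossRel {m n : Sheet r} (h : DownRel m n) : ¬ CrossRel m n := fun h' =>
  h'.2 h

theorem not_crossRel_of_upRel {m n : Sheet r} (h : UpRel m n) : ¬ CrossRel m n := by
  grind [UpRel, CrossRel, OuterRel]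

section Cellular

variable (μ : MaslovPotential r)

theorem cellMatrix_isBihom (c : Cell) : IsBihom (cellQuiver r μ).vertex (cellMatrix μ c) :=
  fun m n => (cellMatrix_homog μ c _ rfl m n).2

theorem e₂_supported : (cellMatrix μ .e₂).SupportedOn OuterRel :=
  cellMatrix_supportedOn μ (c := .e₂) (by simp)

theorem e₃_supported : (cellMatrix μ .e₃).SupportedOn InnerRel :=
  cellMatrix_supportedOn μ (c := .e₃) (by simp)

theorem f₂_supported : (cellMatrix μ .f₂).SupportedOn OuterRel :=
  cellMatrix_supportedOn μ (c := .f₂) (by simp)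

theorem f₃_supported : (cellMatrix μ .f₃).SupportedOn InnerRel :=
  cellMatrix_supportedOn μ (c := .f₃) (by simp)

theorem v₂_supported : (cellMatrix μ .v₂).SupportedOn CrossRel :=
  cellMatrix_supportedOn μ (c := .v₂) (by simp)

theorem v₃_supported : (cellMatrix μ .v₃).SupportedOn InnerRel :=
  cellMatrix_supportedOn μ (c := .v₃) (by simp)

theorem c₂_supported : (cellMatrix μ .c₂).SupportedOn CrossRel :=
  cellMatrix_supportedOn μ (c := .c₂) (by simp)

theorem exists_outerTail : ∃ T : Mat μ, (1 + cellMatrix μ .e₂) * (1 + T) = 1 ∧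
    (1 + T) * (1 + cellMatrix μ .e₂) = 1 ∧ T.SupportedOn OuterRel ∧
    IsBihom (cellQuiver r μ).vertex T := by
  have h := e₂_supported μ
  obtain ⟨T, h1, h2, h3⟩ := exists_one_add_inverse (X := cellMatrix μ .e₂)
    -- The positions from the top just outside the circle: 2j for u_j and 2j + 1 for ℓ_j. The bound
    -- is not sharp.
    (rank := fun m => 2 * m.1 + (if m.2 then 0 else 1)) (N := 2 * r + 2)
    (fun m => by have := m.1.2; split <;> omega)
    (h.mono fun m n h => by grind [OuterRel])
  exact ⟨T, h1, h2, h3 _ .zero (fun _ _ => .add) (fun Y Z hY hZ => hY.mul hZ fun _ _ _ h h' =>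
    (crossRel_of_outer_outer _ _ _ h h').1) h, h3 _ .zero (fun _ _ => .add) (fun _ _ => .mul)
    (cellMatrix_isBihom μ _)⟩

theorem exists_innerTail : ∃ T : Mat μ, (1 + cellMatrix μ .e₃) * (1 + T) = 1 ∧
    (1 + T) * (1 + cellMatrix μ .e₃) = 1 ∧ T.SupportedOn InnerRel ∧
    IsBihom (cellQuiver r μ).vertex T := by
  have h := e₃_supported μ
  obtain ⟨T, h1, h2, h3⟩ := exists_one_add_inverse (X := cellMatrix μ .e₃)
    -- Inside the circle ℓ_j, with rank 2j + 3, lies between u_{j+1} with rank 2j + 2 and u_{j+2}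
    -- with rank 2j + 4.
    (rank := fun m => 2 * m.1 + (if m.2 then 0 else 3)) (N := 2 * r + 4)
    (fun m => by have := m.1.2; split <;> omega)
    (h.mono fun m n h => by grind [InnerRel, CrossRel, OuterRel])
  exact ⟨T, h1, h2, h3 _ .zero (fun _ _ => .add) (fun Y Z hY hZ => hY.mul hZ fun _ _ _ h h' =>
    Or.inl (crossRel_of_inner_inner _ _ _ h h')) h, h3 _ .zero (fun _ _ => .add) (fun _ _ => .mul)
    (cellMatrix_isBihom μ _)⟩

/-- `(E + B)⁻¹ - E` for the matrix `B` of the edge `e₂`. -/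
noncomputable def outerTail : Mat μ := (exists_outerTail μ).choose

/-- `(E + B)⁻¹ - E` for the matrix `B` of the edge `e₃`. -/
noncomputable def innerTail : Mat μ := (exists_innerTail μ).choose

theorem outer_mul_tail : (1 + cellMatrix μ .e₂) * (1 + outerTail μ) = 1 :=
  (exists_outerTail μ).choose_spec.1

theorem tail_mul_outer : (1 + outerTail μ) * (1 + cellMatrix μ .e₂) = 1 :=
  (exists_outerTail μ).choose_spec.2.1

theorem outerTail_supported : (outerTail μ).SupportedOn OuterRel :=
  (exists_outerTail μ).choose_spec.2.2.1

theorem outerTail_isBihom : IsBihom (cellQuiver r μ).vertex (outerTail μ) :=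
  (exists_outerTail μ).choose_spec.2.2.2

theorem inner_mul_tail : (1 + cellMatrix μ .e₃) * (1 + innerTail μ) = 1 :=
  (exists_innerTail μ).choose_spec.1

theorem tail_mul_inner : (1 + innerTail μ) * (1 + cellMatrix μ .e₃) = 1 :=
  (exists_innerTail μ).choose_spec.2.1

theorem innerTail_supported : (innerTail μ).SupportedOn InnerRel :=
  (exists_innerTail μ).choose_spec.2.2.1

theorem innerTail_isBihom : IsBihom (cellQuiver r μ).vertex (innerTail μ) :=
  (exists_innerTail μ).choose_spec.2.2.2

/-- The matrix of the face, transported to the constant differential `N`. -/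
noncomputable def disc : Mat μ :=
  (1 + outerTail μ) * ((1 + innerTail μ) * cellMatrix μ .f₃) * (1 + cellMatrix μ .e₂) +
    (1 + outerTail μ) * cellMatrix μ .f₂

theorem disc_isBihom : IsBihom (cellQuiver r μ).vertex (disc μ) :=
  (((outerTail_isBihom μ).one_add_mul ((innerTail_isBihom μ).one_add_mul
    (cellMatrix_isBihom μ _))).mul_one_add (cellMatrix_isBihom μ _)).add
    ((outerTail_isBihom μ).one_add_mul (cellMatrix_isBihom μ _))

/-- The homomorphism from the path algebra of the listed generators to the cellular algebra. -/
noncomputable def listedHom : (listedQuiver r μ).PathAlg →ₐ[ZMod 2] (cellQuiver r μ).PathAlg :=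
  (listedQuiver r μ).lift (cellQuiver r μ).vertex
    (fun g : ListedGen r => match g with
      | .b k hk => (cellQuiver r μ).arrow (ListedGen.b k hk).toCellGen
      | .z j => disc μ (upper j) (lower j)
      | .bdual k hk => (cellQuiver r μ).arrow (ListedGen.bdual k hk).toCellGen)
    (cellQuiver r μ).vertex_idem (cellQuiver r μ).vertex_orth (cellQuiver r μ).vertex_sum
    (fun g : ListedGen r => match g with
      | .b k hk => (cellQuiver r μ).vertex_mul_arrow (ListedGen.b k hk).toCellGen
      | .z j => (disc_isBihom μ (upper j) (lower j)).1
      | .bdual k hk => (cellQuiver r μ).vertex_mul_arrow (ListedGen.bdual k hk).toCellGen)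
    (fun g : ListedGen r => match g with
      | .b k hk => (cellQuiver r μ).arrow_mul_vertex (ListedGen.b k hk).toCellGen
      | .z j => (disc_isBihom μ (upper j) (lower j)).2
      | .bdual k hk => (cellQuiver r μ).arrow_mul_vertex (ListedGen.bdual k hk).toCellGen)

theorem listedHom_vertex (v : Fin r) :
    listedHom μ ((listedQuiver r μ).vertex v) = (cellQuiver r μ).vertex v :=
  (listedQuiver r μ).lift_gen _ _ _ _ _ _ _ (Sum.inl v)

theorem listedHom_b (k : ℕ) (hk : k + 1 < r) :
    listedHom μ ((listedQuiver r μ).arrow (ListedGen.b k hk)) =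
      (cellQuiver r μ).arrow (ListedGen.b k hk).toCellGen :=
  (listedQuiver r μ).lift_gen _ _ _ _ _ _ _ (Sum.inr (ListedGen.b k hk))

theorem listedHom_bdual (k : ℕ) (hk : k + 1 < r) :
    listedHom μ ((listedQuiver r μ).arrow (ListedGen.bdual k hk)) =
      (cellQuiver r μ).arrow (ListedGen.bdual k hk).toCellGen :=
  (listedQuiver r μ).lift_gen _ _ _ _ _ _ _ (Sum.inr (ListedGen.bdual k hk))

theorem listedHom_z (j : Fin r) :
    listedHom μ ((listedQuiver r μ).arrow (ListedGen.z j)) = disc μ (upper j) (lower j) :=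
  (listedQuiver r μ).lift_gen _ _ _ _ _ _ _ (Sum.inr (ListedGen.z j))

/-- The part of the matrix of the edge `e₂` formed by the generators `b k`. -/
noncomputable def cb : Mat μ := (listedHom μ).mapMatrix (lb μ)

/-- The part of the matrix of the face `f₃` formed by the generators `bdual k`. -/
noncomputable def cw : Mat μ := (listedHom μ).mapMatrix (lw μ)

/-- The entries of `disc` at the upper and the lower sheets of the components. -/
noncomputable def cz : Mat μ := (listedHom μ).mapMatrix (lz μ)

theorem listedHom_lcusp : (listedHom μ).mapMatrix (lcusp μ) = ccusp μ := by
  rw [AlgHom.mapMatrix_apply, lcusp, map_cuspMatrix _ (map_zero _)]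
  exact congrArg cuspMatrix (funext (listedHom_vertex μ))

theorem cb_supported : (cb μ).SupportedOn DownRel := (lb_supported μ).map (map_zero (listedHom μ))

theorem cw_supported : (cw μ).SupportedOn UpRel := (lw_supported μ).map (map_zero (listedHom μ))

theorem cz_supported : (cz μ).SupportedOn CuspRel := (lz_supported μ).map (map_zero (listedHom μ))

theorem cb_apply {m n : Sheet r} (h : DownRel m n) : cb μ m n = cellMatrix μ .e₂ m n := by
  obtain ⟨k, hk, rfl, rfl⟩ := h.exists
  exact ((congrArg (listedHom μ) (lb_apply μ k hk)).trans (listedHom_b μ k hk)).trans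
    (cellMatrix_apply μ (ListedGen.b k hk).toCellGen.prec).symm

theorem cw_apply {m n : Sheet r} (h : UpRel m n) : cw μ m n = cellMatrix μ .f₃ m n := by
  obtain ⟨k, hk, rfl, rfl⟩ := h.exists
  exact ((congrArg (listedHom μ) (lw_apply μ k hk)).trans (listedHom_bdual μ k hk)).trans
    (cellMatrix_apply μ (ListedGen.bdual k hk).toCellGen.prec).symm

theorem cz_apply {m n : Sheet r} (h : CuspRel m n) : cz μ m n = disc μ m n := by
  obtain ⟨j, rfl, rfl⟩ := h.exists
  change listedHom μ (lz μ _ _) = _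
  rw [lz_apply μ j, listedHom_z]

theorem listedHom_isBihom {X : LMat μ} (h : IsBihom (listedQuiver r μ).vertex X) :
    IsBihom (cellQuiver r μ).vertex ((listedHom μ).mapMatrix X) := by
  intro m n
  rw [AlgHom.mapMatrix_apply, Matrix.map_apply, ← listedHom_vertex, ← listedHom_vertex, ← map_mul,
    ← map_mul, (h m n).1, (h m n).2]
  exact ⟨rfl, rfl⟩

/-- The pairs ordered over `e₂` but not over the circle carry exactly the generators b_k, so B₂ and
b agree there. -/
theorem e₂_add_cb_supported : (cellMatrix μ .e₂ + cb μ).SupportedOn CrossRel := by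
  intro m n h
  rw [Matrix.add_apply]
  by_cases h1 : DownRel m n
  · rw [cb_apply μ h1, ZModModule.add_self]
  · rw [cb_supported μ m n h1, e₂_supported μ m n fun h2 => h ⟨h2, h1⟩, add_zero]

theorem f₃_add_cw_supported : (cellMatrix μ .f₃ + cw μ).SupportedOn CrossRel := by
  intro m n h
  rw [Matrix.add_apply]
  by_cases h1 : UpRel m n
  · rw [cw_apply μ h1, ZModModule.add_self]
  · rw [cw_supported μ m n h1, f₃_supported μ m n fun h2 => h2.elim h h1,
      add_zero]

/-- The tail T of U⁻¹ satisfies T = B₂ + B₂T, and B₂T composes two outer relations. So T, like B₂,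
has leading part b. -/
theorem outerTail_add_cb_supported : (outerTail μ + cb μ).SupportedOn CrossRel := by
  have h := outer_mul_tail μ
  have e : (1 + cellMatrix μ .e₂) * (1 + outerTail μ) =
      1 + (cellMatrix μ .e₂ + outerTail μ + cellMatrix μ .e₂ * outerTail μ) := by noncomm_ring
  rw [e, add_eq_left] at h
  have h1 : outerTail μ = cellMatrix μ .e₂ + cellMatrix μ .e₂ * outerTail μ := by
    rw [← sub_eq_zero, ZModModule.sub_eq_add, ← h]
    abel
  rw [h1, add_right_comm]
  exact (e₂_add_cb_supported μ).add ((e₂_supported μ).mul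
    (outerTail_supported μ) crossRel_of_outer_outer)

theorem innerTail_mul_f₃_supported : (innerTail μ * cellMatrix μ .f₃).SupportedOn CrossRel :=
  (innerTail_supported μ).mul (f₃_supported μ) crossRel_of_inner_inner

/-- The remainder after splitting off the leading terms of `disc`. -/
noncomputable def discRem : Mat μ :=
  disc μ + (cw μ + cb μ * cw μ + cw μ * cb μ + cellMatrix μ .f₂ + cb μ * cw μ * cb μ)

/-- Modulo matrices supported on the crossing order, B₂ and the tail of U⁻¹ are b, and V⁻¹F₃ is w.
Hence the leading part of `disc` is (E + b)w(E + b) + F₂. -/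
theorem discRem_supported : (discRem μ).SupportedOn CrossRel := by
  have hT := outerTail_supported μ
  have hB := e₂_supported μ
  have hF := f₂_supported μ
  have hw := cw_supported μ
  have hb := cb_supported μ
  have hTb := outerTail_add_cb_supported μ
  have hBb := e₂_add_cb_supported μ
  obtain ⟨G, hG, hG'⟩ : ∃ G : Mat μ, (1 + innerTail μ) * cellMatrix μ .f₃ = cw μ + G ∧
      G.SupportedOn CrossRel := by
    refine ⟨_, ?_, (f₃_add_cw_supported μ).add (innerTail_mul_f₃_supported μ)⟩
    rw [add_mul, one_mul, ← add_assoc, ← add_assoc, add_comm (cw μ), add_assoc (cellMatrix μ .f₃),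
      ZModModule.add_self, add_zero]
  -- Each summand contains a factor supported on the crossing order, except the last, which composes
  -- two outer relations.
  have e : discRem μ = (outerTail μ + cb μ) * cw μ + cw μ * (cellMatrix μ .e₂ + cb μ) +
      (outerTail μ + cb μ) * cw μ * cellMatrix μ .e₂ + cb μ * (cw μ * (cellMatrix μ .e₂ + cb μ)) +
      (G + outerTail μ * G + G * cellMatrix μ .e₂ + outerTail μ * (G * cellMatrix μ .e₂)) +
      outerTail μ * cellMatrix μ .f₂ := by
    rw [discRem, disc, hG, ← sub_eq_zero, ZModModule.sub_eq_add]
    have : ∀ T w G B F b : Mat μ, (1 + T) * (w + G) * (1 + B) + (1 + T) * F +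
        (w + b * w + w * b + F + b * w * b) + ((T + b) * w + w * (B + b) + (T + b) * w * B +
        b * (w * (B + b)) + (G + T * G + G * B + T * (G * B)) + T * F) =
        (w + T * w + w * B + T * w * B + G + T * G + G * B + T * G * B + F + T * F + b * w + w * b +
          b * w * b + b * w * B) + (w + T * w + w * B + T * w * B + G + T * G + G * B + T * G * B +
          F + T * F + b * w + w * b + b * w * b + b * w * B) + (0 : Mat μ) := by
      intro T w G B F b
      noncomm_ring
    rw [this, ZModModule.add_self, add_zero]
  have oc : ∀ k m n : Sheet r, OuterRel k m → CrossRel m n → CrossRel k n := fun k m n h h' =>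
    crossRel_of_outer_outer k m n h h'.1
  have co : ∀ k m n : Sheet r, CrossRel k m → OuterRel m n → CrossRel k n := fun k m n h h' =>
    crossRel_of_outer_outer k m n h.1 h'
  rw [e]
  have h1 := hTb.mul hw crossRel_of_cross_up
  have h2 := hw.mul hBb crossRel_of_up_cross
  have h3 := hG'.mul hB co
  exact ((((h1.add h2).add (h1.mul hB co)).add (hb.mul h2 crossRel_of_down_cross)).add
    (((hG'.add (hT.mul hG' oc)).add h3).add (hT.mul h3 oc))).add
    (hT.mul hF crossRel_of_outer_outer)

theorem cb_cw_cb_supported : (cb μ * cw μ * cb μ).SupportedOn DownRel :=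
  ((cb_supported μ).mul (cw_supported μ) (R'' := fun k m => ∃ l, DownRel k l ∧ UpRel l m)
    fun _ l _ h h' => ⟨l, h, h'⟩).mul (cb_supported μ)
    fun _ _ _ ⟨_, h, h'⟩ h'' => downRel_of_down_up_down _ _ _ _ h h' h''

/-- Only w, bw and wb run backwards or along the diagonal. Without them `disc` is strictly
triangular for the outer order. -/
theorem disc_add_supported :
    (disc μ + (cw μ + cb μ * cw μ + cw μ * cb μ)).SupportedOn OuterRel := by
  have e : disc μ + (cw μ + cb μ * cw μ + cw μ * cb μ) =
      discRem μ + (cellMatrix μ .f₂ + cb μ * cw μ * cb μ) := by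
    rw [discRem, ← sub_eq_zero, ZModModule.sub_eq_add]
    have : ∀ d x f y : Mat μ, d + x + (d + (x + f + y) + (f + y)) =
        (d + x + f + y) + (d + x + f + y) := by
      intros
      abel
    rw [this, ZModModule.add_self]
  rw [e]
  exact ((discRem_supported μ).mono fun _ _ h => h.1).add
    ((f₂_supported μ).add ((cb_cw_cb_supported μ).mono outerRel_of_downRel))

end Cellular

end ALink

/-! ### Compatibility of ψ with the differentials -/

namespace ALink

variable {r : ℕ}

section Cellular

variable (μ : MaslovPotential r)

theorem cellDeriv_matrix_mul (X Y : Mat μ) : (cellDeriv μ).mapMatrix (X * Y) =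
    (cellDeriv μ).mapMatrix X * Y + X * (cellDeriv μ).mapMatrix Y :=
  matDeriv_mul μ X Y

theorem cellDeriv_matrix_one : (cellDeriv μ).mapMatrix (1 : Mat μ) = 0 := matDeriv_one μ

theorem cellDeriv_cellMatrix (c : Cell) :
    (cellDeriv μ).mapMatrix (cellMatrix μ c) = cellDiff μ c := matDeriv_cellMatrix μ c

theorem cellDeriv_ccusp : (cellDeriv μ).mapMatrix (ccusp μ) = 0 := by
  rw [← cellMatrix_v₁_eq, cellDeriv_cellMatrix, cellDiff, cellMatrix_v₁_sq]

theorem cellDiff_e₂ : cellDiff μ .e₂ =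
    cellMatrix μ .v₂ * (1 + cellMatrix μ .e₂) + (1 + cellMatrix μ .e₂) * ccusp μ := by
  rw [cellDiff, edgeFormula, cellMatrix_v₁_eq]

theorem cellDiff_f₂ : cellDiff μ .f₂ = cellMatrix μ .v₂ * cellMatrix μ .f₂ +
    cellMatrix μ .f₂ * ccusp μ + cellMatrix μ .c₂ * (1 + cellMatrix μ .e₂) := by
  rw [cellDiff, faceFormula_two, cellMatrix_c₁, cellMatrix_v₁_eq, mul_zero, add_zero, zero_add,
    mul_add, mul_one]

theorem cellDiff_f₃ : cellDiff μ .f₃ = cellMatrix μ .v₃ * cellMatrix μ .f₃ +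
    cellMatrix μ .f₃ * cellMatrix μ .v₂ + (1 + cellMatrix μ .e₃) * cellMatrix μ .c₂ := by
  rw [cellDiff, faceFormula_one, add_mul, one_mul]

theorem cellDeriv_inverse {X Y : Mat μ} (h : X * Y = 1) (h' : Y * X = 1) :
    (cellDeriv μ).mapMatrix Y = Y * (cellDeriv μ).mapMatrix X * Y := by
  have h1 := cellDeriv_matrix_mul μ X Y
  rw [h, cellDeriv_matrix_one] at h1
  have h2 : Y * ((cellDeriv μ).mapMatrix X * Y + X * (cellDeriv μ).mapMatrix Y) = 0 := by
    rw [← h1, mul_zero]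
  rw [mul_add, ← mul_assoc, ← mul_assoc, h', one_mul] at h2
  rw [← sub_eq_zero, ZModModule.sub_eq_add, add_comm, h2]

/-- Together with d(x⁻¹) = x⁻¹(dx)x⁻¹ this shows that the inverse of an edge matrix obeys the edge
formula with the end vertices exchanged. -/
theorem inverse_conj {R : Type*} [Ring R] {x y : R} (h : x * y = 1) (h' : y * x = 1) (a c : R) :
    y * (a * x + x * c) * y = y * a + c * y := by
  have e : y * (a * x + x * c) * y = y * a * (x * y) + y * x * (c * y) := by noncomm_ring
  rw [e, h, h', mul_one, one_mul]

theorem cellDeriv_outerTail : (cellDeriv μ).mapMatrix (1 + outerTail μ) =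
    (1 + outerTail μ) * cellMatrix μ .v₂ + ccusp μ * (1 + outerTail μ) := by
  rw [cellDeriv_inverse μ (outer_mul_tail μ) (tail_mul_outer μ), map_add, cellDeriv_matrix_one,
    zero_add, cellDeriv_cellMatrix, cellDiff_e₂,
    inverse_conj (outer_mul_tail μ) (tail_mul_outer μ)]

theorem cellDeriv_innerTail : (cellDeriv μ).mapMatrix (1 + innerTail μ) =
    (1 + innerTail μ) * cellMatrix μ .v₃ + cellMatrix μ .v₂ * (1 + innerTail μ) := by
  rw [cellDeriv_inverse μ (inner_mul_tail μ) (tail_mul_inner μ), map_add, cellDeriv_matrix_one,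
    zero_add, cellDeriv_cellMatrix, cellDiff, edgeFormula,
    inverse_conj (inner_mul_tail μ) (tail_mul_inner μ)]

/-- V⁻¹ and U⁻¹ carry A₃ to A₂ and A₂ to N, so F₃ is transported to `v₁` on both sides. The loop
contributes U⁻¹C₂U once through F₃ and once through F₂; cancelling this term is the purpose of the
summand U⁻¹F₂. -/
theorem cellDeriv_disc :
    (cellDeriv μ).mapMatrix (disc μ) = ccusp μ * disc μ + disc μ * ccusp μ := by
  have e : ∀ N A A' U' V' U V F G L : Mat μ, V' * V = 1 →
      ((U' * A + N * U') * (V' * F) + U' * ((V' * A' + A * V') * F +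
        V' * (A' * F + F * A + V * L))) * U + U' * (V' * F) * (A * U + U * N) +
        ((U' * A + N * U') * G + U' * (A * G + G * N + L * U)) =
      N * (U' * (V' * F) * U + U' * G) + (U' * (V' * F) * U + U' * G) * N := by
    intro N A A' U' V' U V F G L h
    have h1 : ((U' * A + N * U') * (V' * F) + U' * ((V' * A' + A * V') * F +
        V' * (A' * F + F * A + V * L))) * U + U' * (V' * F) * (A * U + U * N) +
        ((U' * A + N * U') * G + U' * (A * G + G * N + L * U)) =
        N * (U' * (V' * F) * U + U' * G) + (U' * (V' * F) * U + U' * G) * N +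
        ((U' * A * V' * F * U + U' * A * V' * F * U) +
          (U' * V' * A' * F * U + U' * V' * A' * F * U) +
          (U' * V' * F * A * U + U' * V' * F * A * U) + (U' * A * G + U' * A * G) +
          (U' * (V' * V) * L * U + U' * L * U)) := by
      noncomm_ring
    rw [h1, h]
    simp only [mul_one, ZModModule.add_self, add_zero]
  have hU : (cellDeriv μ).mapMatrix (1 + cellMatrix μ .e₂) =
      cellMatrix μ .v₂ * (1 + cellMatrix μ .e₂) + (1 + cellMatrix μ .e₂) * ccusp μ := by
    rw [map_add, cellDeriv_matrix_one, zero_add, cellDeriv_cellMatrix, cellDiff_e₂]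
  rw [disc, map_add, cellDeriv_matrix_mul, cellDeriv_matrix_mul, cellDeriv_matrix_mul,
    cellDeriv_matrix_mul, hU, cellDeriv_outerTail, cellDeriv_innerTail, cellDeriv_cellMatrix,
    cellDeriv_cellMatrix, cellDiff_f₂, cellDiff_f₃]
  exact e _ _ _ _ _ _ _ _ _ _ (tail_mul_inner μ)

theorem cellHom_outerTail : (cellHom μ).mapMatrix (1 + outerTail μ) = 1 + lb μ := by
  have h := congrArg (cellHom μ).mapMatrix (outer_mul_tail μ)
  rw [map_mul, map_one, map_add, map_one, cellHom_cellMatrix, cellImage] at h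
  calc (cellHom μ).mapMatrix (1 + outerTail μ)
      = (1 + lb μ) * (1 + lb μ) * (cellHom μ).mapMatrix (1 + outerTail μ) := by
        rw [one_add_lb_mul_self, one_mul]
    _ = 1 + lb μ := by rw [mul_assoc, h, mul_one]

theorem cellHom_innerTail : (cellHom μ).mapMatrix (1 + innerTail μ) = 1 := by
  have h := congrArg (cellHom μ).mapMatrix (inner_mul_tail μ)
  rwa [map_mul, map_one, map_add, map_one, cellHom_cellMatrix, cellImage, add_zero, one_mul] at h

/-- Conjugating z back removes the factors E + b, and the bwb coming from F₂ cancels the one in (E +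
b)w(E + b). At (u_j, ℓ_j) only z_j is left, which gives φψ = id. -/
theorem cellHom_disc :
    (cellHom μ).mapMatrix (disc μ) = lz μ + (lw μ + lb μ * lw μ + lw μ * lb μ) := by
  rw [disc, map_add, map_mul, map_mul, map_mul, map_mul, cellHom_outerTail, cellHom_innerTail,
    map_add, map_one, cellHom_cellMatrix, cellHom_cellMatrix, cellHom_cellMatrix, cellImage,
    cellImage, cellImage, one_mul, add_mul 1 _ (louter μ), lb_mul_louter, one_mul, add_zero, linner]
  have e : ∀ b w z : LMat μ, (1 + b) * (w + (1 + b) * z * (1 + b)) * (1 + b) + b * w * b =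
      ((1 + b) * (1 + b)) * z * ((1 + b) * (1 + b)) + (w + b * w + w * b) +
        (b * w * b + b * w * b) := by
    intro b w z
    noncomm_ring
  rw [louter, e, one_add_lb_mul_self, one_mul, mul_one, ZModModule.add_self, add_zero]

theorem cellHom_listedHom (x : (listedQuiver r μ).PathAlg) : cellHom μ (listedHom μ x) = x := by
  have : (cellHom μ).comp (listedHom μ) = AlgHom.id _ _ := by
    apply (listedQuiver r μ).algHom_eq
    · intro v
      rw [AlgHom.comp_apply, listedHom_vertex, cellHom_vertex]
      rfl
    · rintro (⟨k, hk⟩ | j | ⟨k, hk⟩)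
      · rw [AlgHom.comp_apply, listedHom_b μ k hk, cellHom_listed]
        rfl
      · rw [AlgHom.comp_apply, listedHom_z μ j]
        refine (congrFun (congrFun (cellHom_disc μ) (upper j)) (lower j)).trans ?_
        rw [Matrix.add_apply, Matrix.add_apply, Matrix.add_apply,
          mul_apply_eq_zero_of_upper (lb_supported μ), mul_apply_eq_zero_of_lower (lb_supported μ),
          lw_supported μ _ _ fun h => by simp [UpRel] at h, add_zero, add_zero, add_zero, lz_apply]
        rfl
      · rw [AlgHom.comp_apply, listedHom_bdual μ k hk, cellHom_listed]
        rfl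
  exact DFunLike.congr_fun this x

/-- Products of outer relations never reach a pair (ℓ_k, u_{k+1}), and A₂, N have no entries there.
Hence each b_k is closed in the cellular algebra. -/
theorem cellDiff_e₂_supported : (cellDiff μ .e₂).SupportedOn CrossRel := by
  have hN := cuspMatrix_supported (cellQuiver r μ).vertex
  have e : cellDiff μ .e₂ = cellMatrix μ .v₂ + cellMatrix μ .v₂ * cellMatrix μ .e₂ +
      (ccusp μ + cellMatrix μ .e₂ * ccusp μ) := by
    rw [cellDiff_e₂]
    noncomm_ring
  rw [e]
  exact ((v₂_supported μ).add ((v₂_supported μ).mul (e₂_supported μ) fun k m n h h' =>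
    crossRel_of_outer_outer k m n h.1 h')).add ((hN.mono crossRel_of_cuspRel).add
    ((e₂_supported μ).mul hN fun k m n h h' =>
      crossRel_of_outer_outer k m n h (outerRel_of_cuspRel m n h')))

/-- The same argument inside the circle shows that the generators `bdual` are closed. -/
theorem cellDiff_f₃_supported : (cellDiff μ .f₃).SupportedOn CrossRel := by
  rw [cellDiff_f₃, add_mul, one_mul]
  exact (((v₃_supported μ).mul (f₃_supported μ) crossRel_of_inner_inner).add
    ((f₃_supported μ).mul (v₂_supported μ) fun k m n h h' =>
      crossRel_of_inner_inner k m n h (Or.inl h'))).add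
    ((c₂_supported μ).add ((e₃_supported μ).mul (c₂_supported μ) fun k m n h h' =>
      crossRel_of_inner_inner k m n h (Or.inl h')))

theorem listedHom_lzDiff : (listedHom μ).mapMatrix (lzDiff μ) =
    ccusp μ * cb μ * cw μ + cw μ * cb μ * ccusp μ := by
  simp only [lzDiff, map_add, map_mul, listedHom_lcusp]
  rfl

theorem ccusp_mul_cw : ccusp μ * cw μ = 0 := by
  rw [← listedHom_lcusp, cw, ← map_mul, lcusp_mul_lw, map_zero]

theorem cw_mul_ccusp : cw μ * ccusp μ = 0 := by
  rw [← listedHom_lcusp, cw, ← map_mul, lw_mul_lcusp, map_zero]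

/-- Split `disc` into w + bw + wb and a matrix O supported on the outer order. From a lower sheet,
and into an upper sheet, O always changes the component, so NO and ON have no entry at (u_j, ℓ_j).
The terms Nw and wN vanish. -/
theorem ccusp_disc_apply (j : Fin r) : (ccusp μ * disc μ + disc μ * ccusp μ) (upper j) (lower j) =
    (ccusp μ * cb μ * cw μ + cw μ * cb μ * ccusp μ) (upper j) (lower j) := by
  obtain ⟨O, hO, hO'⟩ : ∃ O : Mat μ, disc μ = cw μ + cb μ * cw μ + cw μ * cb μ + O ∧
      O.SupportedOn OuterRel := by
    refine ⟨_, ?_, disc_add_supported μ⟩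
    rw [add_comm (disc μ), ZModModule.add_add_self_cancel]
  have hN := cuspMatrix_supported (cellQuiver r μ).vertex
  have h1 : (ccusp μ * O).SupportedOn fun m n => m.1 ≠ n.1 :=
    hN.mul hO' fun k m n h h' => by grind [CuspRel, OuterRel]
  have h2 : (O * ccusp μ).SupportedOn fun m n => m.1 ≠ n.1 :=
    hO'.mul hN fun k m n h h' => by grind [CuspRel, OuterRel]
  have e : ccusp μ * disc μ + disc μ * ccusp μ =
      ccusp μ * cb μ * cw μ + cw μ * cb μ * ccusp μ + (ccusp μ * O + O * ccusp μ) +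
      (ccusp μ * cw μ * (1 + cb μ) + (1 + cb μ) * (cw μ * ccusp μ)) := by
    rw [hO]
    noncomm_ring
  rw [e, ccusp_mul_cw, cw_mul_ccusp, zero_mul, mul_zero, add_zero, add_zero, Matrix.add_apply _ (_ + _),
    (h1.add h2) _ _ (by simp), add_zero]

theorem listedHom_listedDeriv (x : (listedQuiver r μ).PathAlg) :
    listedHom μ (listedDeriv μ x) = cellDeriv μ (listedHom μ x) := by
  have key := (listedQuiver r μ).derivation_eq_zero (listedHom μ) (listedHom μ)
    ((listedHom μ).toLinearMap ∘ₗ listedDeriv μ - cellDeriv μ ∘ₗ (listedHom μ).toLinearMap) ?_ ?_ ?_ x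
  · exact sub_eq_zero.1 key
  · intro x y
    simp only [LinearMap.sub_apply, LinearMap.comp_apply, AlgHom.toLinearMap_apply, cellDeriv_mul,
      map_add, map_mul, listedDeriv_mul]
    noncomm_ring
  · intro v
    simp only [LinearMap.sub_apply, LinearMap.comp_apply, AlgHom.toLinearMap_apply,
      cellDeriv_vertex, listedHom_vertex, listedDeriv_vertex, map_zero, sub_zero]
  · intro (g : ListedGen r)
    simp only [LinearMap.sub_apply, LinearMap.comp_apply, AlgHom.toLinearMap_apply]
    rw [listedDeriv_arrow μ g, sub_eq_zero]
    cases g with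
    | b k hk =>
      rw [listedHom_b, cellDeriv_arrow]
      exact (map_zero _).trans
        (cellDiff_e₂_supported μ _ _ (not_downRel_of_crossRel ⟨rfl, rfl, rfl⟩)).symm
    | z j =>
      rw [listedHom_z]
      refine (congrFun (congrFun (listedHom_lzDiff μ) (upper j)) (lower j)).trans ?_
      rw [← ccusp_disc_apply, ← cellDeriv_disc]
      rfl
    | bdual k hk =>
      rw [listedHom_bdual, cellDeriv_arrow]
      exact (map_zero _).trans
        (cellDiff_f₃_supported μ _ _ (not_crossRel_of_upRel ⟨rfl, rfl, rfl⟩)).symm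

end Cellular

end ALink

/-! ### The retraction ρ and the values of the homotopy -/

namespace ALink

variable {r : ℕ}

/-- Used to cancel the factor ρ(U) = E + b from the right. -/
theorem eq_zero_of_mul_involution {R : Type*} [Ring R] {x u : R} (hu : u * u = 1)
    (h : x * u = 0) : x = 0 := by
  rw [← mul_one x, ← hu, ← mul_assoc, h, zero_mul]

section Cellular

variable (μ : MaslovPotential r)

/-- The composition of the two homomorphisms, an idempotent endomorphism of the cellular algebra. -/
noncomputable def retract : (cellQuiver r μ).PathAlg →ₐ[ZMod 2] (cellQuiver r μ).PathAlg :=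
  (listedHom μ).comp (cellHom μ)

theorem retract_mapMatrix (X : Mat μ) :
    (retract μ).mapMatrix X = (listedHom μ).mapMatrix ((cellHom μ).mapMatrix X) := rfl

theorem retract_cellDeriv (x : (cellQuiver r μ).PathAlg) :
    retract μ (cellDeriv μ x) = cellDeriv μ (retract μ x) := by
  rw [retract, AlgHom.comp_apply, AlgHom.comp_apply, cellHom_cellDeriv, listedHom_listedDeriv]

theorem retract_vertex (v : Fin r) :
    retract μ ((cellQuiver r μ).vertex v) = (cellQuiver r μ).vertex v := by
  rw [retract, AlgHom.comp_apply, cellHom_vertex, listedHom_vertex]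

theorem retract_ccusp : (retract μ).mapMatrix (ccusp μ) = ccusp μ := by
  rw [← cellMatrix_v₁_eq, retract_mapMatrix, cellHom_cellMatrix, cellImage, listedHom_lcusp,
    cellMatrix_v₁_eq]

theorem retract_e₂ : (retract μ).mapMatrix (cellMatrix μ .e₂) = cb μ := by
  rw [retract_mapMatrix, cellHom_cellMatrix]
  rfl

theorem retract_e₃ : (retract μ).mapMatrix (cellMatrix μ .e₃) = 0 := by
  rw [retract_mapMatrix, cellHom_cellMatrix, cellImage, map_zero]

theorem retract_f₂ : (retract μ).mapMatrix (cellMatrix μ .f₂) = cb μ * cw μ * cb μ := by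
  rw [retract_mapMatrix, cellHom_cellMatrix, cellImage, louter, map_mul, map_mul]
  rfl

theorem retract_disc :
    (retract μ).mapMatrix (disc μ) = cz μ + (cw μ + cb μ * cw μ + cw μ * cb μ) := by
  rw [retract_mapMatrix, cellHom_disc]
  simp only [map_add, map_mul]
  rfl

theorem one_add_cb_mul_self : (1 + cb μ) * (1 + cb μ) = 1 := by
  have := congrArg (listedHom μ).mapMatrix (one_add_lb_mul_self μ)
  rwa [map_mul, map_add, map_one] at this

theorem cb_mul_cb : cb μ * cb μ = 0 := by
  rw [cb, ← map_mul, lb_mul_lb, map_zero]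

theorem cb_isBihom : IsBihom (cellQuiver r μ).vertex (cb μ) := listedHom_isBihom μ (lb_isBihom μ)

theorem cw_isBihom : IsBihom (cellQuiver r μ).vertex (cw μ) := listedHom_isBihom μ (lw_isBihom μ)

theorem cz_isBihom : IsBihom (cellQuiver r μ).vertex (cz μ) := listedHom_isBihom μ (lz_isBihom μ)

theorem ccusp_supported : (ccusp μ).SupportedOn CuspRel := cuspMatrix_supported _

theorem ccusp_isBihom : IsBihom (cellQuiver r μ).vertex (ccusp μ) :=
  cuspMatrix_isBihom (cellQuiver r μ).vertex_idem

/-- The part of `disc` that the retraction kills: its entries between different components, from an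
upper to a lower component. -/
noncomputable def discUpper : Mat μ := disc μ + (retract μ).mapMatrix (disc μ)

theorem discUpper_isBihom : IsBihom (cellQuiver r μ).vertex (discUpper μ) := by
  rw [discUpper, retract_disc]
  have hb := cb_isBihom μ
  have hw := cw_isBihom μ
  exact (disc_isBihom μ).add ((cz_isBihom μ).add ((hw.add (hb.mul hw)).add (hw.mul hb)))

/-- ρ reproduces the terms w, bw, wb and the entries at (u_j, ℓ_j), so all of these cancel. Every
other entry of the outer order goes to a later component. -/
theorem discUpper_supported : (discUpper μ).SupportedOn fun m n => m.1 < n.1 := by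
  have e : discUpper μ = disc μ + (cw μ + cb μ * cw μ + cw μ * cb μ) + cz μ := by
    rw [discUpper, retract_disc]
    abel
  intro m n h
  by_cases h1 : CuspRel m n
  · rw [discUpper, retract_disc]
    obtain ⟨j, rfl, rfl⟩ := h1.exists
    rw [Matrix.add_apply, Matrix.add_apply, Matrix.add_apply, Matrix.add_apply, cz_apply μ h1,
      mul_apply_eq_zero_of_upper (cb_supported μ), mul_apply_eq_zero_of_lower (cb_supported μ),
      cw_supported μ _ _ fun h => by simp [UpRel] at h, add_zero, add_zero, add_zero,
      ZModModule.add_self]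
  · rw [e, Matrix.add_apply, cz_supported μ _ _ h1, add_zero]
    refine disc_add_supported μ m n fun h2 => h2.elim h h1

/-- At the pairs (ℓ_k, u_{k+1}), which the crossing order omits, this identifies `discUpper` with F₂
+ bwb. -/
theorem discUpper_add_supported :
    (discUpper μ + (cellMatrix μ .f₂ + cb μ * cw μ * cb μ)).SupportedOn CrossRel := by
  have e : discUpper μ + (cellMatrix μ .f₂ + cb μ * cw μ * cb μ) = discRem μ + cz μ := by
    rw [discUpper, retract_disc, discRem]
    abel
  rw [e]
  exact (discRem_supported μ).add ((cz_supported μ).mono crossRel_of_cuspRel)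

theorem retract_cellDeriv_matrix (X : Mat μ) : (retract μ).mapMatrix ((cellDeriv μ).mapMatrix X) =
    (cellDeriv μ).mapMatrix ((retract μ).mapMatrix X) := by
  ext m n
  exact retract_cellDeriv μ (X m n)

theorem cellDeriv_discUpper : (cellDeriv μ).mapMatrix (discUpper μ) =
    ccusp μ * discUpper μ + discUpper μ * ccusp μ := by
  rw [discUpper, map_add, ← retract_cellDeriv_matrix, cellDeriv_disc, map_add, map_mul, map_mul,
    retract_ccusp]
  noncomm_ring

/-- The transpose of the constant matrix of the cusps. -/
noncomputable def ccuspT : Mat μ := (ccusp μ).transpose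

theorem ccuspT_supported : (ccuspT μ).SupportedOn fun m n => CuspRel n m :=
  fun _ _ h => if_neg h

theorem ccuspT_isBihom : IsBihom (cellQuiver r μ).vertex (ccuspT μ) := by
  intro m n
  by_cases h : CuspRel n m
  · obtain ⟨j, rfl, rfl⟩ := h.exists
    exact ccusp_isBihom μ (upper j) (lower j)
  · rw [ccuspT_supported μ m n h]
    simp

theorem ccusp_mul_upper (X : Mat μ) (j : Fin r) (n : Sheet r) :
    (ccusp μ * X) (upper j) n = (cellQuiver r μ).vertex j * X (lower j) n := by
  rw [Matrix.mul_apply, Finset.sum_eq_single (lower j)]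
  · congr 1
    exact if_pos ⟨rfl, rfl, rfl⟩
  · intro k _ hk
    rw [ccusp_supported μ _ _ fun h => hk ?_, zero_mul]
    obtain ⟨i, h1, rfl⟩ := h.exists
    rw [(Prod.mk.inj h1).1]
  · simp

theorem ccusp_mul_lower (X : Mat μ) (j : Fin r) (n : Sheet r) :
    (ccusp μ * X) (lower j) n = 0 := by
  rw [Matrix.mul_apply]
  refine Finset.sum_eq_zero fun k _ => ?_
  rw [ccusp_supported μ _ _ fun h => absurd h.2.1 (by simp), zero_mul]

theorem mul_ccusp_upper (X : Mat μ) (m : Sheet r) (j : Fin r) :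
    (X * ccusp μ) m (upper j) = 0 := by
  rw [Matrix.mul_apply]
  refine Finset.sum_eq_zero fun k _ => ?_
  rw [ccusp_supported μ _ _ fun h => absurd h.2.2 (by simp), mul_zero]

theorem ccuspT_mul_lower (X : Mat μ) (j : Fin r) (n : Sheet r) :
    (ccuspT μ * X) (lower j) n = (cellQuiver r μ).vertex j * X (upper j) n := by
  rw [Matrix.mul_apply, Finset.sum_eq_single (upper j)]
  · congr 1
    exact if_pos ⟨rfl, rfl, rfl⟩
  · intro k _ hk
    rw [ccuspT_supported _ _ _ fun h => hk ?_, zero_mul]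
    obtain ⟨i, rfl, h1⟩ := h.exists
    rw [(Prod.mk.inj h1).1]
  · simp

theorem ccuspT_mul_upper (X : Mat μ) (j : Fin r) (n : Sheet r) :
    (ccuspT μ * X) (upper j) n = 0 := by
  rw [Matrix.mul_apply]
  refine Finset.sum_eq_zero fun k _ => ?_
  rw [ccuspT_supported _ _ _ fun h => absurd h.2.2 (by simp), zero_mul]

/-- NNᵗ selects the rows at upper sheets and NᵗN those at lower sheets, each multiplied by an
idempotent that fixes the row of X. Consequently X ↦ NᵗX contracts the commutator with N: the terms
NᵗXN occur twice. -/
theorem ccusp_ccuspT_mul {X : Mat μ} (hX : IsBihom (cellQuiver r μ).vertex X) :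
    ccusp μ * (ccuspT μ * X) + ccuspT μ * (ccusp μ * X) = X := by
  ext ⟨j, s⟩ n
  have h1 := (hX (j, s) n).1
  cases s
  · rw [Matrix.add_apply, ccusp_mul_lower, ccuspT_mul_lower, ccusp_mul_upper, h1, h1, zero_add]
  · rw [Matrix.add_apply, ccuspT_mul_upper, ccusp_mul_upper, ccuspT_mul_lower, h1, h1, add_zero]

theorem cellDeriv_ccuspT : (cellDeriv μ).mapMatrix (ccuspT μ) = 0 := by
  ext m n
  exact congrFun (congrFun (cellDeriv_ccusp μ) n) m

/-- The value of the homotopy on `disc`. -/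
noncomputable def discHomotopy : Mat μ := ccuspT μ * discUpper μ

theorem discHomotopy_supported : (discHomotopy μ).SupportedOn fun m n => m.1 < n.1 :=
  (ccuspT_supported μ).mul (discUpper_supported μ) fun _ _ _ h h' => h.1 ▸ h'

theorem discHomotopy_isBihom : IsBihom (cellQuiver r μ).vertex (discHomotopy μ) :=
  (ccuspT_isBihom μ).mul (discUpper_isBihom μ)

open Classical in
/-- The value of the homotopy on the matrix of the face `f₂`. -/
noncomputable def outerHomotopy : Mat μ := fun m n =>
  if DownRel m n then discUpper μ (upper m.1) n else 0

theorem outerHomotopy_supported : (outerHomotopy μ).SupportedOn DownRel := fun _ _ h => if_neg h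

theorem outerHomotopy_apply {m n : Sheet r} (h : DownRel m n) :
    outerHomotopy μ m n = discUpper μ (upper m.1) n := if_pos h

theorem outerHomotopy_isBihom : IsBihom (cellQuiver r μ).vertex (outerHomotopy μ) := by
  intro m n
  by_cases h : DownRel m n
  · rw [outerHomotopy_apply μ h]
    exact discUpper_isBihom μ (upper m.1) n
  · rw [outerHomotopy_supported μ m n h]
    simp

/-- Row ℓ_k of Nᵗ `discUpper` is row u_k of `discUpper`. The value on F₂ is defined to cancel this
row's entry at u_{k+1}, where F₃ carries no generator to absorb it. -/
theorem discHomotopy_add_supported :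
    (discHomotopy μ + outerHomotopy μ).SupportedOn CrossRel := by
  intro m n h
  rw [Matrix.add_apply]
  by_cases h1 : DownRel m n
  · rw [outerHomotopy_apply μ h1]
    obtain ⟨k, hk, rfl, rfl⟩ := h1.exists
    rw [discHomotopy, ccuspT_mul_lower, (discUpper_isBihom μ (upper _) _).1, ZModModule.add_self]
  · rw [outerHomotopy_supported μ m n h1, discHomotopy_supported μ m n fun h2 => h ⟨Or.inl h2, h1⟩,
      add_zero]

theorem outer_discHomotopy_add_supported :
    ((1 + cellMatrix μ .e₂) * discHomotopy μ + outerHomotopy μ).SupportedOn CrossRel := by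
  rw [add_mul, one_mul, add_right_comm]
  exact (discHomotopy_add_supported μ).add ((e₂_supported μ).mul (discHomotopy_supported μ)
    fun k m n h h' => by grind [OuterRel, CrossRel])

/-- The differential of the (u_k, u_{k+1}) entry of `discUpper` is its (ℓ_k, u_{k+1}) entry, which
is that of F₂ + bwb by `discUpper_add_supported`. So the choice of h(F₂) that suits F₃ also suits
C₂. -/
theorem cellDeriv_outerHomotopy_add_supported : (cellMatrix μ .f₂ + cb μ * cw μ * cb μ +
    (cellDeriv μ).mapMatrix (outerHomotopy μ)).SupportedOn CrossRel := by
  intro m n h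
  by_cases h1 : DownRel m n
  · have h2 : (cellDeriv μ).mapMatrix (outerHomotopy μ) m n = discUpper μ m n := by
      rw [LinearMap.mapMatrix_apply, Matrix.map_apply, outerHomotopy_apply μ h1]
      refine (congrFun (congrFun (cellDeriv_discUpper μ) _) _).trans ?_
      obtain ⟨k, hk, rfl, rfl⟩ := h1.exists
      rw [Matrix.add_apply, mul_ccusp_upper, add_zero, ccusp_mul_upper,
        (discUpper_isBihom μ (lower _) _).1]
    rw [Matrix.add_apply, h2, add_comm]
    exact discUpper_add_supported μ m n h
  · have h2 : ¬ OuterRel m n := fun h2 => h ⟨h2, h1⟩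
    rw [Matrix.add_apply, Matrix.add_apply, f₂_supported μ m n h2, cb_cw_cb_supported μ m n h1,
      LinearMap.mapMatrix_apply, Matrix.map_apply, outerHomotopy_supported μ m n h1, map_zero,
      add_zero, add_zero]

/-- The value of the homotopy on the matrix of the vertex `v₂`. -/
noncomputable def crossHomotopy : Mat μ := (cellMatrix μ .e₂ + cb μ) * (1 + cb μ)

theorem crossHomotopy_supported : (crossHomotopy μ).SupportedOn CrossRel := by
  rw [crossHomotopy, mul_add, mul_one]
  exact (e₂_add_cb_supported μ).add
    ((e₂_add_cb_supported μ).mul (cb_supported μ) crossRel_of_cross_down)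

theorem crossHomotopy_isBihom : IsBihom (cellQuiver r μ).vertex (crossHomotopy μ) :=
  ((cellMatrix_isBihom μ _).add (cb_isBihom μ)).mul_one_add (cb_isBihom μ)

/-- The sum of the terms in the homotopy equation for `f₂` that do not involve the loop `c₂`. -/
noncomputable def loopTerms : Mat μ := cellMatrix μ .f₂ + cb μ * cw μ * cb μ +
    (cellDeriv μ).mapMatrix (outerHomotopy μ) + cellMatrix μ .e₂ * (cb μ * cw μ * cb μ) +
    cellMatrix μ .v₂ * outerHomotopy μ + outerHomotopy μ * ccusp μ

/-- The equation of `f₂` must be solvable by a value on C₂, which has no generators at the pairs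
(ℓ_k, u_{k+1}); all terms there have to cancel. -/
theorem loopTerms_supported : (loopTerms μ).SupportedOn CrossRel := by
  refine (((cellDeriv_outerHomotopy_add_supported μ).add ?_).add ?_).add ?_
  · exact (e₂_supported μ).mul (cb_cw_cb_supported μ) fun k m n h h' =>
      crossRel_of_outer_outer k m n h (outerRel_of_downRel m n h')
  · exact (v₂_supported μ).mul (outerHomotopy_supported μ) crossRel_of_cross_down
  · exact (outerHomotopy_supported μ).mul (cuspMatrix_supported _) crossRel_of_down_cusp

theorem cellDeriv_isBihom {X : Mat μ} (h : IsBihom (cellQuiver r μ).vertex X) :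
    IsBihom (cellQuiver r μ).vertex ((cellDeriv μ).mapMatrix X) := by
  intro m n
  have h1 := cellDeriv_mul μ ((cellQuiver r μ).vertex m.1) (X m n)
  have h2 := cellDeriv_mul μ (X m n) ((cellQuiver r μ).vertex n.1)
  rw [(h m n).1, cellDeriv_vertex, zero_mul, zero_add] at h1
  rw [(h m n).2, cellDeriv_vertex, mul_zero, add_zero] at h2
  exact ⟨h1.symm, h2.symm⟩

theorem loopTerms_isBihom : IsBihom (cellQuiver r μ).vertex (loopTerms μ) := by
  have hb := cb_isBihom μ
  have hf := (hb.mul (cw_isBihom μ)).mul hb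
  have hX := outerHomotopy_isBihom μ
  have hc := cellMatrix_isBihom μ
  exact (((((hc _).add hf).add (cellDeriv_isBihom μ hX)).add ((hc _).mul hf)).add
    ((hc _).mul hX)).add (hX.mul (ccusp_isBihom μ))

/-- The values of the homotopy on the matrices of the cells. -/
noncomputable def homotopyImage : Cell → Mat μ
  | .v₁ | .e₂ | .e₃ | .c₁ => 0
  -- The values at `v₂`, `v₃` and `c₂` solve the homotopy equations of `e₂`, `e₃` and `f₂`; the
  -- value at `f₃` solves h(disc) = `discHomotopy`.
  | .v₂ => crossHomotopy μ
  | .v₃ => cellMatrix μ .e₃ + (1 + cellMatrix μ .e₃) * crossHomotopy μ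
  | .f₂ => outerHomotopy μ
  | .c₂ => loopTerms μ * (1 + cb μ)
  | .f₃ => (1 + cellMatrix μ .e₃) *
      (((1 + cellMatrix μ .e₂) * discHomotopy μ + outerHomotopy μ) * (1 + cb μ))

theorem homotopyImage_isBihom (c : Cell) :
    IsBihom (cellQuiver r μ).vertex (homotopyImage μ c) := by
  have hb := cb_isBihom μ
  have hc := cellMatrix_isBihom μ
  have hX := outerHomotopy_isBihom μ
  cases c
  case v₁ | e₂ | e₃ | c₁ => exact .zero
  case v₂ => exact crossHomotopy_isBihom μ
  case v₃ => exact (hc _).add ((hc _).one_add_mul (crossHomotopy_isBihom μ))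
  case f₂ => exact hX
  case c₂ => exact (loopTerms_isBihom μ).mul_one_add hb
  case f₃ =>
    exact (hc _).one_add_mul ((((hc _).one_add_mul (discHomotopy_isBihom μ)).add hX).mul_one_add hb)

/-- The values are found by solving equations between whole matrices. They come from values on the
generators only if they vanish at all other pairs. -/
theorem homotopyImage_supported (c : Cell) : (homotopyImage μ c).SupportedOn (CellRel c) := by
  have hmul : ∀ X : Mat μ, X.SupportedOn CrossRel → (X * (1 + cb μ)).SupportedOn CrossRel := by
    intro X hX
    rw [mul_add, mul_one]
    exact hX.add (hX.mul (cb_supported μ) crossRel_of_cross_down)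
  have hinner : ∀ X : Mat μ, X.SupportedOn CrossRel →
      ((1 + cellMatrix μ .e₃) * X).SupportedOn InnerRel := by
    intro X hX
    rw [add_mul, one_mul]
    exact (hX.mono fun _ _ h => Or.inl h).add ((e₃_supported μ).mul hX fun k m n h h' =>
      Or.inl (crossRel_of_inner_inner k m n h (Or.inl h')))
  cases c
  case v₁ | e₂ | e₃ | c₁ => exact .zero
  case v₂ => exact crossHomotopy_supported μ
  case v₃ => exact (e₃_supported μ).add (hinner _ (crossHomotopy_supported μ))
  case f₂ => exact (outerHomotopy_supported μ).mono outerRel_of_downRel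
  case c₂ => exact hmul _ (loopTerms_supported μ)
  case f₃ => exact hinner _ (hmul _ (outer_discHomotopy_add_supported μ))

end Cellular

end ALink

/-! ### The homotopy equation and the quasi-isomorphism -/

namespace ALink

variable {r : ℕ}

section Cellular

variable (μ : MaslovPotential r)

theorem exists_cellHomotopy :
    ∃ h : (cellQuiver r μ).PathAlg →ₗ[ZMod 2] (cellQuiver r μ).PathAlg,
      (∀ x y, h (x * y) = h x * retract μ y + x * h y) ∧
      (∀ v, h ((cellQuiver r μ).vertex v) = 0) ∧
      ∀ g : CellGen r, h ((cellQuiver r μ).arrow g) = homotopyImage μ g.cell g.fst g.snd :=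
  (cellQuiver r μ).exists_derivation (AlgHom.id _ _) (retract μ)
    (fun g : CellGen r => homotopyImage μ g.cell g.fst g.snd)
    (fun g => (homotopyImage_isBihom μ g.cell g.fst g.snd).1)
    (fun g => by
      rw [retract_vertex]
      exact (homotopyImage_isBihom μ g.cell g.fst g.snd).2)

/-- The homotopy between the identity and the retraction. -/
noncomputable def cellHomotopy : (cellQuiver r μ).PathAlg →ₗ[ZMod 2] (cellQuiver r μ).PathAlg :=
  (exists_cellHomotopy μ).choose

theorem cellHomotopy_mul (x y : (cellQuiver r μ).PathAlg) :
    cellHomotopy μ (x * y) = cellHomotopy μ x * retract μ y + x * cellHomotopy μ y :=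
  (exists_cellHomotopy μ).choose_spec.1 x y

theorem cellHomotopy_vertex (v : Fin r) : cellHomotopy μ ((cellQuiver r μ).vertex v) = 0 :=
  (exists_cellHomotopy μ).choose_spec.2.1 v

theorem cellHomotopy_arrow (g : CellGen r) :
    cellHomotopy μ ((cellQuiver r μ).arrow g) = homotopyImage μ g.cell g.fst g.snd :=
  (exists_cellHomotopy μ).choose_spec.2.2 g

theorem mapMatrix_mul_of_retract_derivation
    (T : (cellQuiver r μ).PathAlg →ₗ[ZMod 2] (cellQuiver r μ).PathAlg)
    (hT : ∀ x y, T (x * y) = T x * retract μ y + x * T y) (X Y : Mat μ) :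
    T.mapMatrix (X * Y) = T.mapMatrix X * (retract μ).mapMatrix Y + X * T.mapMatrix Y := by
  have := LinearMap.mapMatrix_mul_of_derivation (AlgHom.id _ _) (retract μ) T hT X Y
  rwa [AlgHom.mapMatrix_id] at this

theorem mapMatrix_one_of_retract_derivation
    (T : (cellQuiver r μ).PathAlg →ₗ[ZMod 2] (cellQuiver r μ).PathAlg)
    (hT : ∀ v, T ((cellQuiver r μ).vertex v) = 0) : T.mapMatrix (1 : Mat μ) = 0 := by
  refine LinearMap.mapMatrix_one_of_map_one ?_
  rw [← (cellQuiver r μ).vertex_sum, map_sum]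
  exact Finset.sum_eq_zero fun v _ => hT v

theorem mapMatrix_inverse_of_retract_derivation
    (T : (cellQuiver r μ).PathAlg →ₗ[ZMod 2] (cellQuiver r μ).PathAlg)
    (hT : ∀ x y, T (x * y) = T x * retract μ y + x * T y)
    (hv : ∀ v, T ((cellQuiver r μ).vertex v) = 0) {X Y : Mat μ} (h : X * Y = 1) (h' : Y * X = 1)
    (hX : T.mapMatrix X = 0) : T.mapMatrix Y = 0 := by
  have e := mapMatrix_mul_of_retract_derivation μ T hT X Y
  rw [h, mapMatrix_one_of_retract_derivation μ T hv, hX, zero_mul, zero_add] at e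
  rw [← one_mul (T.mapMatrix Y), ← h', mul_assoc, ← e, mul_zero]

theorem mapMatrix_ccusp_of_retract_derivation
    (T : (cellQuiver r μ).PathAlg →ₗ[ZMod 2] (cellQuiver r μ).PathAlg)
    (hv : ∀ v, T ((cellQuiver r μ).vertex v) = 0) : T.mapMatrix (ccusp μ) = 0 := by
  ext m n
  change T (cuspMatrix _ m n) = 0
  unfold cuspMatrix
  split_ifs
  · exact hv _
  · exact map_zero T

theorem homotopy_mul (X Y : Mat μ) : (cellHomotopy μ).mapMatrix (X * Y) =
    (cellHomotopy μ).mapMatrix X * (retract μ).mapMatrix Y + X * (cellHomotopy μ).mapMatrix Y :=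
  mapMatrix_mul_of_retract_derivation μ _ (cellHomotopy_mul μ) X Y

theorem homotopy_one : (cellHomotopy μ).mapMatrix (1 : Mat μ) = 0 :=
  mapMatrix_one_of_retract_derivation μ _ (cellHomotopy_vertex μ)

theorem homotopy_ccusp : (cellHomotopy μ).mapMatrix (ccusp μ) = 0 :=
  mapMatrix_ccusp_of_retract_derivation μ _ (cellHomotopy_vertex μ)

theorem homotopy_cellMatrix (c : Cell) :
    (cellHomotopy μ).mapMatrix (cellMatrix μ c) = homotopyImage μ c := by
  by_cases hc : c = .v₁
  · subst hc
    rw [cellMatrix_v₁_eq, homotopy_ccusp, homotopyImage]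
  · ext m n
    rw [LinearMap.mapMatrix_apply, Matrix.map_apply]
    by_cases h : CellRel c m n
    · rw [cellMatrix_apply μ ((prec_iff c m n).2 h), cellHomotopy_arrow]
    · rw [cellMatrix_supportedOn μ hc m n h, map_zero, homotopyImage_supported μ c m n h]

theorem homotopy_outer : (cellHomotopy μ).mapMatrix (1 + cellMatrix μ .e₂) = 0 := by
  rw [map_add, homotopy_one, homotopy_cellMatrix, homotopyImage, add_zero]

theorem homotopy_inner : (cellHomotopy μ).mapMatrix (1 + cellMatrix μ .e₃) = 0 := by
  rw [map_add, homotopy_one, homotopy_cellMatrix, homotopyImage, add_zero]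

theorem retract_outer : (retract μ).mapMatrix (1 + cellMatrix μ .e₂) = 1 + cb μ := by
  rw [map_add, map_one, retract_e₂]

theorem retract_inner : (retract μ).mapMatrix (1 + cellMatrix μ .e₃) = 1 := by
  rw [map_add, map_one, retract_e₃, add_zero]

/-- A derivation relative to the identity and the retraction that kills the matrices of the edges
is determined on `disc` by its values on the matrices of the faces. -/
theorem mapMatrix_disc_of_retract_derivation
    (T : (cellQuiver r μ).PathAlg →ₗ[ZMod 2] (cellQuiver r μ).PathAlg)
    (hT : ∀ x y, T (x * y) = T x * retract μ y + x * T y)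
    (hv : ∀ v, T ((cellQuiver r μ).vertex v) = 0)
    (h₂ : T.mapMatrix (1 + cellMatrix μ .e₂) = 0) (h₃ : T.mapMatrix (1 + cellMatrix μ .e₃) = 0) :
    T.mapMatrix (disc μ) = (1 + outerTail μ) *
      ((1 + innerTail μ) * T.mapMatrix (cellMatrix μ .f₃)) * (1 + cb μ) +
      (1 + outerTail μ) * T.mapMatrix (cellMatrix μ .f₂) := by
  have hm := mapMatrix_mul_of_retract_derivation μ T hT
  have h₂' := mapMatrix_inverse_of_retract_derivation μ T hT hv (outer_mul_tail μ)
    (tail_mul_outer μ) h₂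
  have h₃' := mapMatrix_inverse_of_retract_derivation μ T hT hv (inner_mul_tail μ)
    (tail_mul_inner μ) h₃
  rw [disc, map_add, hm, hm, hm, hm, h₂, h₂', h₃', zero_mul, zero_mul, zero_mul, zero_add, zero_add,
    zero_add, mul_zero, add_zero, retract_outer]

/-- The factors U⁻¹, V⁻¹ and E + b undo those in the value at `f₃`, and the value at `f₂` enters
twice. -/
theorem homotopy_disc : (cellHomotopy μ).mapMatrix (disc μ) = discHomotopy μ := by
  rw [mapMatrix_disc_of_retract_derivation μ _ (cellHomotopy_mul μ) (cellHomotopy_vertex μ)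
    (homotopy_outer μ) (homotopy_inner μ), homotopy_cellMatrix, homotopy_cellMatrix, homotopyImage,
    homotopyImage, ← mul_assoc (1 + innerTail μ), tail_mul_inner, one_mul, mul_assoc,
    mul_assoc _ (1 + cb μ), one_add_cb_mul_self, mul_one, mul_add, ← mul_assoc, tail_mul_outer,
    one_mul, add_assoc, ZModModule.add_self, add_zero]

/-- The defect of the homotopy equation. -/
noncomputable def homotopyDefect : (cellQuiver r μ).PathAlg →ₗ[ZMod 2] (cellQuiver r μ).PathAlg :=
  cellDeriv μ ∘ₗ cellHomotopy μ + cellHomotopy μ ∘ₗ cellDeriv μ + LinearMap.id +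
    (retract μ).toLinearMap

theorem homotopyDefect_apply (x : (cellQuiver r μ).PathAlg) : homotopyDefect μ x =
    cellDeriv μ (cellHomotopy μ x) + cellHomotopy μ (cellDeriv μ x) + x + retract μ x := rfl

theorem homotopyDefect_matrix (X : Mat μ) : (homotopyDefect μ).mapMatrix X =
    (cellDeriv μ).mapMatrix ((cellHomotopy μ).mapMatrix X) +
      (cellHomotopy μ).mapMatrix ((cellDeriv μ).mapMatrix X) + X + (retract μ).mapMatrix X := rfl

/-- The mixed terms (dx)(hy) and (hx)(dρy) arise once from dh and once from hd. -/
theorem homotopyDefect_mul (x y : (cellQuiver r μ).PathAlg) : homotopyDefect μ (x * y) =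
    homotopyDefect μ x * retract μ y + x * homotopyDefect μ y := by
  simp only [homotopyDefect_apply, cellHomotopy_mul, cellDeriv_mul, map_add, map_mul,
    retract_cellDeriv]
  rw [← sub_eq_zero, ZModModule.sub_eq_add]
  have e : ∀ x y ρx ρy hx hy dx dhx dhy hdx hdy dρy : (cellQuiver r μ).PathAlg,
      dhx * ρy + hx * dρy + (dx * hy + x * dhy) + (hdx * ρy + dx * hy + (hx * dρy + x * hdy)) +
        x * y + ρx * ρy + ((dhx + hdx + x + ρx) * ρy + x * (dhy + hdy + y + ρy)) =
      (dhx * ρy + hx * dρy + dx * hy + x * dhy + hdx * ρy + x * hdy + x * y + ρx * ρy + x * ρy) +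
      (dhx * ρy + hx * dρy + dx * hy + x * dhy + hdx * ρy + x * hdy + x * y + ρx * ρy + x * ρy) := by
    intros
    noncomm_ring
  rw [e, ZModModule.add_self]

theorem homotopyDefect_vertex (v : Fin r) :
    homotopyDefect μ ((cellQuiver r μ).vertex v) = 0 := by
  rw [homotopyDefect_apply, cellHomotopy_vertex, cellDeriv_vertex, retract_vertex, map_zero,
    map_zero, zero_add, zero_add, ZModModule.add_self]

/-- By d² = 0 both sides are dhd + d + dρ, since ρ is a chain map. -/
theorem homotopyDefect_cellDeriv (x : (cellQuiver r μ).PathAlg) :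
    homotopyDefect μ (cellDeriv μ x) = cellDeriv μ (homotopyDefect μ x) := by
  have hd : ∀ x, cellDeriv μ (cellDeriv μ x) = 0 := (cellDifferential μ).sq
  simp only [homotopyDefect_apply, map_add, hd, map_zero, add_zero, zero_add, retract_cellDeriv]

theorem defect_mul (X Y : Mat μ) : (homotopyDefect μ).mapMatrix (X * Y) =
    (homotopyDefect μ).mapMatrix X * (retract μ).mapMatrix Y + X * (homotopyDefect μ).mapMatrix Y :=
  mapMatrix_mul_of_retract_derivation μ _ (homotopyDefect_mul μ) X Y

theorem defect_ccusp : (homotopyDefect μ).mapMatrix (ccusp μ) = 0 :=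
  mapMatrix_ccusp_of_retract_derivation μ _ (homotopyDefect_vertex μ)

theorem defect_one : (homotopyDefect μ).mapMatrix (1 : Mat μ) = 0 :=
  mapMatrix_one_of_retract_derivation μ _ (homotopyDefect_vertex μ)

theorem defect_cellDiff {c : Cell} (h : (homotopyDefect μ).mapMatrix (cellMatrix μ c) = 0) :
    (homotopyDefect μ).mapMatrix (cellDiff μ c) = 0 := by
  rw [← cellDeriv_cellMatrix]
  ext m n
  refine (homotopyDefect_cellDeriv μ (cellMatrix μ c m n)).trans ?_
  rw [show homotopyDefect μ (cellMatrix μ c m n) = 0 from congrFun (congrFun h m) n, map_zero]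
  rfl

theorem defect_e₂ : (homotopyDefect μ).mapMatrix (cellMatrix μ .e₂) = 0 := by
  rw [homotopyDefect_matrix, cellDeriv_cellMatrix, cellDiff_e₂, map_add, homotopy_mul, homotopy_mul,
    homotopy_outer, homotopy_ccusp, homotopy_cellMatrix, homotopy_cellMatrix, homotopyImage,
    homotopyImage, map_zero, retract_outer, retract_e₂, crossHomotopy, mul_assoc,
    one_add_cb_mul_self, mul_one, mul_zero, mul_zero, zero_mul, add_zero, add_zero, add_zero,
    zero_add, add_assoc, ZModModule.add_self]

theorem defect_e₃ : (homotopyDefect μ).mapMatrix (cellMatrix μ .e₃) = 0 := by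
  rw [homotopyDefect_matrix, cellDeriv_cellMatrix, cellDiff, edgeFormula, map_add, homotopy_mul,
    homotopy_mul, homotopy_inner, homotopy_cellMatrix, homotopy_cellMatrix, homotopy_cellMatrix,
    homotopyImage, homotopyImage, homotopyImage, map_zero, retract_inner, retract_e₃, mul_one,
    mul_zero, zero_mul, add_zero, add_zero, zero_add, zero_add, add_assoc (cellMatrix μ .e₃),
    ZModModule.add_self, add_zero, ZModModule.add_self]

theorem defect_outer : (homotopyDefect μ).mapMatrix (1 + cellMatrix μ .e₂) = 0 := by
  rw [map_add, defect_one, defect_e₂, add_zero]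

theorem defect_inner : (homotopyDefect μ).mapMatrix (1 + cellMatrix μ .e₃) = 0 := by
  rw [map_add, defect_one, defect_e₃, add_zero]

theorem defect_f₂ : (homotopyDefect μ).mapMatrix (cellMatrix μ .f₂) = 0 := by
  -- h(A₂) = (B₂ + b)(E + b) meets ρ(F₂) = bwb, and b² = 0 leaves only B₂bwb, as in `loopTerms`.
  have hb : crossHomotopy μ * (cb μ * cw μ * cb μ) =
      cellMatrix μ .e₂ * (cb μ * cw μ * cb μ) := by
    have e : ∀ a b w : Mat μ, (a + b) * (1 + b) * (b * w * b) =
        a * (b * w * b) + ((b * b) * w * b + a * (b * b) * w * b + b * (b * b) * w * b) := by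
      intros
      noncomm_ring
    rw [crossHomotopy, e, cb_mul_cb]
    simp only [mul_zero, zero_mul, add_zero]
  rw [homotopyDefect_matrix, cellDeriv_cellMatrix, cellDiff_f₂, map_add, map_add, homotopy_mul,
    homotopy_mul, homotopy_mul, homotopy_outer, homotopy_ccusp, homotopy_cellMatrix,
    homotopy_cellMatrix, homotopy_cellMatrix, homotopyImage, homotopyImage, homotopyImage,
    retract_outer, retract_f₂, retract_ccusp, mul_zero, mul_zero, add_zero, add_zero, mul_assoc (loopTerms μ),
    one_add_cb_mul_self, mul_one, hb, loopTerms]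
  have e : ∀ d p q s f x : Mat μ, d + (p + q + s + (f + x + d + p + q + s)) + f + x =
      (d + p + q + s + f + x) + (d + p + q + s + f + x) := by
    intros
    abel
  rw [e, ZModModule.add_self]

/-- This is the contraction of the commutator with N applied to `discUpper`, whose differential is
that commutator; Nᵗ is constant. -/
theorem defect_disc : (homotopyDefect μ).mapMatrix (disc μ) = 0 := by
  have h := ccusp_ccuspT_mul μ (discUpper_isBihom μ)
  rw [homotopyDefect_matrix, homotopy_disc, cellDeriv_disc, map_add, homotopy_mul, homotopy_mul,
    homotopy_ccusp, homotopy_disc, retract_ccusp, zero_mul, zero_add, mul_zero, add_zero,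
    discHomotopy, cellDeriv_matrix_mul, cellDeriv_ccuspT, zero_mul, zero_add, cellDeriv_discUpper,
    add_assoc, ← discUpper]
  have e : ∀ a b p : Mat μ, a * (b * p + p * b) + (b * (a * p) + a * p * b) + p =
      b * (a * p) + a * (b * p) + p + (a * p * b + a * p * b) := by
    intros
    noncomm_ring
  rw [e, h, ZModModule.add_self, ZModModule.add_self, add_zero]

/-- As the defect commutes with d, its vanishing on B₂, B₃ and F₂ passes to dB₂, dB₃ and dF₂, which
contain A₂, A₃ and C₂ multiplied by the invertible ρ(U), ρ(V) and ρ(U). No separate check is needed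
on these cells. -/
theorem defect_cellMatrix (c : Cell) : (homotopyDefect μ).mapMatrix (cellMatrix μ c) = 0 := by
  have hv₂ : (homotopyDefect μ).mapMatrix (cellMatrix μ .v₂) = 0 := by
    have h := defect_cellDiff μ (defect_e₂ μ)
    rw [cellDiff_e₂, map_add, defect_mul, defect_mul, defect_outer, defect_ccusp, mul_zero, mul_zero,
      zero_mul, add_zero, add_zero, add_zero, retract_outer] at h
    exact eq_zero_of_mul_involution (one_add_cb_mul_self μ) h
  cases c
  case v₁ =>
    rw [cellMatrix_v₁_eq]
    exact defect_ccusp μ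
  case v₂ => exact hv₂
  case v₃ =>
    have h := defect_cellDiff μ (defect_e₃ μ)
    rwa [cellDiff, edgeFormula, map_add, defect_mul, defect_mul, defect_inner, hv₂, mul_zero,
      mul_zero, zero_mul, add_zero, add_zero, add_zero, retract_inner, mul_one] at h
  case e₂ => exact defect_e₂ μ
  case e₃ => exact defect_e₃ μ
  case c₁ => rw [cellMatrix_c₁, map_zero]
  case c₂ =>
    have h := defect_cellDiff μ (defect_f₂ μ)
    rw [cellDiff_f₂, map_add, map_add, defect_mul, defect_mul, defect_mul, defect_outer,
      defect_ccusp, defect_f₂, hv₂, mul_zero, mul_zero, mul_zero, zero_mul, zero_mul, add_zero,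
      add_zero, add_zero, zero_add, retract_outer] at h
    exact eq_zero_of_mul_involution (one_add_cb_mul_self μ) h
  case f₂ => exact defect_f₂ μ
  case f₃ =>
    -- On `disc` the defect is U⁻¹V⁻¹ times its value on F₃ times E + b, plus a term from F₂ that
    -- vanishes; the outer factors are invertible.
    have h := defect_disc μ
    rw [mapMatrix_disc_of_retract_derivation μ _ (homotopyDefect_mul μ) (homotopyDefect_vertex μ)
      (defect_outer μ) (defect_inner μ), defect_f₂, mul_zero, add_zero] at h
    have h1 := eq_zero_of_mul_involution (one_add_cb_mul_self μ) h
    calc (homotopyDefect μ).mapMatrix (cellMatrix μ .f₃)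
        = (1 + cellMatrix μ .e₃) * ((1 + cellMatrix μ .e₂) * ((1 + outerTail μ) *
            ((1 + innerTail μ) * (homotopyDefect μ).mapMatrix (cellMatrix μ .f₃)))) := by
          rw [← mul_assoc (1 + cellMatrix μ .e₂), outer_mul_tail, one_mul, ← mul_assoc,
            inner_mul_tail, one_mul]
      _ = 0 := by rw [h1, mul_zero, mul_zero]

theorem homotopyDefect_eq_zero (x : (cellQuiver r μ).PathAlg) : homotopyDefect μ x = 0 :=
  (cellQuiver r μ).derivation_eq_zero (AlgHom.id _ _) (retract μ) (homotopyDefect μ)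
    (homotopyDefect_mul μ) (homotopyDefect_vertex μ) (fun g : CellGen r => by
      rw [← cellMatrix_apply μ g.prec]
      exact congrFun (congrFun (defect_cellMatrix μ g.cell) g.fst) g.snd) x

theorem cellDGHom_isQuasiIso : (cellDGHom μ).IsQuasiIso :=
  (cellDGHom μ).isQuasiIso_of_homotopy (listedHom μ).toLinearMap (listedHom_listedDeriv μ)
    (cellHom_listedHom μ) (cellHomotopy μ) (homotopyDefect_eq_zero μ)

end Cellular

end ALink

/-- `C(Λ_r)` is quasi-isomorphic to a dg algebra that is freely generated by the listed
generators. -/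
theorem proposition6 (r : ℕ) (μ : ALink.MaslovPotential r) :
    ∃ (D : (ALink.listedQuiver r μ).Differential)
      (φ : (ALink.cellularDGA r μ).Hom D.dgAlgebra),
      φ.IsQuasiIso ∧
      ∀ g : ALink.ListedGen r,
        φ.toAlgHom ((ALink.cellQuiver r μ).arrow g.toCellGen) =
          (ALink.listedQuiver r μ).arrow g :=
  ⟨ALink.listedDifferential μ, ALink.cellDGHom μ, ALink.cellDGHom_isQuasiIso μ,
    ALink.cellHom_listed μ⟩
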